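/- For $f:\mathbb R\to\mathbb C$ write $f^*(k)=\int_{\mathbb R}e^{ikx}f(x)\,dx$. Let $$0<\alpha\le 1,\qquad 0<\gamma\le 2,\qquad |\theta|\le\min(\gamma,2-\gamma),\qquad \mu>0,$$ and exclude the case $\alpha=\gamma=|\theta|=1$. Consider the single-term equation $$ {}_0D_t^{\alpha}N(x,t)=\mu\;{}_xD_\theta^{\gamma}N(x,t),\qquad x\in\mathbb R,\ t>0,$$ with $${}_0D_t^{\alpha-1}N(x,0)=\delta(x),\qquad \lim_{x\to\pm\infty}N(x,t)=0\quad(t>0).$$ Here ${}_0D_t^{\alpha}u(t)=\frac1{\Gamma(n-\alpha)}\frac{d^n}{dt^n}\int_0^t(t-\tau)^{n-\alpha-1}u(\tau)\,d\tau$, $n=[\alpha]+1$, is the Riemann–Liouville derivative; ${}_0D_t^{\alpha-1}$ is the Riemann–Liouville integral of order $1-\alpha$ (the identity if $\alpha=1$), and its value at $t=0$ is the limit as $t\to0+$. The operator ${}_xD^\gamma_\theta$ is the Riesz–Feller derivative, defined by $({}_xD_\theta^\gamma f)^*(k)=-|k|^\gamma e^{i(\operatorname{sign}k)\theta\pi/2}f^*(k)$.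 A *fundamental solution* is a function $N:\mathbb R\times(0,\infty)\to\mathbb C$ that is integrable on $\mathbb R\times(0,T]$ for every $T>0$, is such that $N(\cdot,t)$ is integrable for every $t>0$ and tends to $0$ at $\pm\infty$, and satisfies the equation (at every $t>0$) and the initial condition (as $t\to0+$) in the sense of tempered distributions in $x$, that is, after pairing with each Schwartz function of $x$. Let $$H^{m,n}_{p,q}\left[z\,\middle|\,{(a_1,A_1),\dots,(a_p,A_p)\atop(b_1,B_1),\dots,(b_q,B_q)}\right]=\frac1{2\pi i}\int_{\Omega}\frac{\prod_{j=1}^m\Gamma(b_j+B_j\xi)\prod_{j=1}^n\Gamma(1-a_j-A_j\xi)}{\prod_{j=m+1}^q\Gamma(1-b_j-B_j\xi)\prod_{j=n+1}^p\Gamma(a_j+A_j\xi)}\,z^{-\xi}\,d\xi,$$ where $\Omega$ is an upward vertical line with the poles of the $\Gamma(b_j+B_j\xi)$, $j\le m$, on its left and those of the $\Gamma(1-a_j-A_j\xi)$, $j\le n$, on its right, and $1/\Gamma$ is read as an entire function (so $1/\Gamma=0$ at the poles of $\Gamma$). For $x\ne0$, $t>0$ put $$N_0(x,t)=\frac{t^{\alpha-1}}{\gamma|x|}\,H^{2,1}_{3,3}\left[\frac{|x|}{(\mu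 t^\alpha)^{1/\gamma}}\,\middle|\,{(1,1/\gamma),\ (\alpha,\alpha/\gamma),\ (1,\rho)\atop(1,1/\gamma),\ (1,1),\ (1,\rho)}\right],\qquad \rho=\rho(x)=\frac{\gamma-\theta\operatorname{sign}x}{2\gamma}.$$ Then: 1. The $H$-function in $N_0$ exists for all $x\ne0$ and $t>0$: separating vertical lines exist, and for all of them the integral converges absolutely and has the same value. 2. $N_0$, with arbitrary values at $x=0$, is a fundamental solution. 3. Every fundamental solution $N$ is given by $N_0$: for every $t>0$, $N(x,t)=N_0(x,t)$ for almost every $x\in\mathbb R$, and also for every $x\ne0$ at which $N(\cdot,t)$ is continuous. -/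

import Mathlib

open MeasureTheory Filter Topology Set
open scoped SchwartzMap

noncomputable section

namespace FracDiff

/-! ### Fox's H-function -/

/-- The Mellin-Barnes kernel
`Θ(ξ) = ∏_{j ≤ m} Γ(b_j + B_j ξ) ∏_{j ≤ n} Γ(1 - a_j - A_j ξ)
  / (∏_{m < j ≤ q} Γ(1 - b_j - B_j ξ) ∏_{n < j ≤ p} Γ(a_j + A_j ξ))`
of the H-function `H^{m,n}_{p,q}`, where `up j = (a_j, A_j)` and `lo j = (b_j, B_j)`
(indices start at `0`). Mathlib's `Gamma` is `0` at its poles, so `(Gamma s)⁻¹` is everywhere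
the entire function `1/Γ`. -/
def foxKernel (m n : ℕ) {p q : ℕ} (up : Fin p → ℂ × ℝ) (lo : Fin q → ℂ × ℝ) (ξ : ℂ) : ℂ :=
  (∏ j : Fin q, if (j : ℕ) < m then Complex.Gamma ((lo j).1 + (lo j).2 * ξ)
    else (Complex.Gamma (1 - (lo j).1 - (lo j).2 * ξ))⁻¹) *
  (∏ j : Fin p, if (j : ℕ) < n then Complex.Gamma (1 - (up j).1 - (up j).2 * ξ)
    else (Complex.Gamma ((up j).1 + (up j).2 * ξ))⁻¹)

/-- The vertical line `Re ξ = c` separates the poles of the `Γ(b_j + B_j ξ)`, `j ≤ m`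
(which lie to its left), from those of the `Γ(1 - a_j - A_j ξ)`, `j ≤ n`
(which lie to its right). -/
def SeparatesPoles (m n : ℕ) {p q : ℕ} (up : Fin p → ℂ × ℝ) (lo : Fin q → ℂ × ℝ)
    (c : ℝ) : Prop :=
  (∀ j : Fin q, (j : ℕ) < m → ∀ (ν : ℕ) (ξ : ℂ),
    (lo j).1 + (lo j).2 * ξ = -(ν : ℂ) → ξ.re < c) ∧
  (∀ j : Fin p, (j : ℕ) < n → ∀ (ν : ℕ) (ξ : ℂ),
    1 - (up j).1 - (up j).2 * ξ = -(ν : ℂ) → c < ξ.re)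

/-- The integrand `Θ(ξ) z^{-ξ}` at the point `ξ = c + i y`. -/
def foxIntegrand (m n : ℕ) {p q : ℕ} (up : Fin p → ℂ × ℝ) (lo : Fin q → ℂ × ℝ)
    (z : ℂ) (c y : ℝ) : ℂ :=
  foxKernel m n up lo (c + y * Complex.I) * z ^ (-((c : ℂ) + y * Complex.I))

/-- `H^{m,n}_{p,q}(z)` exists and has the value `w`: there are vertical lines that separate the
two families of poles, and for each of them `(1 / (2 π i)) ∫ Θ(ξ) z^{-ξ} dξ` over the line
(upwards, `dξ = i dy`) converges absolutely and is equal to `w`. -/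
def HasFoxH (m n : ℕ) {p q : ℕ} (up : Fin p → ℂ × ℝ) (lo : Fin q → ℂ × ℝ)
    (z w : ℂ) : Prop :=
  (∃ c : ℝ, SeparatesPoles m n up lo c) ∧
  ∀ c : ℝ, SeparatesPoles m n up lo c →
    Integrable (foxIntegrand m n up lo z c) ∧
    (1 / (2 * (Real.pi : ℂ))) * ∫ y : ℝ, foxIntegrand m n up lo z c y = w

open Classical in
/-- The H-function `H^{m,n}_{p,q}(z)` (with the value `0` where it does not exist in the sense
of `HasFoxH`). -/
def foxH (m n : ℕ) {p q : ℕ} (up : Fin p → ℂ × ℝ) (lo : Fin q → ℂ × ℝ) (z : ℂ) : ℂ :=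
  if h : ∃ w, HasFoxH m n up lo z w then h.choose else 0

/-! ### Riemann-Liouville operators in time -/

/-- The Riemann-Liouville integral
`(1 / Γ(β)) ∫_0^t (t - τ)^{β - 1} u(τ) dτ` of order `β > 0`, also denoted `₀D_t^{-β} u`;
the operator of order `0` is the identity. -/
def rlIntegral (β : ℝ) (u : ℝ → ℂ) (t : ℝ) : ℂ :=
  if β = 0 then u t
  else (1 / (Real.Gamma β : ℂ)) * ∫ τ in (0 : ℝ)..t, (((t - τ) ^ (β - 1) : ℝ) : ℂ) * u τ

/-- The Riemann-Liouville derivative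
`₀D_t^α u = (1 / Γ(n - α)) (d/dt)^n ∫_0^t (t - τ)^{n - α - 1} u(τ) dτ`, `n = [α] + 1`,
exists at `t` and has the value `d`. -/
def HasRLDerivAt (α : ℝ) (u : ℝ → ℂ) (d : ℂ) (t : ℝ) : Prop :=
  (∀ᶠ s in 𝓝 t, IntervalIntegrable
    (fun τ => (((s - τ) ^ (((⌊α⌋₊ + 1 : ℕ) : ℝ) - α - 1) : ℝ) : ℂ) * u τ) volume 0 s) ∧
  (∀ j < ⌊α⌋₊, ∀ᶠ s in 𝓝 t,
    DifferentiableAt ℝ (iteratedDeriv j (rlIntegral (((⌊α⌋₊ + 1 : ℕ) : ℝ) - α) u)) s) ∧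
  HasDerivAt (iteratedDeriv ⌊α⌋₊ (rlIntegral (((⌊α⌋₊ + 1 : ℕ) : ℝ) - α) u)) d t

/-! ### The Riesz-Feller derivative in space -/

/-- The Fourier transform `f^*(k) = ∫ e^{i k x} f(x) dx`. -/
def fourierStar (f : ℝ → ℂ) (k : ℝ) : ℂ :=
  ∫ x : ℝ, Complex.exp (Complex.I * k * x) * f x

/-- The symbol `ψ_γ^θ(k) = |k|^γ exp(i (sign k) θ π / 2)`. -/
def rieszFellerSymbol (γ θ k : ℝ) : ℂ :=
  ((|k| ^ γ : ℝ) : ℂ) * Complex.exp (Complex.I * (Real.sign k * θ * Real.pi / 2 : ℝ))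

/-- The Riesz-Feller derivative of order `γ` and skewness `θ` of an integrable function `f`, as
a tempered distribution: it is the distribution whose Fourier transform is the function
`-ψ_γ^θ(k) f^*(k)`, so that its value on a Schwartz function `φ` is, by Parseval's formula,
`(1 / (2 π)) ∫ (-ψ_γ^θ(k) f^*(k)) φ^*(-k) dk`. -/
def rieszFeller (γ θ : ℝ) (f : ℝ → ℂ) (φ : 𝓢(ℝ, ℂ)) : ℂ :=
  (1 / (2 * (Real.pi : ℂ))) *
    ∫ k : ℝ, (-rieszFellerSymbol γ θ k * fourierStar f k) * fourierStar φ (-k)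

/-! ### The Cauchy problem -/

/-- `⟨N(·,t), φ⟩ = ∫ N(x,t) φ(x) dx`. -/
def pairing (N : ℝ → ℝ → ℂ) (φ : 𝓢(ℝ, ℂ)) (t : ℝ) : ℂ := ∫ x : ℝ, N x t * φ x

/-- `N = N(x,t)`, `x ∈ ℝ`, `t > 0`, is a fundamental solution of
`₀D_t^α N = μ ₓD_θ^γ N`, `₀D_t^{α-1} N(x,0) = δ(x)`, `lim_{x → ±∞} N(x,t) = 0`.
It is a function, integrable in `x` at each time and integrable on `ℝ × (0,T]`; the equation
(at each time `t > 0`) and the initial condition (as `t → 0+`) hold in the sense of tempered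
distributions in `x`, as they must since the initial value is the Dirac distribution. -/
structure IsFundamentalSolution (α γ θ μ : ℝ) (N : ℝ → ℝ → ℂ) : Prop where
  integrableOn_slab : ∀ T : ℝ, 0 < T →
    IntegrableOn (fun p : ℝ × ℝ => N p.1 p.2) (univ ×ˢ Ioc 0 T)
  integrable_slice : ∀ t : ℝ, 0 < t → Integrable (fun x => N x t)
  equation : ∀ (φ : 𝓢(ℝ, ℂ)) (t : ℝ), 0 < t →
    HasRLDerivAt α (pairing N φ) (μ * rieszFeller γ θ (fun x => N x t) φ) t
  initial : ∀ φ : 𝓢(ℝ, ℂ),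
    Tendsto (rlIntegral (1 - α) (pairing N φ)) (𝓝[>] 0) (𝓝 (φ 0))
  tendsto_atTop : ∀ t : ℝ, 0 < t → Tendsto (fun x => N x t) atTop (𝓝 0)
  tendsto_atBot : ∀ t : ℝ, 0 < t → Tendsto (fun x => N x t) atBot (𝓝 0)

/-! ### The closed form -/

/-- `ρ = (γ - θ sign x) / (2 γ)`. -/
def rho (γ θ x : ℝ) : ℝ := (γ - θ * Real.sign x) / (2 * γ)

/-- The upper parameters `(1, 1/γ), (α, α/γ), (1, ρ)`. -/
def upperParams (α γ ρ : ℝ) : Fin 3 → ℂ × ℝ := ![(1, 1 / γ), ((α : ℂ), α / γ), (1, ρ)]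

/-- The lower parameters `(1, 1/γ), (1, 1), (1, ρ)`. -/
def lowerParams (γ ρ : ℝ) : Fin 3 → ℂ × ℝ := ![(1, 1 / γ), (1, 1), (1, ρ)]

/-- The argument `|x| / (μ t^α)^{1/γ}`. -/
def similarity (α γ μ x t : ℝ) : ℝ := |x| / (μ * t ^ α) ^ (1 / γ)

/-- `t^{α-1} / (γ |x|) · H^{2,1}_{3,3}[ |x| / (μ t^α)^{1/γ} ]`. -/
def closedForm (α γ θ μ x t : ℝ) : ℂ :=
  ((t ^ (α - 1) / (γ * |x|) : ℝ) : ℂ) *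
    foxH 2 1 (upperParams α γ (rho γ θ x)) (lowerParams γ (rho γ θ x)) (similarity α γ μ x t : ℂ)

end FracDiff

end

/-! Everything is reduced to one scalar identity for each frequency `k`. Write ψ for the
Riesz–Feller symbol and E_{α,a} for the Mittag-Leffler function, which enters only through its
Mellin–Barnes integral `mlBarnes`. The heart of the existence proof is that the closed form has
Fourier transform t^{α-1} E_{α,α}(-μ ψ(k) t^α) (`EqParams.fourierStar_closedForm`).

Existence of the H-function. The pole of Γ(-ξ/γ) at 0 is cancelled by a zero of 1/Γ(-ρξ), so away
from 0 the Fox kernel equals `regKernel`, which is holomorphic on a strip around the imaginary axis.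
Exponential bounds for Γ and 1/Γ on strips show that it decays like exp(-δ|Im ξ|) provided ρ <
(1-α/2)/γ + 1/2. For both signs of x this is the condition |θ| < 2-α, and the excluded case α = γ =
|θ| = 1 is exactly where it fails. Cauchy's theorem makes the integral independent of the line;
lines on both sides of 0 give the bounds r^{±γ/4}, hence integrability in x.

The Fourier transform. On a half-line x^{-ξ-1} transforms into Γ(-ξ)(∓ik)^ξ. The reflection formula
leaves sin(πρξ)/sin(πξ), and the contributions of x > 0 and x < 0 add up through a trigonometric
identity to the pure phase that makes the argument μ ψ(k) t^α.

The closed form solves the problem. Beta integrals under the Mellin–Barnes integral give the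
Riemann–Liouville integrals of the transform (`integral_rl_mlBarnes`). The recurrence E_{α,1}(-z) =
1 - z E_{α,1+α}(-z), obtained by moving the line across the pole at 0 (`mlBarnes_one_eq`), then
reads: the integral of order 1-α of the transform is 1 - μ ψ(k) times its time primitive. This is
the equation together with the initial value δ, integrated once in time. Pairing with a test
function, then differentiating, yields the equation and the initial condition.

Uniqueness. A fundamental solution is assumed only integrable in time, so the argument runs on the
time primitive W(k,t) of its Fourier transform, which is jointly continuous. Integrating the
equation and removing the test function gives, for every k, the weakly singular Volterra equation
Γ(α) W(k,t) = t^α/α - μ ψ(k) ∫_0^t (t-s)^{α-1} W(k,s) ds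
(`IsFundamentalSolution.starPrimitive_volterra`), whose continuous solution is unique
(`eq_zero_of_volterra`). Because the equation holds at every t > 0, the primitive in time can be
differentiated at every t, so the transforms of two solutions agree at every time for k ≠ 0, and the
solutions agree almost everywhere in x. -/

noncomputable section

namespace FracDiff

/-! ### The Laplace transform of a complex power -/

theorem norm_ofReal_cpow_mul_cexp_neg_mul {a r : ℂ} {t : ℝ} (ht : 0 < t) :
    ‖(t : ℂ) ^ a * Complex.exp (-(r * t))‖ = t ^ a.re * Real.exp (-(r.re * t)) := by
  rw [norm_mul, Complex.norm_cpow_eq_rpow_re_of_pos ht, Complex.norm_exp]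
  simp

theorem aestronglyMeasurable_cpow_mul_cexp_neg_mul (a r : ℂ) :
    AEStronglyMeasurable (fun t : ℝ => (t : ℂ) ^ a * Complex.exp (-(r * t)))
      (volume.restrict (Ioi 0)) := by
  refine ContinuousOn.aestronglyMeasurable (fun t ht => ?_) measurableSet_Ioi
  have ht' : (0 : ℝ) < t := ht
  refine ContinuousAt.continuousWithinAt ?_
  exact (Complex.continuousAt_ofReal_cpow_const _ _ (Or.inr ht'.ne')).mul (by fun_prop)

theorem integrableOn_cpow_mul_cexp_neg_mul {a r : ℂ} (ha : 0 < a.re) (hr : 0 < r.re) :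
    IntegrableOn (fun t : ℝ => (t : ℂ) ^ (a - 1) * Complex.exp (-(r * t))) (Ioi 0) := by
  have h := integrableOn_rpow_mul_exp_neg_mul_rpow (s := a.re - 1) (p := 1) (b := r.re)
    (by linarith) one_pos hr
  refine h.mono' (aestronglyMeasurable_cpow_mul_cexp_neg_mul _ _) ?_
  refine (ae_restrict_iff' measurableSet_Ioi).2 (ae_of_all _ fun t ht => ?_)
  rw [norm_ofReal_cpow_mul_cexp_neg_mul ht]
  simp

/-- Both sides are holomorphic in `r` on the right half-plane and agree for real `r`, in particular
at the points 1 + 1/(n+1), which accumulate at 1; the identity theorem does the rest. -/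
theorem integral_cpow_mul_cexp_neg_mul {a r : ℂ} (ha : 0 < a.re) (hr : 0 < r.re) :
    ∫ t : ℝ in Ioi 0, (t : ℂ) ^ (a - 1) * Complex.exp (-(r * t)) =
      (1 / r) ^ a * Complex.Gamma a := by
  set F : ℂ → ℂ := fun r => ∫ t : ℝ in Ioi 0, (t : ℂ) ^ (a - 1) * Complex.exp (-(r * t)) with hF
  set U : Set ℂ := {r : ℂ | 0 < r.re} with hU
  have hUo : IsOpen U := isOpen_lt continuous_const Complex.continuous_re
  have hFd : DifferentiableOn ℂ F U := by
    intro r₀ hr₀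
    have hr₀' : 0 < r₀.re := hr₀
    have hball : ∀ z ∈ Metric.ball r₀ (r₀.re / 2), r₀.re / 2 < z.re := by
      intro z hz
      have h1 := Complex.abs_re_le_norm (z - r₀)
      have h2 : ‖z - r₀‖ < r₀.re / 2 := by simpa [dist_eq_norm] using hz
      have := (abs_lt.1 (h1.trans_lt h2)).1
      simp only [Complex.sub_re] at this
      linarith
    have hb := integrableOn_rpow_mul_exp_neg_mul_rpow (s := a.re) (p := 1) (b := r₀.re / 2)
      (by linarith) one_pos (by linarith)
    have key := hasDerivAt_integral_of_dominated_loc_of_deriv_le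
      (μ := volume.restrict (Ioi (0 : ℝ)))
      (F := fun (z : ℂ) (t : ℝ) => (t : ℂ) ^ (a - 1) * Complex.exp (-(z * t)))
      (F' := fun (z : ℂ) (t : ℝ) => (t : ℂ) ^ (a - 1) * (Complex.exp (-(z * t)) * (-t)))
      -- Differentiating in `z` brings down a factor `t`, which raises the exponent from `a.re - 1`
      -- to `a.re`; on the ball the damping rate stays above `r₀.re / 2`.
      (bound := fun t : ℝ => t ^ a.re * Real.exp (-(r₀.re / 2) * t ^ (1 : ℝ)))
      (Metric.ball_mem_nhds r₀ (by linarith : 0 < r₀.re / 2))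
      (Eventually.of_forall fun z => aestronglyMeasurable_cpow_mul_cexp_neg_mul _ _)
      (integrableOn_cpow_mul_cexp_neg_mul ha hr₀)
      (by
        have h := aestronglyMeasurable_cpow_mul_cexp_neg_mul (a - 1) r₀
        have h2 : AEStronglyMeasurable (fun t : ℝ => (-(t : ℂ))) (volume.restrict (Ioi 0)) :=
          (by fun_prop : Continuous fun t : ℝ => (-(t : ℂ))).aestronglyMeasurable
        exact (h.mul h2).congr (ae_of_all _ fun t => by simp [mul_assoc]))
      (by
        refine (ae_restrict_iff' measurableSet_Ioi).2 (ae_of_all _ fun t ht z hz => ?_)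
        have ht' : (0 : ℝ) < t := ht
        rw [← mul_assoc, norm_mul, norm_ofReal_cpow_mul_cexp_neg_mul ht', norm_neg,
          Complex.norm_real, Real.norm_of_nonneg ht'.le, Real.rpow_one, Complex.sub_re,
          Complex.one_re, Real.rpow_sub_one ht'.ne']
        have : t ^ a.re / t * Real.exp (-(z.re * t)) * t = t ^ a.re * Real.exp (-(z.re * t)) := by
          field_simp
        rw [this]
        have := hball z hz
        gcongr
        nlinarith)
      hb
      (by
        refine ae_of_all _ fun t z _ => ?_
        have h1 : HasDerivAt (fun z : ℂ => -(z * t)) (-(t : ℂ)) z := by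
          simpa using! ((hasDerivAt_id z).mul_const (t : ℂ)).neg
        exact h1.cexp.const_mul _)
    exact key.2.differentiableAt.differentiableWithinAt
  have hGd : DifferentiableOn ℂ (fun r : ℂ => (1 / r) ^ a * Complex.Gamma a) U := by
    intro r hr
    have hr' : 0 < r.re := hr
    have hr0 : r ≠ 0 := by rintro rfl; simp at hr'
    have hs : 1 / r ∈ Complex.slitPlane := by
      left
      rw [one_div, Complex.inv_re]
      exact div_pos hr' (Complex.normSq_pos.2 hr0)
    exact ((((differentiableAt_const 1).div differentiableAt_id hr0).cpow_const hs).mul_const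
      _).differentiableWithinAt
  have hconn : IsPreconnected U := (convex_halfSpace_re_gt 0).isPreconnected
  have heq : EqOn F (fun r : ℂ => (1 / r) ^ a * Complex.Gamma a) U := by
    refine (hFd.analyticOnNhd hUo).eqOn_of_preconnected_of_frequently_eq
      (hGd.analyticOnNhd hUo) hconn (z₀ := 1) (by simp [hU]) ?_
    have ht : Tendsto (fun n : ℕ => (((1 + 1 / ((n : ℝ) + 1) : ℝ)) : ℂ)) atTop (𝓝[≠] 1) := by
      refine tendsto_nhdsWithin_iff.2 ⟨?_, Eventually.of_forall fun n => ?_⟩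
      · have := tendsto_one_div_add_atTop_nhds_zero_nat (𝕜 := ℝ)
        have h2 := (this.const_add 1)
        rw [add_zero] at h2
        exact_mod_cast (Complex.continuous_ofReal.tendsto 1).comp h2
      · have : (0 : ℝ) < 1 / ((n : ℝ) + 1) := by positivity
        simp only [mem_compl_iff, mem_singleton_iff]
        intro h
        have h3 : (1 + 1 / ((n : ℝ) + 1) : ℝ) = 1 := by exact_mod_cast h
        linarith
    refine ht.frequently (Frequently.of_forall fun n => ?_)
    have h0 : (0 : ℝ) < 1 + 1 / ((n : ℝ) + 1) := by positivity
    exact Complex.integral_cpow_mul_exp_neg_mul_Ioi ha h0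
  exact heq hr

/-! ### Bounds for the Gamma function on vertical strips -/

/-- Rotate the Laplace integral: with `r = exp (i b)` it represents Γ(s) as exp(ibs) times an
integral dominated by a real Gamma integral of rate cos b. The prefactor has modulus exp(-b Im s),
and b = ±η is chosen with the sign of Im s. -/
theorem norm_Gamma_le {s : ℂ} (hs : 0 < s.re) {η : ℝ} (h0 : 0 ≤ η) (h1 : η < Real.pi / 2) :
    ‖Complex.Gamma s‖ ≤
      Real.Gamma s.re * (1 / Real.cos η) ^ s.re * Real.exp (-(η * |s.im|)) := by
  have hcos : 0 < Real.cos η := Real.cos_pos_of_mem_Ioo ⟨by linarith [Real.pi_pos], h1⟩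
  have main : ∀ b : ℝ, |b| = η →
      ‖Complex.Gamma s‖ ≤
        Real.Gamma s.re * (1 / Real.cos η) ^ s.re * Real.exp (-(b * s.im)) := by
    intro b hb
    have hcb : Real.cos b = Real.cos η := by rw [← hb, Real.cos_abs]
    have hre : (Complex.exp (b * Complex.I)).re = Real.cos η := by
      rw [Complex.exp_ofReal_mul_I_re, hcb]
    have key := integral_cpow_mul_cexp_neg_mul (a := s) (r := Complex.exp (b * Complex.I)) hs
      (by rw [hre]; exact hcos)
    have hb' : -Real.pi < -b ∧ -b ≤ Real.pi := by
      have := abs_le.1 hb.le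
      constructor <;> linarith [Real.pi_pos]
    have hpow : (1 / Complex.exp (b * Complex.I)) ^ s = Complex.exp (-(b * Complex.I) * s) := by
      rw [one_div, ← Complex.exp_neg, Complex.cpow_def_of_ne_zero (Complex.exp_ne_zero _),
        Complex.log_exp (by simpa using hb'.1) (by simpa using hb'.2)]
    rw [hpow] at key
    have hG : Complex.Gamma s = Complex.exp (b * Complex.I * s) *
        ∫ t : ℝ in Ioi 0, (t : ℂ) ^ (s - 1) *
          Complex.exp (-(Complex.exp (b * Complex.I) * t)) := by
      rw [key, ← mul_assoc, ← Complex.exp_add]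
      simp
    have hint : ‖∫ t : ℝ in Ioi 0, (t : ℂ) ^ (s - 1) *
          Complex.exp (-(Complex.exp (b * Complex.I) * t))‖ ≤
        (1 / Real.cos η) ^ s.re * Real.Gamma s.re := by
      rw [← Real.integral_rpow_mul_exp_neg_mul_Ioi hs hcos]
      refine (norm_integral_le_integral_norm _).trans_eq ?_
      refine setIntegral_congr_fun measurableSet_Ioi fun t ht => ?_
      rw [norm_ofReal_cpow_mul_cexp_neg_mul ht, hre]
      simp
    rw [hG, norm_mul, Complex.norm_exp]
    have : (b * Complex.I * s).re = -(b * s.im) := by simp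
    rw [this]
    calc _ ≤ Real.exp (-(b * s.im)) * ((1 / Real.cos η) ^ s.re * Real.Gamma s.re) := by gcongr
      _ = _ := by ring
  rcases le_total 0 s.im with h | h
  · have := main η (abs_of_nonneg h0)
    rwa [← abs_of_nonneg h] at this
  · have := main (-η) (by rw [abs_neg, abs_of_nonneg h0])
    rwa [neg_mul, ← mul_neg, ← abs_of_nonpos h] at this

theorem exists_norm_Gamma_le {a : ℝ} (b : ℝ) (ha : 0 < a) {η : ℝ} (h0 : 0 ≤ η)
    (h1 : η < Real.pi / 2) :
    ∃ C : ℝ, 0 < C ∧ ∀ s : ℂ, a ≤ s.re → s.re ≤ b →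
      ‖Complex.Gamma s‖ ≤ C * Real.exp (-(η * |s.im|)) := by
  have hcos : 0 < Real.cos η := Real.cos_pos_of_mem_Ioo ⟨by linarith [Real.pi_pos], h1⟩
  have hcont : ContinuousOn (fun σ : ℝ => Real.Gamma σ * (1 / Real.cos η) ^ σ) (Icc a b) := by
    intro σ hσ
    have h : 0 < σ := ha.trans_le hσ.1
    refine ContinuousAt.continuousWithinAt (ContinuousAt.mul ?_ ?_)
    · refine (Real.differentiableAt_Gamma fun m => ?_).continuousAt
      have : (0 : ℝ) ≤ m := m.cast_nonneg
      linarith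
    · exact Real.continuousAt_const_rpow (by positivity)
  obtain ⟨C, hC⟩ := isCompact_Icc.exists_bound_of_continuousOn hcont
  refine ⟨max C 1, by positivity, fun s hs1 hs2 => ?_⟩
  refine (norm_Gamma_le (ha.trans_le hs1) h0 h1).trans ?_
  gcongr
  exact ((le_abs_self _).trans (hC s.re ⟨hs1, hs2⟩)).trans (le_max_left _ _)

theorem norm_sin_le_exp (z : ℂ) : ‖Complex.sin z‖ ≤ Real.exp |z.im| := by
  rw [Complex.sin, norm_div, norm_mul, Complex.norm_I, mul_one]
  have h1 : ‖Complex.exp (-z * Complex.I)‖ ≤ Real.exp |z.im| := by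
    rw [Complex.norm_exp]; simpa using le_abs_self z.im
  have h2 : ‖Complex.exp (z * Complex.I)‖ ≤ Real.exp |z.im| := by
    rw [Complex.norm_exp]; simpa using neg_le_abs z.im
  have h3 := norm_sub_le (Complex.exp (-z * Complex.I)) (Complex.exp (z * Complex.I))
  rw [div_le_iff₀ (by simp)]
  simp only [Complex.norm_ofNat]
  linarith

/-- The functional equation Γ(s) = Γ(s+1)/s carries the bound to the left. The condition |Im s| ≥ 1
keeps away from the poles and gives |s| ≥ 1, so no constant is lost. -/
theorem exists_norm_Gamma_shift_le (b : ℝ) (N : ℕ) : ∀ {a : ℝ} (_ : 0 < a + N) {η : ℝ}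
    (_ : 0 ≤ η) (_ : η < Real.pi / 2),
    ∃ C : ℝ, 0 < C ∧ ∀ s : ℂ, a ≤ s.re → s.re ≤ b → 1 ≤ |s.im| →
      ‖Complex.Gamma s‖ ≤ C * Real.exp (-(η * |s.im|)) := by
  induction N generalizing b with
  | zero =>
    intro a ha η h0 h1
    obtain ⟨C, hC, h⟩ := exists_norm_Gamma_le b (by simpa using ha) h0 h1
    exact ⟨C, hC, fun s h2 h3 _ => h s h2 h3⟩
  | succ N ih =>
    intro a ha η h0 h1
    obtain ⟨C, hC, h⟩ := ih (b + 1) (a := a + 1) (by push_cast at ha; linarith) h0 h1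
    refine ⟨C, hC, fun s h2 h3 h4 => ?_⟩
    have hs : s ≠ 0 := by rintro rfl; norm_num at h4
    have h5 := h (s + 1) (by simpa using h2) (by simpa using h3) (by simpa using h4)
    rw [Complex.Gamma_add_one s hs, norm_mul] at h5
    have h6 : 1 ≤ ‖s‖ := h4.trans (Complex.abs_im_le_norm s)
    simp only [Complex.add_im, Complex.one_im, add_zero] at h5
    nlinarith [norm_nonneg (Complex.Gamma s)]

/-- By reflection 1/Γ(s) = Γ(1-s) sin(πs)/π: the sine costs exp(π|Im s|) and Γ(1-s) gives back any
rate below π/2. For |Im s| ≤ 1 the entire function 1/Γ is bounded by compactness. -/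
theorem exists_norm_Gamma_inv_le (a b : ℝ) {η : ℝ} (h1 : Real.pi / 2 < η) :
    ∃ C : ℝ, 0 < C ∧ ∀ s : ℂ, a ≤ s.re → s.re ≤ b →
      ‖(Complex.Gamma s)⁻¹‖ ≤ C * Real.exp (η * |s.im|) := by
  have hpi := Real.pi_pos
  obtain ⟨N, hN⟩ := exists_nat_gt (b - 1)
  -- The truncation at 0 is for η > π, since the bound for Γ requires a nonnegative rate.
  set η' : ℝ := max 0 (Real.pi - η) with hη'
  obtain ⟨C, hC, h⟩ := exists_norm_Gamma_shift_le (1 - a) N (a := 1 - b) (by linarith)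
    (le_max_left 0 (Real.pi - η)) (max_lt (by linarith) (by linarith))
  have hK : IsCompact (Icc a b ×ℂ Icc (-1) 1) := isCompact_Icc.reProdIm isCompact_Icc
  obtain ⟨D, hD⟩ := hK.exists_bound_of_continuousOn
    (Complex.differentiable_one_div_Gamma.continuous.continuousOn)
  refine ⟨max C D, lt_max_of_lt_left hC, fun s h2 h3 => ?_⟩
  rcases le_total |s.im| 1 with h4 | h4
  · have := hD s ⟨⟨h2, h3⟩, abs_le.1 h4⟩
    calc ‖(Complex.Gamma s)⁻¹‖ ≤ max C D * 1 := by
          rw [mul_one]; exact this.trans (le_max_right _ _)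
      _ ≤ _ := by
          gcongr
          exact Real.one_le_exp (mul_nonneg (by linarith) (abs_nonneg _))
  · have him : s.im ≠ 0 := by intro h; rw [h] at h4; norm_num at h4
    have hsin : Complex.sin (Real.pi * s) ≠ 0 := by
      rw [Complex.sin_ne_zero_iff]
      intro k hk
      have : (Real.pi * s : ℂ).im = ((k : ℂ) * Real.pi).im := by rw [hk]
      simp [hpi.ne', him] at this
    have hrefl := Complex.Gamma_mul_Gamma_one_sub s
    have hg : Complex.Gamma s ≠ 0 := by
      intro h0
      rw [h0, zero_mul] at hrefl
      have := div_ne_zero (Complex.ofReal_ne_zero.2 hpi.ne') hsin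
      exact this hrefl.symm
    have hinv : (Complex.Gamma s)⁻¹ =
        Complex.Gamma (1 - s) * Complex.sin (Real.pi * s) / Real.pi := by
      have hpic : (Real.pi : ℂ) ≠ 0 := Complex.ofReal_ne_zero.2 hpi.ne'
      rw [eq_div_iff hsin] at hrefl
      field_simp
      rw [mul_comm s]
      linear_combination -hrefl
    have h5 := h (1 - s) (by simp; linarith) (by simp; linarith) (by simpa using h4)
    have h6 := norm_sin_le_exp (Real.pi * s)
    have h7 : (Real.pi * s : ℂ).im = Real.pi * s.im := by simp
    rw [h7, abs_mul, abs_of_pos hpi] at h6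
    simp only [Complex.sub_im, Complex.one_im, zero_sub, abs_neg] at h5
    rw [hinv, norm_div, norm_mul, Complex.norm_real, Real.norm_of_nonneg hpi.le]
    calc _ ≤ ‖Complex.Gamma (1 - s)‖ * ‖Complex.sin (Real.pi * s)‖ / 1 := by
          gcongr; linarith [Real.pi_gt_three]
      _ ≤ (C * Real.exp (-(η' * |s.im|))) * Real.exp (Real.pi * |s.im|) := by
          rw [div_one]; gcongr
      _ = C * Real.exp ((Real.pi - η') * |s.im|) := by
          rw [mul_assoc, ← Real.exp_add]; ring_nf
      _ ≤ _ := by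
          gcongr
          · exact le_max_left _ _
          · have := le_max_right 0 (Real.pi - η); linarith

/-! ### Integrals over vertical lines -/

theorem integrable_exp_neg_mul_abs {δ : ℝ} (hδ : 0 < δ) :
    Integrable fun y : ℝ => Real.exp (-(δ * |y|)) := by
  have h1 : IntegrableOn (fun y : ℝ => Real.exp (-(δ * |y|))) (Ioi 0) := by
    refine (exp_neg_integrableOn_Ioi 0 hδ).congr_fun (fun y hy => ?_) measurableSet_Ioi
    have : (0 : ℝ) < y := hy
    simp [abs_of_pos this]
  have h2 : IntegrableOn (fun y : ℝ => Real.exp (-(δ * |y|))) (Iic 0) := by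
    rw [← integrable_indicator_iff measurableSet_Iic]
    have h3 := ((integrableOn_Ici_iff_integrableOn_Ioi (b := (0 : ℝ))).2 h1).integrable_indicator
      measurableSet_Ici
    refine h3.comp_neg.congr (ae_of_all _ fun y => ?_)
    simp [indicator]
  rw [← integrableOn_univ, ← Iic_union_Ioi (a := (0 : ℝ))]
  exact h2.union h1

theorem continuous_vertical {f : ℂ → ℂ} {c : ℝ}
    (hf : ∀ s : ℂ, s.re = c → ContinuousAt f s) :
    Continuous fun y : ℝ => f (c + y * Complex.I) := by
  refine continuous_iff_continuousAt.2 fun y => ?_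
  exact ContinuousAt.comp (f := fun y : ℝ => (c + y * Complex.I : ℂ)) (hf _ (by simp))
    (by fun_prop)

theorem integrable_vertical {f : ℂ → ℂ} {c C δ : ℝ} (hδ : 0 < δ)
    (hf : ∀ s : ℂ, s.re = c → ContinuousAt f s)
    (hb : ∀ s : ℂ, s.re = c → ‖f s‖ ≤ C * Real.exp (-(δ * |s.im|))) :
    Integrable fun y : ℝ => f (c + y * Complex.I) := by
  refine ((integrable_exp_neg_mul_abs hδ).const_mul C).mono'
    (continuous_vertical hf).aestronglyMeasurable (ae_of_all _ fun y => ?_)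
  simpa using hb (c + y * Complex.I) (by simp)

/-- Cauchy's theorem on a rectangle of height 2T whose horizontal sides vanish in the limit. It
speaks of symmetric truncations because it is also applied to a divided difference that decays only
like 1/|s|, whose full vertical integrals need not converge absolutely. -/
theorem tendsto_vertical_sub {f : ℂ → ℂ} {a b : ℝ} (hab : a ≤ b)
    (hf : ∀ s : ℂ, a ≤ s.re → s.re ≤ b → DifferentiableAt ℂ f s)
    {B : ℝ → ℝ} (hB : Tendsto B atTop (𝓝 0))
    (hfB : ∀ s : ℂ, a ≤ s.re → s.re ≤ b → 1 ≤ |s.im| → ‖f s‖ ≤ B |s.im|) :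
    Tendsto (fun T : ℝ => (∫ y in -T..T, f (b + y * Complex.I)) -
      ∫ y in -T..T, f (a + y * Complex.I)) atTop (𝓝 0) := by
  have hlim : Tendsto (fun T => B T * |b - a| + B T * |b - a|) atTop (𝓝 0) := by
    simpa using (hB.mul_const |b - a|).add (hB.mul_const |b - a|)
  refine squeeze_zero_norm' ?_ hlim
  filter_upwards [eventually_ge_atTop 1] with T hT
  have key := Complex.integral_boundary_rect_eq_zero_of_differentiableOn f
    (a + (-T : ℝ) * Complex.I) (b + (T : ℝ) * Complex.I) (by
      intro s hs
      rw [Complex.mem_reProdIm] at hs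
      simp only [Complex.add_re, Complex.ofReal_re, Complex.mul_re, Complex.I_re, mul_zero,
        Complex.ofReal_im, Complex.I_im, mul_one, sub_self, add_zero, uIcc_of_le hab] at hs
      exact (hf s hs.1.1 hs.1.2).differentiableWithinAt)
  simp only [Complex.add_re, Complex.ofReal_re, Complex.mul_re, Complex.I_re, mul_zero,
    Complex.ofReal_im, Complex.I_im, mul_one, sub_self, add_zero, Complex.add_im,
    Complex.mul_im, zero_add] at key
  have hseg : ∀ u : ℝ, |u| = T →
      ‖∫ x : ℝ in a..b, f (x + (u : ℝ) * Complex.I)‖ ≤ B T * |b - a| := by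
    intro u hu
    refine intervalIntegral.norm_integral_le_of_norm_le_const fun x hx => ?_
    rw [uIoc_of_le hab] at hx
    have := hfB (x + u * Complex.I) (by simpa using hx.1.le) (by simpa using hx.2)
      (by simpa [hu] using hT)
    simpa [hu] using this
  have h1 := hseg T (abs_of_nonneg (by linarith))
  have h2 := hseg (-T) (by rw [abs_neg, abs_of_nonneg (by linarith)])
  have h3 : Complex.I * ((∫ y in -T..T, f (b + y * Complex.I)) -
      ∫ y in -T..T, f (a + y * Complex.I)) =
      (∫ x : ℝ in a..b, f (x + (T : ℝ) * Complex.I)) -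
        ∫ x : ℝ in a..b, f (x + (-T : ℝ) * Complex.I) := by
    simp only [smul_eq_mul] at key
    linear_combination key
  have h4 : ‖(∫ y in -T..T, f (b + y * Complex.I)) -
      ∫ y in -T..T, f (a + y * Complex.I)‖ = ‖Complex.I * ((∫ y in -T..T, f (b + y * Complex.I)) -
      ∫ y in -T..T, f (a + y * Complex.I))‖ := by simp
  rw [h4, h3]
  exact (norm_sub_le _ _).trans (add_le_add h1 h2)

theorem tendsto_integral_symm {f : ℝ → ℂ} (hf : Integrable f) :
    Tendsto (fun T : ℝ => ∫ y in -T..T, f y) atTop (𝓝 (∫ y, f y)) :=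
  intervalIntegral_tendsto_integral hf tendsto_neg_atTop_atBot tendsto_id

/-- Two vertical integrals agree when the integrand is holomorphic and decays exponentially in
the strip between the lines. -/
theorem integral_vertical_eq {f : ℂ → ℂ} {a b C δ : ℝ} (hab : a ≤ b) (hδ : 0 < δ)
    (hf : ∀ s : ℂ, a ≤ s.re → s.re ≤ b → DifferentiableAt ℂ f s)
    (hb : ∀ s : ℂ, a ≤ s.re → s.re ≤ b → ‖f s‖ ≤ C * Real.exp (-(δ * |s.im|))) :
    ∫ y : ℝ, f (a + y * Complex.I) = ∫ y : ℝ, f (b + y * Complex.I) := by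
  have hB : Tendsto (fun T : ℝ => C * Real.exp (-(δ * T))) atTop (𝓝 0) := by
    have : Tendsto (fun T : ℝ => Real.exp (-(δ * T))) atTop (𝓝 0) :=
      Real.tendsto_exp_neg_atTop_nhds_zero.comp (tendsto_id.const_mul_atTop hδ)
    simpa using this.const_mul C
  have h := tendsto_vertical_sub hab hf hB (fun s h1 h2 _ => hb s h1 h2)
  have ha' : Integrable fun y : ℝ => f (a + y * Complex.I) :=
    integrable_vertical hδ (fun s hs => (hf s hs.ge (hs.le.trans hab)).continuousAt)
      (fun s hs => hb s hs.ge (hs.le.trans hab))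
  have hb' : Integrable fun y : ℝ => f (b + y * Complex.I) :=
    integrable_vertical hδ (fun s hs => (hf s (hab.trans hs.ge) hs.le).continuousAt)
      (fun s hs => hb s (hab.trans hs.ge) hs.le)
  have h' := (tendsto_integral_symm hb').sub (tendsto_integral_symm ha')
  exact (sub_eq_zero.1 (tendsto_nhds_unique h' h)).symm

theorem ofReal_add_mul_I_ne_zero {c : ℝ} (hc : c ≠ 0) (y : ℝ) :
    (c + y * Complex.I : ℂ) ≠ 0 := by
  intro h
  have := congrArg Complex.re h
  simp [hc] at this

/-- The primitive is arctan(y/c) - (i/2) log(c² + y²); the logarithm is even in y and drops out of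
the symmetric integral. -/
theorem integral_inv_vertical {c : ℝ} (hc : c ≠ 0) (T : ℝ) :
    ∫ y in -T..T, (c + y * Complex.I : ℂ)⁻¹ = 2 * (Real.arctan (T / c) : ℂ) := by
  have hpos : ∀ y : ℝ, c ^ 2 + y ^ 2 ≠ 0 := fun y => by positivity
  have hderiv : ∀ y : ℝ, HasDerivAt
      (fun y : ℝ => ((Real.arctan (y / c) : ℝ) : ℂ) -
        Complex.I / 2 * ((Real.log (c ^ 2 + y ^ 2) : ℝ) : ℂ)) (c + y * Complex.I : ℂ)⁻¹ y := by
    intro y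
    have h1 : HasDerivAt (fun y : ℝ => Real.arctan (y / c)) (c / (c ^ 2 + y ^ 2)) y := by
      have := ((hasDerivAt_id y).div_const c).arctan
      refine this.congr_deriv ?_
      have := hpos y
      have h2 : c ^ 2 * (1 + (y / c) ^ 2) = c ^ 2 + y ^ 2 := by field_simp
      simp only [id]
      rw [← h2]
      have h3 : 1 + (y / c) ^ 2 ≠ 0 := by positivity
      field_simp
    have h2 : HasDerivAt (fun y : ℝ => Real.log (c ^ 2 + y ^ 2)) (2 * y / (c ^ 2 + y ^ 2)) y := by
      have := ((hasDerivAt_pow 2 y).const_add (c ^ 2)).log (hpos y)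
      simpa using this
    have := h1.ofReal_comp.sub (h2.ofReal_comp.const_mul (Complex.I / 2))
    refine this.congr_deriv ?_
    have h3 : (c + y * Complex.I : ℂ) * (c - y * Complex.I) = ((c ^ 2 + y ^ 2 : ℝ) : ℂ) := by
      push_cast
      linear_combination (-(y : ℂ) ^ 2) * Complex.I_sq
    have h4 := ofReal_add_mul_I_ne_zero hc y
    have h5 : ((c ^ 2 + y ^ 2 : ℝ) : ℂ) ≠ 0 := Complex.ofReal_ne_zero.2 (hpos y)
    rw [inv_eq_of_mul_eq_one_right (a := (c + y * Complex.I : ℂ))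
      (b := (c - y * Complex.I) / ((c ^ 2 + y ^ 2 : ℝ) : ℂ)) (by rw [← mul_div_assoc, h3, div_self h5])]
    push_cast at h5 ⊢
    field_simp
  rw [intervalIntegral.integral_eq_sub_of_hasDerivAt (fun y _ => hderiv y)]
  · simp only [neg_div, Real.arctan_neg, neg_sq]
    push_cast
    ring
  · refine Continuous.intervalIntegrable ?_ _ _
    exact Continuous.inv₀ (by fun_prop) (ofReal_add_mul_I_ne_zero hc)

/-- The residue theorem for a simple pole at `0` between two vertical lines. -/
theorem integral_vertical_sub_eq {g : ℂ → ℂ} {a b C δ : ℝ} (ha : a < 0) (hb0 : 0 < b)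
    (hδ : 0 < δ)
    (hg : ∀ s : ℂ, a ≤ s.re → s.re ≤ b → DifferentiableAt ℂ g s)
    (hb : ∀ s : ℂ, a ≤ s.re → s.re ≤ b → ‖g s‖ ≤ C * Real.exp (-(δ * |s.im|))) :
    (∫ y : ℝ, g (b + y * Complex.I) / (b + y * Complex.I)) -
      ∫ y : ℝ, g (a + y * Complex.I) / (a + y * Complex.I) = 2 * Real.pi * g 0 := by
  have hC : 0 ≤ C := by
    have := (norm_nonneg _).trans (hb 0 (by simpa using ha.le) (by simpa using hb0.le))
    simpa using this
  -- Subtracting g(0)/s leaves the divided difference, which is holomorphic across 0. The subtracted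
  -- term contributes 2 arctan(T/c), with limits π for c = b and -π for c = a; their difference is
  -- the residue term.
  have hds : ∀ s : ℂ, s ≠ 0 → dslope g 0 s = g s / s - g 0 * s⁻¹ := by
    intro s hs
    rw [dslope_of_ne _ hs, slope_def_field]
    field_simp
    simp
  have hdiff : ∀ s : ℂ, a ≤ s.re → s.re ≤ b → DifferentiableAt ℂ (dslope g 0) s := by
    intro s h1 h2
    rcases eq_or_ne s 0 with rfl | hs
    · have hU : Complex.re ⁻¹' Ioo a b ∈ 𝓝 (0 : ℂ) :=
        (isOpen_Ioo.preimage Complex.continuous_re).mem_nhds (by simp [ha, hb0])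
      have : DifferentiableOn ℂ g (Complex.re ⁻¹' Ioo a b) := fun s hs =>
        (hg s hs.1.le hs.2.le).differentiableWithinAt
      exact ((Complex.differentiableOn_dslope hU).2 this).differentiableAt hU
    · exact (differentiableAt_dslope_of_ne hs).2 (hg s h1 h2)
  have hint : ∀ c : ℝ, c ≠ 0 → a ≤ c → c ≤ b →
      Integrable fun y : ℝ => g (c + y * Complex.I) / (c + y * Complex.I) := by
    intro c hc h1 h2
    refine integrable_vertical (f := fun s => g s / s) (C := C / |c|) hδ (fun s hs => ?_)
      (fun s hs => ?_)
    · have : s ≠ 0 := by rintro rfl; simp at hs; exact hc hs.symm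
      exact (hg s (hs ▸ h1) (hs ▸ h2)).continuousAt.div continuousAt_id this
    · have h3 := hb s (hs ▸ h1) (hs ▸ h2)
      have h4 : |c| ≤ ‖s‖ := hs ▸ Complex.abs_re_le_norm s
      have h5 : 0 < |c| := abs_pos.2 hc
      rw [norm_div]
      calc ‖g s‖ / ‖s‖ ≤ (C * Real.exp (-(δ * |s.im|))) / |c| := by gcongr
        _ = _ := by ring
  have hB : Tendsto (fun T : ℝ => (C + ‖g 0‖) / T) atTop (𝓝 0) :=
    tendsto_const_nhds.div_atTop tendsto_id
  have h := tendsto_vertical_sub (ha.trans hb0).le hdiff hB (fun s h1 h2 h3 => by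
    have hs : s ≠ 0 := by rintro rfl; norm_num at h3
    have hle : |s.im| ≤ ‖s‖ := Complex.abs_im_le_norm s
    have hgs : ‖g s‖ ≤ C := (hb s h1 h2).trans (by
      have : Real.exp (-(δ * |s.im|)) ≤ 1 := Real.exp_le_one_iff.2 (by
        have := mul_nonneg hδ.le (abs_nonneg s.im); linarith)
      nlinarith)
    have : dslope g 0 s = (g s - g 0) / s := by rw [hds s hs]; ring
    rw [this, norm_div]
    have := norm_sub_le (g s) (g 0)
    gcongr
    linarith)
  have hds_int : ∀ c : ℝ, c ≠ 0 → a ≤ c → c ≤ b → ∀ T : ℝ,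
      ∫ y in -T..T, dslope g 0 (c + y * Complex.I) =
        (∫ y in -T..T, g (c + y * Complex.I) / (c + y * Complex.I)) -
          g 0 * (2 * (Real.arctan (T / c) : ℂ)) := by
    intro c hc h1 h2 T
    rw [← integral_inv_vertical hc, ← intervalIntegral.integral_const_mul,
      ← intervalIntegral.integral_sub]
    · exact intervalIntegral.integral_congr fun y _ => hds _ (ofReal_add_mul_I_ne_zero hc y)
    · exact (hint c hc h1 h2).intervalIntegrable
    · refine Continuous.intervalIntegrable ?_ _ _
      exact continuous_const.mul
        (Continuous.inv₀ (by fun_prop) (ofReal_add_mul_I_ne_zero hc))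
  have harct_pos : Tendsto (fun T : ℝ => g 0 * (2 * ((Real.arctan (T / b) : ℝ) : ℂ))) atTop
      (𝓝 (g 0 * (2 * ((Real.pi / 2 : ℝ) : ℂ)))) := by
    refine Tendsto.const_mul _ (Tendsto.const_mul _ ?_)
    refine (Complex.continuous_ofReal.tendsto _).comp ?_
    have := Real.tendsto_arctan_atTop.mono_right nhdsWithin_le_nhds
    exact this.comp (tendsto_id.atTop_div_const hb0)
  have harct_neg : Tendsto (fun T : ℝ => g 0 * (2 * ((Real.arctan (T / a) : ℝ) : ℂ))) atTop
      (𝓝 (g 0 * (2 * ((-(Real.pi / 2) : ℝ) : ℂ)))) := by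
    refine Tendsto.const_mul _ (Tendsto.const_mul _ ?_)
    refine (Complex.continuous_ofReal.tendsto _).comp ?_
    have := Real.tendsto_arctan_atBot.mono_right nhdsWithin_le_nhds
    exact this.comp (tendsto_id.atTop_div_const_of_neg ha)
  have hlim := ((tendsto_integral_symm (hint b hb0.ne' (ha.trans hb0).le le_rfl)).sub harct_pos).sub
    ((tendsto_integral_symm (hint a ha.ne le_rfl (ha.trans hb0).le)).sub harct_neg)
  have h' := h.congr fun T => by
    rw [hds_int b hb0.ne' (ha.trans hb0).le le_rfl T, hds_int a ha.ne le_rfl (ha.trans hb0).le T]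
  have := tendsto_nhds_unique h' hlim
  push_cast at this
  linear_combination -this

/-! ### The regularized Mellin-Barnes kernels -/

/-- `Γ(1 + s) Γ(1 - s) / Γ(a + α s)`, which is `-s` times the Mellin-Barnes kernel of the
Mittag-Leffler function `E_{α,a}`. -/
def mlKernel (α a : ℝ) (s : ℂ) : ℂ :=
  Complex.Gamma (1 + s) * Complex.Gamma (1 - s) * (Complex.Gamma (a + α * s))⁻¹

/-- The kernel of the H-function of the fundamental solution, with its removable singularity at
`0` removed. -/
def regKernel (α γ ρ : ℝ) (ξ : ℂ) : ℂ :=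
  ((ρ * γ : ℝ) : ℂ) * mlKernel α α (ξ / γ) *
    (Complex.Gamma (1 + ξ) * (Complex.Gamma (1 - ρ * ξ))⁻¹ * (Complex.Gamma (1 + ρ * ξ))⁻¹)

theorem differentiableAt_Gamma_of_re_pos {s : ℂ} (hs : 0 < s.re) :
    DifferentiableAt ℂ Complex.Gamma s := by
  refine Complex.differentiableAt_Gamma s fun m h => ?_
  rw [h] at hs
  have : (0 : ℝ) ≤ m := m.cast_nonneg
  simp at hs
  linarith

theorem differentiableAt_mlKernel (α a : ℝ) {s : ℂ} (h1 : -1 < s.re) (h2 : s.re < 1) :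
    DifferentiableAt ℂ (mlKernel α a) s := by
  have e1 : DifferentiableAt ℂ (fun s : ℂ => Complex.Gamma (1 + s)) s :=
    (differentiableAt_Gamma_of_re_pos (s := 1 + s) (by simp; linarith)).comp s
      (by fun_prop : DifferentiableAt ℂ (fun s : ℂ => 1 + s) s)
  have e2 : DifferentiableAt ℂ (fun s : ℂ => Complex.Gamma (1 - s)) s :=
    (differentiableAt_Gamma_of_re_pos (s := 1 - s) (by simp; linarith)).comp s
      (by fun_prop : DifferentiableAt ℂ (fun s : ℂ => 1 - s) s)
  have e3 : DifferentiableAt ℂ (fun s : ℂ => (Complex.Gamma (a + α * s))⁻¹) s :=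
    (Complex.differentiable_one_div_Gamma _).comp s
      (by fun_prop : DifferentiableAt ℂ (fun s : ℂ => (a + α * s : ℂ)) s)
  exact (e1.mul e2).mul e3

theorem differentiableAt_regKernel (α ρ : ℝ) {γ : ℝ} (hγ : 0 < γ) {ξ : ℂ} (h1 : -1 < ξ.re)
    (h2 : -γ < ξ.re) (h3 : ξ.re < γ) : DifferentiableAt ℂ (regKernel α γ ρ) ξ := by
  have hre : (ξ / γ).re = ξ.re / γ := Complex.div_ofReal_re ξ γ
  have e1 : DifferentiableAt ℂ (fun ξ : ℂ => mlKernel α α (ξ / γ)) ξ :=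
    DifferentiableAt.comp (f := fun ξ : ℂ => ξ / γ) ξ
      (differentiableAt_mlKernel α α
        (by rw [hre, lt_div_iff₀ hγ]; linarith) (by rw [hre, div_lt_iff₀ hγ]; linarith))
      (by fun_prop)
  have e2 : DifferentiableAt ℂ (fun ξ : ℂ => Complex.Gamma (1 + ξ)) ξ :=
    (differentiableAt_Gamma_of_re_pos (s := 1 + ξ) (by simp; linarith)).comp ξ
      (by fun_prop : DifferentiableAt ℂ (fun ξ : ℂ => 1 + ξ) ξ)
  have e3 : DifferentiableAt ℂ (fun ξ : ℂ => (Complex.Gamma (1 - ρ * ξ))⁻¹) ξ :=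
    (Complex.differentiable_one_div_Gamma _).comp ξ
      (by fun_prop : DifferentiableAt ℂ (fun ξ : ℂ => (1 - ρ * ξ : ℂ)) ξ)
  have e4 : DifferentiableAt ℂ (fun ξ : ℂ => (Complex.Gamma (1 + ρ * ξ))⁻¹) ξ :=
    (Complex.differentiable_one_div_Gamma _).comp ξ
      (by fun_prop : DifferentiableAt ℂ (fun ξ : ℂ => (1 + ρ * ξ : ℂ)) ξ)
  exact (e1.const_mul _).mul ((e2.mul e3).mul e4)

theorem exists_norm_Gamma_le' {a : ℝ} (b : ℝ) (ha : 0 < a) {η : ℝ} (h1 : η < Real.pi / 2) :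
    ∃ C : ℝ, 0 < C ∧ ∀ s : ℂ, a ≤ s.re → s.re ≤ b →
      ‖Complex.Gamma s‖ ≤ C * Real.exp (-(η * |s.im|)) := by
  obtain ⟨C, hC, h⟩ := exists_norm_Gamma_le b ha (le_max_left 0 η)
    (max_lt (by linarith [Real.pi_pos]) h1)
  refine ⟨C, hC, fun s h2 h3 => (h s h2 h3).trans ?_⟩
  gcongr
  exact le_max_right _ _

/-- Each of the two Gamma factors decays at a rate close to π/2, and the reciprocal one grows at a
rate close to πα/2, hence any rate below π(1 - α/2). -/
theorem exists_norm_mlKernel_le {α : ℝ} (a : ℝ) (hα : 0 < α) {p q : ℝ} (hp : -1 < p) (hq : q < 1)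
    {η : ℝ} (hη : η < Real.pi * (1 - α / 2)) :
    ∃ C : ℝ, 0 < C ∧ ∀ s : ℂ, p ≤ s.re → s.re ≤ q →
      ‖mlKernel α a s‖ ≤ C * Real.exp (-(η * |s.im|)) := by
  -- The slack ω is spent as ω/4 on each Gamma factor and as ω/2 on the reciprocal, whose imaginary
  -- part is scaled by α.
  set ω := Real.pi * (1 - α / 2) - η with hω
  have hω0 : 0 < ω := by rw [hω]; linarith
  obtain ⟨C₁, hC₁, h₁⟩ := exists_norm_Gamma_le' (a := 1 + p) (1 + q) (by linarith)
    (η := Real.pi / 2 - ω / 4) (by linarith)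
  obtain ⟨C₂, hC₂, h₂⟩ := exists_norm_Gamma_le' (a := 1 - q) (1 - p) (by linarith)
    (η := Real.pi / 2 - ω / 4) (by linarith)
  obtain ⟨C₃, hC₃, h₃⟩ := exists_norm_Gamma_inv_le (a + α * p) (a + α * q)
    (η := Real.pi / 2 + ω / (2 * α)) (by have : 0 < ω / (2 * α) := by positivity
                                         linarith)
  refine ⟨C₁ * C₂ * C₃, by positivity, fun s hs1 hs2 => ?_⟩
  have g1 := h₁ (1 + s) (by simpa using hs1) (by simpa using hs2)
  have g2 := h₂ (1 - s) (by simp; linarith) (by simp; linarith)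
  have g3 := h₃ (a + α * s) (by simp; nlinarith) (by simp; nlinarith)
  simp only [Complex.add_im, Complex.one_im, zero_add, Complex.sub_im, zero_sub, abs_neg,
    Complex.ofReal_im, Complex.mul_im, Complex.ofReal_re, zero_mul, add_zero, abs_mul,
    abs_of_pos hα] at g1 g2 g3
  rw [mlKernel, norm_mul, norm_mul]
  calc _ ≤ (C₁ * Real.exp (-((Real.pi / 2 - ω / 4) * |s.im|))) *
        (C₂ * Real.exp (-((Real.pi / 2 - ω / 4) * |s.im|))) *
        (C₃ * Real.exp ((Real.pi / 2 + ω / (2 * α)) * (α * |s.im|))) := by gcongr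
    _ = C₁ * C₂ * C₃ * (Real.exp (-((Real.pi / 2 - ω / 4) * |s.im|)) *
        Real.exp (-((Real.pi / 2 - ω / 4) * |s.im|)) *
        Real.exp ((Real.pi / 2 + ω / (2 * α)) * (α * |s.im|))) := by ring
    _ = _ := by
        rw [← Real.exp_add, ← Real.exp_add]
        congr 2
        field_simp
        rw [hω]
        ring

/-- The conditions on the parameters under which the kernel decays exponentially. -/
structure KernelParams (α γ ρ : ℝ) : Prop where
  α_pos : 0 < α
  γ_pos : 0 < γ
  ρ_nonneg : 0 ≤ ρ
  decay : ρ < (1 - α / 2) / γ + 1 / 2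

/-- The rates add up: π(1-α/2)/γ from `mlKernel` at ξ/γ, π/2 from Γ(1+ξ), and -πρ from the two
reciprocals. The sum is positive exactly by `decay`. -/
theorem KernelParams.exists_norm_regKernel_le {α γ ρ : ℝ} (H : KernelParams α γ ρ) :
    ∃ δ : ℝ, 0 < δ ∧ ∀ a b : ℝ, -1 < a → -γ < a → b < γ → ∃ C : ℝ, 0 < C ∧
      ∀ ξ : ℂ, a ≤ ξ.re → ξ.re ≤ b → ‖regKernel α γ ρ ξ‖ ≤ C * Real.exp (-(δ * |ξ.im|)) := by
  have hγ := H.γ_pos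
  have hα := H.α_pos
  have hρ := H.ρ_nonneg
  have hpi := Real.pi_pos
  -- The ideal rate is 6κ. A loss of κ in `mlKernel`, κ in Γ(1+ξ) and at most κ in the two
  -- reciprocals together leaves 3κ.
  set κ := Real.pi * ((1 - α / 2) / γ + 1 / 2 - ρ) / 6 with hκ
  have hκ0 : 0 < κ := by
    have := H.decay
    have h : 0 < (1 - α / 2) / γ + 1 / 2 - ρ := by linarith
    positivity
  refine ⟨3 * κ, by positivity, fun a b ha1 haγ hb => ?_⟩
  obtain ⟨C₁, hC₁, h₁⟩ := exists_norm_mlKernel_le α hα (p := a / γ) (q := b / γ)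
    (by rw [lt_div_iff₀ hγ]; linarith) (by rw [div_lt_iff₀ hγ]; linarith)
    (η := Real.pi * (1 - α / 2) - γ * κ) (by have : 0 < γ * κ := by positivity
                                             linarith)
  obtain ⟨C₂, hC₂, h₂⟩ := exists_norm_Gamma_le' (a := 1 + a) (1 + b) (by linarith)
    (η := Real.pi / 2 - κ) (by linarith)
  -- Dividing by ρ + 1 instead of ρ also covers ρ = 0.
  have hκρ : 0 < κ / (2 * (ρ + 1)) := by positivity
  obtain ⟨C₃, hC₃, h₃⟩ := exists_norm_Gamma_inv_le (1 - ρ * b) (1 - ρ * a)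
    (η := Real.pi / 2 + κ / (2 * (ρ + 1))) (by linarith)
  obtain ⟨C₄, hC₄, h₄⟩ := exists_norm_Gamma_inv_le (1 + ρ * a) (1 + ρ * b)
    (η := Real.pi / 2 + κ / (2 * (ρ + 1))) (by linarith)
  refine ⟨(ρ * γ + 1) * C₁ * C₂ * C₃ * C₄, by positivity, fun ξ hξ1 hξ2 => ?_⟩
  have e1 : ρ * a ≤ ρ * ξ.re := by gcongr
  have e2 : ρ * ξ.re ≤ ρ * b := by gcongr
  have g1 := h₁ (ξ / γ) (by rw [Complex.div_ofReal_re]; gcongr)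
    (by rw [Complex.div_ofReal_re]; gcongr)
  have g2 := h₂ (1 + ξ) (by simpa using hξ1) (by simpa using hξ2)
  have g3 := h₃ (1 - ρ * ξ) (by simp; linarith) (by simp; linarith)
  have g4 := h₄ (1 + ρ * ξ) (by simpa using e1) (by simpa using e2)
  rw [Complex.div_ofReal_im, abs_div, abs_of_pos hγ] at g1
  simp only [Complex.add_im, Complex.one_im, zero_add, Complex.sub_im, zero_sub, abs_neg,
    Complex.ofReal_im, Complex.mul_im, Complex.ofReal_re, zero_mul, add_zero, abs_mul,
    abs_of_nonneg hρ] at g2 g3 g4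
  rw [regKernel, norm_mul, norm_mul, norm_mul, norm_mul, Complex.norm_real,
    Real.norm_of_nonneg (by positivity)]
  set Y := |ξ.im| with hY
  have hY0 : 0 ≤ Y := abs_nonneg _
  set E := Real.pi / 2 + κ / (2 * (ρ + 1)) with hE
  calc _ ≤ (ρ * γ + 1) * (C₁ * Real.exp (-((Real.pi * (1 - α / 2) - γ * κ) * (Y / γ)))) *
        ((C₂ * Real.exp (-((Real.pi / 2 - κ) * Y))) * (C₃ * Real.exp (E * (ρ * Y))) *
          (C₄ * Real.exp (E * (ρ * Y)))) := by
        gcongr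
        linarith
    _ = (ρ * γ + 1) * C₁ * C₂ * C₃ * C₄ *
        (Real.exp (-((Real.pi * (1 - α / 2) - γ * κ) * (Y / γ))) *
        Real.exp (-((Real.pi / 2 - κ) * Y)) * Real.exp (E * (ρ * Y)) *
          Real.exp (E * (ρ * Y))) := by ring
    _ ≤ _ := by
        rw [← Real.exp_add, ← Real.exp_add, ← Real.exp_add]
        gcongr
        have h5 : 2 * E * ρ ≤ Real.pi * ρ + κ := by
          have : κ / (2 * (ρ + 1)) * (2 * ρ) ≤ κ := by
            rw [div_mul_eq_mul_div, div_le_iff₀ (by positivity)]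
            nlinarith
          rw [hE]; linarith
        have h6 : -((Real.pi * (1 - α / 2) - γ * κ) * (Y / γ)) =
            (κ - Real.pi * ((1 - α / 2) / γ)) * Y := by field_simp; ring
        have h7 : Real.pi * ((1 - α / 2) / γ) + Real.pi / 2 - Real.pi * ρ = 6 * κ := by
          rw [hκ]; ring
        rw [h6]
        have h8 : (κ - Real.pi * ((1 - α / 2) / γ)) * Y + -((Real.pi / 2 - κ) * Y) +
            E * (ρ * Y) + E * (ρ * Y) =
            (2 * κ - (Real.pi * ((1 - α / 2) / γ) + Real.pi / 2) + 2 * E * ρ) * Y := by ring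
        rw [h8, ← neg_mul]
        gcongr
        linarith

/-! ### The H-function as a Mellin-Barnes integral -/

/-- Γ(-ξ/γ) and 1/Γ(-ρξ) are both moved one step by the functional equation; the factors ξ that
appear cancel and leave the constant ργ. At ξ = 0 itself the value 0 of `Gamma` at its pole would
spoil the identity. -/
theorem foxKernel_eq_regKernel (α ρ : ℝ) {γ : ℝ} (hγ : 0 < γ) {ξ : ℂ} (hξ : ξ ≠ 0) :
    foxKernel 2 1 (upperParams α γ ρ) (lowerParams γ ρ) ξ = regKernel α γ ρ ξ := by
  have hγc : (γ : ℂ) ≠ 0 := Complex.ofReal_ne_zero.2 hγ.ne'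
  have h1 : Complex.Gamma (1 - ξ / γ) = -(ξ / γ) * Complex.Gamma (-(ξ / γ)) := by
    rw [← Complex.Gamma_add_one _ (neg_ne_zero.2 (div_ne_zero hξ hγc))]
    congr 1; ring
  have h2 : (Complex.Gamma (-(ρ * ξ)))⁻¹ = -(ρ * ξ) * (Complex.Gamma (1 - ρ * ξ))⁻¹ := by
    have := Complex.one_div_Gamma_eq_self_mul_one_div_Gamma_add_one (-(ρ * ξ))
    rw [this]
    congr 3; ring
  have e1 : (1 : ℂ) + ((1 / γ : ℝ) : ℂ) * ξ = 1 + ξ / γ := by push_cast; ring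
  have e2 : (1 : ℂ) - 1 - ((1 / γ : ℝ) : ℂ) * ξ = -(ξ / γ) := by push_cast; ring
  have e3 : (1 : ℂ) - 1 - (ρ : ℂ) * ξ = -(ρ * ξ) := by ring
  have e4 : (α : ℂ) + ((α / γ : ℝ) : ℂ) * ξ = α + α * (ξ / γ) := by push_cast; ring
  have e5 : (1 : ℂ) + ((1 : ℝ) : ℂ) * ξ = 1 + ξ := by push_cast; ring
  simp only [foxKernel, upperParams, lowerParams, Fin.prod_univ_three, Matrix.cons_val_zero,
    Matrix.cons_val_one, Matrix.cons_val_two, Fin.val_zero, Fin.val_one, Fin.val_two,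
    Nat.zero_lt_succ, Nat.one_lt_ofNat, lt_self_iff_false, if_true, if_false]
  rw [if_neg (by norm_num)]
  simp only [Matrix.tail_cons, Matrix.head_cons]
  rw [e1, e2, e3, e4, e5, h2, regKernel, mlKernel, h1]
  have h3 : (ρ : ℂ) * ξ = ((ρ * γ : ℝ) : ℂ) * (ξ / γ) := by push_cast; field_simp
  linear_combination (-Complex.Gamma (1 + ξ / γ) * Complex.Gamma (1 + ξ) *
    (Complex.Gamma (1 - ρ * ξ))⁻¹ * Complex.Gamma (-(ξ / γ)) *
    (Complex.Gamma (α + α * (ξ / γ)))⁻¹ * (Complex.Gamma (1 + ρ * ξ))⁻¹) * h3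

/-- The binding poles are the first ones, -γ and -1 on the left and 0 on the right. The point 0
bounds the line although it is removable for the whole kernel. -/
theorem separatesPoles_iff (α ρ : ℝ) {γ : ℝ} (hγ : 0 < γ) (c : ℝ) :
    SeparatesPoles 2 1 (upperParams α γ ρ) (lowerParams γ ρ) c ↔ -γ < c ∧ -1 < c ∧ c < 0 := by
  have hγc : (γ : ℂ) ≠ 0 := Complex.ofReal_ne_zero.2 hγ.ne'
  constructor
  · rintro ⟨h1, h2⟩
    have a1 := h1 0 (by norm_num) 0 (-γ : ℂ) (by
      simp [lowerParams, hγc])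
    have a2 := h1 1 (by norm_num) 0 (-1 : ℂ) (by
      simp [lowerParams])
    have a3 := h2 0 (by norm_num) 0 0 (by simp [upperParams])
    simp at a1 a2 a3
    exact ⟨a1, a2, a3⟩
  · rintro ⟨h1, h2, h3⟩
    refine ⟨fun j hj ν ξ hξ => ?_, fun j hj ν ξ hξ => ?_⟩
    · have hν : (0 : ℝ) ≤ ν := ν.cast_nonneg
      have hξ' := congrArg Complex.re hξ
      fin_cases j
      · simp [lowerParams] at hξ'
        have h4 : ξ.re = -(γ * (1 + ν)) := by
          field_simp at hξ'
          linarith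
        nlinarith
      · simp [lowerParams] at hξ'
        linarith
      · simp at hj
    · have hν : (0 : ℝ) ≤ ν := ν.cast_nonneg
      have hξ' := congrArg Complex.re hξ
      fin_cases j
      · simp [upperParams] at hξ'
        have h4 : ξ.re = γ * ν := by
          field_simp at hξ'
          linarith
        nlinarith [mul_nonneg hγ.le hν]
      · simp at hj
      · simp at hj

/-- The vertical Mellin-Barnes integral of `regKernel` at abscissa `c`. -/
def verticalBarnes (α γ ρ c r : ℝ) : ℂ :=
  ∫ y : ℝ, regKernel α γ ρ (c + y * Complex.I) * (r : ℂ) ^ (-((c : ℂ) + y * Complex.I))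

/-- The H-function of the fundamental solution. -/
def barnes (α γ ρ r : ℝ) : ℂ := 1 / (2 * (Real.pi : ℂ)) * verticalBarnes α γ ρ (-γ / 4) r

theorem norm_cpow_neg_vertical {r : ℝ} (hr : 0 < r) (s : ℂ) :
    ‖(r : ℂ) ^ (-s)‖ = r ^ (-s.re) := by
  rw [Complex.norm_cpow_eq_rpow_re_of_pos hr, Complex.neg_re]

/-! ### Existence, size and continuity of the H-function -/

namespace KernelParams

variable {α γ ρ : ℝ}

theorem integrable_barnes (H : KernelParams α γ ρ) {c r : ℝ} (h1 : -1 < c) (h2 : -γ < c)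
    (h3 : c < γ) (hr : 0 < r) :
    Integrable fun y : ℝ =>
      regKernel α γ ρ (c + y * Complex.I) * (r : ℂ) ^ (-((c : ℂ) + y * Complex.I)) := by
  obtain ⟨δ, hδ, h⟩ := H.exists_norm_regKernel_le
  obtain ⟨C, hC, hb⟩ := h c c h1 h2 h3
  have hrc : (r : ℂ) ≠ 0 := Complex.ofReal_ne_zero.2 hr.ne'
  refine integrable_vertical (f := fun s => regKernel α γ ρ s * (r : ℂ) ^ (-s))
    (C := C * r ^ (-c)) hδ (fun s hs => ?_) (fun s hs => ?_)
  · refine ((differentiableAt_regKernel α ρ H.γ_pos (by rwa [hs]) (by rwa [hs])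
      (by rwa [hs])).mul ?_).continuousAt
    exact (differentiableAt_id.neg).const_cpow (Or.inl hrc)
  · rw [norm_mul, norm_cpow_neg_vertical hr, hs]
    calc _ ≤ C * Real.exp (-(δ * |s.im|)) * r ^ (-c) := by
          gcongr; exact hb s hs.ge hs.le
      _ = _ := by ring

theorem verticalBarnes_eq (H : KernelParams α γ ρ) {c c' r : ℝ} (h1 : -1 < c) (h2 : -γ < c)
    (h3 : c' < γ) (hcc : c ≤ c') (hr : 0 < r) :
    verticalBarnes α γ ρ c r = verticalBarnes α γ ρ c' r := by
  obtain ⟨δ, hδ, h⟩ := H.exists_norm_regKernel_le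
  obtain ⟨C, hC, hb⟩ := h c c' h1 h2 h3
  have hrc : (r : ℂ) ≠ 0 := Complex.ofReal_ne_zero.2 hr.ne'
  refine integral_vertical_eq (f := fun s => regKernel α γ ρ s * (r : ℂ) ^ (-s))
    (C := C * (r ^ (-c) + r ^ (-c'))) hcc hδ (fun s hs1 hs2 => ?_) (fun s hs1 hs2 => ?_)
  · refine (differentiableAt_regKernel α ρ H.γ_pos (by linarith) (by linarith)
      (by linarith)).mul ?_
    exact (differentiableAt_id.neg).const_cpow (Or.inl hrc)
  · rw [norm_mul, norm_cpow_neg_vertical hr]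
    have h4 : r ^ (-s.re) ≤ r ^ (-c) + r ^ (-c') := by
      have p1 : 0 < r ^ (-c) := by positivity
      have p2 : 0 < r ^ (-c') := by positivity
      rcases le_total 1 r with h | h
      · have := Real.rpow_le_rpow_of_exponent_le h (neg_le_neg hs1)
        linarith
      · have := Real.rpow_le_rpow_of_exponent_ge hr h (neg_le_neg hs2)
        linarith
    calc _ ≤ C * Real.exp (-(δ * |s.im|)) * (r ^ (-c) + r ^ (-c')) := by
          gcongr; exact hb s hs1 hs2
      _ = _ := by ring

/-- The line at -γ/4 separates the poles because γ ≤ 2, and the mirror line at γ/4 still lies in the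
strip where `regKernel` is holomorphic. Under ξ ↦ ξ/γ the first becomes the line at -1/4 of
`mlBarnes`. -/
theorem quarter (H : KernelParams α γ ρ) (hγ2 : γ ≤ 2) :
    -1 < -γ / 4 ∧ -γ < -γ / 4 ∧ -γ / 4 < 0 ∧ -γ / 4 < γ ∧ -1 < γ / 4 ∧ -γ < γ / 4 ∧ γ / 4 < γ := by
  have := H.γ_pos
  refine ⟨?_, ?_, ?_, ?_, ?_, ?_, ?_⟩ <;> linarith

theorem hasFoxH (H : KernelParams α γ ρ) (hγ2 : γ ≤ 2) {r : ℝ} (hr : 0 < r) :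
    HasFoxH 2 1 (upperParams α γ ρ) (lowerParams γ ρ) (r : ℂ) (barnes α γ ρ r) := by
  have hγ := H.γ_pos
  obtain ⟨q1, q2, q3, q4, -⟩ := H.quarter hγ2
  refine ⟨⟨-γ / 4, (separatesPoles_iff α ρ hγ _).2 ⟨q2, q1, q3⟩⟩, fun c hc => ?_⟩
  obtain ⟨c1, c2, c3⟩ := (separatesPoles_iff α ρ hγ _).1 hc
  have heq : foxIntegrand 2 1 (upperParams α γ ρ) (lowerParams γ ρ) (r : ℂ) c = fun y : ℝ =>
      regKernel α γ ρ (c + y * Complex.I) * (r : ℂ) ^ (-((c : ℂ) + y * Complex.I)) := by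
    funext y
    rw [foxIntegrand, foxKernel_eq_regKernel α ρ hγ (ofReal_add_mul_I_ne_zero c3.ne y)]
  rw [heq]
  refine ⟨H.integrable_barnes c2 c1 (by linarith) hr, ?_⟩
  rw [barnes]
  congr 1
  change verticalBarnes α γ ρ c r = _
  rcases le_total c (-γ / 4) with h | h
  · exact H.verticalBarnes_eq c2 c1 q4 h hr
  · exact (H.verticalBarnes_eq q1 q2 (by linarith) h hr).symm

theorem foxH_eq (H : KernelParams α γ ρ) (hγ2 : γ ≤ 2) {r : ℝ} (hr : 0 < r) :
    foxH 2 1 (upperParams α γ ρ) (lowerParams γ ρ) (r : ℂ) = barnes α γ ρ r := by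
  have h := H.hasFoxH hγ2 hr
  have hex : ∃ w, HasFoxH 2 1 (upperParams α γ ρ) (lowerParams γ ρ) (r : ℂ) w := ⟨_, h⟩
  obtain ⟨c, hc⟩ := h.1
  rw [foxH, dif_pos hex, ← (hex.choose_spec.2 c hc).2, (h.2 c hc).2]

/-- The integral over Re ξ = c is O(r^{-c}). Since 0 is not a singularity of `regKernel`, the line
may be moved from -γ/4 to γ/4, which gives smallness both at r = 0 and at infinity, as integrability
of `barnes α γ ρ x / x` requires. -/
theorem exists_norm_barnes_le (H : KernelParams α γ ρ) (hγ2 : γ ≤ 2) :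
    ∃ C : ℝ, 0 < C ∧ ∀ r : ℝ, 0 < r →
      ‖barnes α γ ρ r‖ ≤ C * r ^ (γ / 4) ∧ ‖barnes α γ ρ r‖ ≤ C * r ^ (-(γ / 4)) := by
  obtain ⟨q1, q2, q3, q4, q5, q6, q7⟩ := H.quarter hγ2
  have main : ∀ c : ℝ, -1 < c → -γ < c → c < γ → ∀ r : ℝ, 0 < r → ‖verticalBarnes α γ ρ c r‖ ≤
      (∫ y : ℝ, ‖regKernel α γ ρ (c + y * Complex.I)‖) * r ^ (-c) := by
    intro c h1 h2 h3 r hr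
    rw [← integral_mul_const]
    refine (norm_integral_le_integral_norm _).trans_eq ?_
    refine integral_congr_ae (ae_of_all _ fun y => ?_)
    simp only
    rw [norm_mul, norm_cpow_neg_vertical hr]
    simp
  set A := ∫ y : ℝ, ‖regKernel α γ ρ (((-γ / 4 : ℝ) : ℂ) + y * Complex.I)‖ with hA
  set B := ∫ y : ℝ, ‖regKernel α γ ρ (((γ / 4 : ℝ) : ℂ) + y * Complex.I)‖ with hB
  have hA0 : 0 ≤ A := integral_nonneg fun _ => norm_nonneg _
  have hB0 : 0 ≤ B := integral_nonneg fun _ => norm_nonneg _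
  have hpi : ‖1 / (2 * (Real.pi : ℂ))‖ ≤ 1 := by
    rw [norm_div, norm_mul, Complex.norm_real, Real.norm_of_nonneg Real.pi_pos.le]
    simp only [norm_one, Complex.norm_ofNat]
    rw [div_le_one (by positivity)]
    linarith [Real.pi_gt_three]
  refine ⟨A + B + 1, by positivity, fun r hr => ?_⟩
  have key : ∀ D e : ℝ, D ≤ A + B → ‖verticalBarnes α γ ρ (-γ / 4) r‖ ≤ D * r ^ e →
      ‖barnes α γ ρ r‖ ≤ (A + B + 1) * r ^ e := by
    intro D e hD h
    rw [barnes, norm_mul]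
    have : 0 ≤ r ^ e := by positivity
    calc _ ≤ 1 * (D * r ^ e) := by gcongr
      _ ≤ _ := by rw [one_mul]; gcongr; linarith
  refine ⟨key A _ (by linarith) ?_, key B _ (by linarith) ?_⟩
  · have := main (-γ / 4) q1 q2 q4 r hr
    rwa [show -(-γ / 4) = γ / 4 by ring] at this
  · rw [H.verticalBarnes_eq q1 q2 q7 (by linarith) hr]
    exact main (γ / 4) q5 q6 q7 r hr

theorem continuousOn_barnes (H : KernelParams α γ ρ) (hγ2 : γ ≤ 2) :
    ContinuousOn (barnes α γ ρ) (Ioi 0) := by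
  obtain ⟨q1, q2, q3, q4, -⟩ := H.quarter hγ2
  refine continuousOn_const.mul ?_
  -- With the power r^{γ/4} taken out, what remains is a Fourier integral in log r with an
  -- integrable density, continuous by dominated convergence.
  have heq : EqOn (verticalBarnes α γ ρ (-γ / 4)) (fun r : ℝ => ((r ^ (γ / 4) : ℝ) : ℂ) *
      ∫ y : ℝ, regKernel α γ ρ (((-γ / 4 : ℝ) : ℂ) + y * Complex.I) *
        Complex.exp (-(y * Real.log r) * Complex.I)) (Ioi 0) := by
    intro r hr
    have hr' : (0 : ℝ) < r := hr
    have hrc : (r : ℂ) ≠ 0 := Complex.ofReal_ne_zero.2 hr'.ne'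
    simp only [verticalBarnes]
    rw [← integral_const_mul]
    refine integral_congr_ae (ae_of_all _ fun y => ?_)
    simp only
    rw [Complex.ofReal_cpow hr'.le, Complex.cpow_def_of_ne_zero hrc,
      Complex.cpow_def_of_ne_zero hrc, mul_left_comm, ← Complex.exp_add, ← Complex.ofReal_log hr'.le]
    congr 2
    push_cast
    ring
  have hint : Integrable fun y : ℝ => regKernel α γ ρ (((-γ / 4 : ℝ) : ℂ) + y * Complex.I) := by
    simpa using H.integrable_barnes q1 q2 q4 one_pos
  refine ContinuousOn.congr ?_ heq
  refine ContinuousOn.mul ?_ ?_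
  · refine Complex.continuous_ofReal.comp_continuousOn ?_
    exact fun r hr => (Real.continuousAt_rpow_const _ _ (Or.inl (ne_of_gt hr))).continuousWithinAt
  · have hc : Continuous fun l : ℝ => ∫ y : ℝ,
        regKernel α γ ρ (((-γ / 4 : ℝ) : ℂ) + y * Complex.I) *
          Complex.exp (-(y * l) * Complex.I) := by
      refine continuous_of_dominated (fun l => ?_) (fun l => ae_of_all _ fun y => ?_) hint.norm
        (ae_of_all _ fun y => by fun_prop)
      · exact hint.aestronglyMeasurable.mul
          (by fun_prop : Continuous fun y : ℝ =>
            Complex.exp (-((y : ℂ) * l) * Complex.I)).aestronglyMeasurable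
      · rw [norm_mul, Complex.norm_exp]
        simp
    exact hc.comp_continuousOn (Real.continuousOn_log.mono fun r hr => ne_of_gt hr)

end KernelParams

/-! ### Riemann-Liouville integrals of powers -/

theorem integral_rl_cpow {β : ℝ} (hβ : 0 < β) {p : ℂ} (hp : 0 < p.re) {t : ℝ} (ht : 0 < t) :
    ∫ τ in (0 : ℝ)..t, (((t - τ) ^ (β - 1) : ℝ) : ℂ) * (τ : ℂ) ^ (p - 1) =
      (t : ℂ) ^ (p + β - 1) * (Complex.Gamma β * Complex.Gamma p * (Complex.Gamma (p + β))⁻¹) := by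
  have h1 := Complex.betaIntegral_scaled p β ht
  have h2 := Complex.Gamma_mul_Gamma_eq_betaIntegral hp (t := (β : ℂ)) (by simpa using hβ)
  have h3 : Complex.Gamma (p + β) ≠ 0 :=
    Complex.Gamma_ne_zero_of_re_pos (by simp; linarith)
  have h4 : Complex.betaIntegral p β =
      Complex.Gamma β * Complex.Gamma p * (Complex.Gamma (p + β))⁻¹ := by
    field_simp
    rw [mul_comm (Complex.Gamma (β : ℂ)), h2]
    ring
  rw [← h4, ← h1]
  refine intervalIntegral.integral_congr fun τ hτ => ?_
  rw [uIcc_of_le ht.le] at hτ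
  rw [Complex.ofReal_cpow (sub_nonneg.2 hτ.2), mul_comm]
  push_cast
  ring

theorem intervalIntegrable_rl_cpow {β : ℝ} (hβ : 0 < β) {p : ℂ} (hp : 0 < p.re) {t : ℝ}
    (ht : 0 < t) :
    IntervalIntegrable (fun τ : ℝ => (((t - τ) ^ (β - 1) : ℝ) : ℂ) * (τ : ℂ) ^ (p - 1))
      volume 0 t := by
  -- A non-integrable function has integral 0 by convention, so the nonzero Beta value already
  -- proves integrability.
  refine intervalIntegral.intervalIntegrable_of_integral_ne_zero ?_
  rw [integral_rl_cpow hβ hp ht]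
  refine mul_ne_zero ?_ (mul_ne_zero (mul_ne_zero ?_ ?_) (inv_ne_zero ?_))
  · rw [Complex.cpow_def_of_ne_zero (Complex.ofReal_ne_zero.2 ht.ne')]
    exact Complex.exp_ne_zero _
  · exact Complex.Gamma_ne_zero_of_re_pos (by simpa using hβ)
  · exact Complex.Gamma_ne_zero_of_re_pos hp
  · exact Complex.Gamma_ne_zero_of_re_pos (by simp; linarith)

theorem integrableOn_rl_rpow {β q : ℝ} (hβ : 0 < β) (hq : 0 < q) {t : ℝ} (ht : 0 < t) :
    IntegrableOn (fun τ : ℝ => (t - τ) ^ (β - 1) * τ ^ (q - 1)) (Ioc 0 t) := by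
  have h := ((intervalIntegrable_iff_integrableOn_Ioc_of_le ht.le).1
    (intervalIntegrable_rl_cpow hβ (p := (q : ℂ)) (by simpa using hq) ht)).norm
  refine IntegrableOn.congr_fun (f := fun τ : ℝ =>
    ‖(((t - τ) ^ (β - 1) : ℝ) : ℂ) * (τ : ℂ) ^ ((q : ℂ) - 1)‖) h (fun τ hτ => ?_) measurableSet_Ioc
  simp only
  rw [norm_mul, Complex.norm_real, Complex.norm_cpow_eq_rpow_re_of_pos hτ.1,
    Real.norm_of_nonneg (Real.rpow_nonneg (sub_nonneg.2 hτ.2) _)]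
  simp

/-! ### The Mittag-Leffler function as a Mellin-Barnes integral -/

/-- The integrand of `mlBarnes`. -/
def mlIntegrand (α a : ℝ) (ζ s : ℂ) : ℂ := -(mlKernel α a s / s) * Complex.exp (s * ζ)

/-- The Mellin-Barnes integral of the Mittag-Leffler function `E_{α,a}(-exp ζ)`. -/
def mlBarnes (α a : ℝ) (ζ : ℂ) : ℂ :=
  1 / (2 * (Real.pi : ℂ)) * ∫ v : ℝ, mlIntegrand α a ζ (((-1 / 4 : ℝ) : ℂ) + v * Complex.I)

theorem norm_cexp_mul_le {s ζ : ℂ} {β : ℝ} (hζ : |ζ.im| ≤ β) :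
    ‖Complex.exp (s * ζ)‖ ≤ Real.exp (s.re * ζ.re) * Real.exp (β * |s.im|) := by
  rw [Complex.norm_exp, ← Real.exp_add, Complex.mul_re]
  gcongr
  have h1 : |s.im * ζ.im| ≤ β * |s.im| := by
    rw [abs_mul, mul_comm]
    gcongr
  have := neg_le_of_abs_le h1
  linarith

/-- In the sector |Im ζ| ≤ β the exponential grows at most like exp(β|Im s|), less than the kernel
decays; half of the gap is kept as δ. -/
theorem exists_norm_mlKernel_mul_cexp_le {α β : ℝ} (a : ℝ) (hα : 0 < α)
    (hβ : β < Real.pi * (1 - α / 2)) {p q : ℝ} (hp : -1 < p) (hq : q < 1) :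
    ∃ C δ : ℝ, 0 < C ∧ 0 < δ ∧ ∀ ζ : ℂ, |ζ.im| ≤ β → ∀ s : ℂ, p ≤ s.re → s.re ≤ q →
      ‖mlKernel α a s * Complex.exp (s * ζ)‖ ≤
        C * Real.exp (s.re * ζ.re) * Real.exp (-(δ * |s.im|)) := by
  obtain ⟨C, hC, h⟩ := exists_norm_mlKernel_le a hα hp hq
    (η := (β + Real.pi * (1 - α / 2)) / 2) (by linarith)
  refine ⟨C, (Real.pi * (1 - α / 2) - β) / 2, hC, by linarith, fun ζ hζ s h1 h2 => ?_⟩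
  rw [norm_mul]
  calc _ ≤ (C * Real.exp (-((β + Real.pi * (1 - α / 2)) / 2 * |s.im|))) *
        (Real.exp (s.re * ζ.re) * Real.exp (β * |s.im|)) := by
        gcongr
        · exact h s h1 h2
        · exact norm_cexp_mul_le hζ
    _ = C * Real.exp (s.re * ζ.re) * (Real.exp (-((β + Real.pi * (1 - α / 2)) / 2 * |s.im|)) *
        Real.exp (β * |s.im|)) := by ring
    _ = _ := by
        rw [← Real.exp_add]
        congr 2
        ring

theorem exists_norm_mlIntegrand_le {α β : ℝ} (a : ℝ) (hα : 0 < α)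
    (hβ : β < Real.pi * (1 - α / 2)) :
    ∃ C δ : ℝ, 0 < C ∧ 0 < δ ∧ ∀ ζ : ℂ, |ζ.im| ≤ β → ∀ v : ℝ,
      ‖mlIntegrand α a ζ (((-1 / 4 : ℝ) : ℂ) + v * Complex.I)‖ ≤
        C * Real.exp (-ζ.re / 4) * Real.exp (-(δ * |v|)) := by
  obtain ⟨C, δ, hC, hδ, h⟩ := exists_norm_mlKernel_mul_cexp_le (α := α) (β := β) a hα hβ
    (p := -1 / 4) (q := -1 / 4) (by norm_num) (by norm_num)
  -- The 4 bounds 1/|s| on the line Re s = -1/4.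
  refine ⟨4 * C, δ, by positivity, hδ, fun ζ hζ v => ?_⟩
  set s : ℂ := ((-1 / 4 : ℝ) : ℂ) + v * Complex.I with hs
  have hre : s.re = -1 / 4 := by simp [hs]
  have him : s.im = v := by simp [hs]
  have h1 := h ζ hζ s hre.ge hre.le
  have h2 : 1 / 4 ≤ ‖s‖ := by
    refine le_trans ?_ (Complex.abs_re_le_norm s)
    rw [hre]; norm_num [abs_of_neg]
  rw [hre, him] at h1
  have h3 : mlIntegrand α a ζ s = -(mlKernel α a s * Complex.exp (s * ζ)) / s := by
    rw [mlIntegrand]; ring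
  rw [h3, norm_div, norm_neg, div_le_iff₀ (by linarith)]
  refine h1.trans ?_
  have h4 : (-1 / 4 : ℝ) * ζ.re = -ζ.re / 4 := by ring
  rw [h4]
  have h5 : 0 ≤ C * Real.exp (-ζ.re / 4) * Real.exp (-(δ * |v|)) := by positivity
  nlinarith

theorem continuous_mlIntegrand (α a : ℝ) :
    Continuous fun p : ℂ × ℝ => mlIntegrand α a p.1 (((-1 / 4 : ℝ) : ℂ) + p.2 * Complex.I) := by
  have h1 : Continuous fun v : ℝ => mlKernel α a (((-1 / 4 : ℝ) : ℂ) + v * Complex.I) :=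
    continuous_vertical fun s hs => (differentiableAt_mlKernel α a (by rw [hs]; norm_num)
      (by rw [hs]; norm_num)).continuousAt
  have h2 : ∀ v : ℝ, (((-1 / 4 : ℝ) : ℂ) + v * Complex.I) ≠ 0 :=
    ofReal_add_mul_I_ne_zero (by norm_num)
  have h3 := h1.comp (continuous_snd : Continuous fun p : ℂ × ℝ => p.2)
  refine Continuous.mul (Continuous.neg (Continuous.div h3 (by fun_prop) fun p => h2 p.2)) ?_
  fun_prop

theorem integrable_mlIntegrand {α β : ℝ} (a : ℝ) (hα : 0 < α)
    (hβ : β < Real.pi * (1 - α / 2)) {ζ : ℂ} (hζ : |ζ.im| ≤ β) :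
    Integrable fun v : ℝ => mlIntegrand α a ζ (((-1 / 4 : ℝ) : ℂ) + v * Complex.I) := by
  obtain ⟨C, δ, hC, hδ, h⟩ := exists_norm_mlIntegrand_le a hα hβ
  refine ((integrable_exp_neg_mul_abs hδ).const_mul _).mono' ?_ (ae_of_all _ fun v => h ζ hζ v)
  exact ((continuous_mlIntegrand α a).comp (by fun_prop : Continuous fun v : ℝ =>
    ((ζ, v) : ℂ × ℝ))).aestronglyMeasurable

theorem continuousOn_mlBarnes {α β : ℝ} (a : ℝ) (hα : 0 < α)
    (hβ : β < Real.pi * (1 - α / 2)) :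
    ContinuousOn (mlBarnes α a) {ζ | |ζ.im| ≤ β} := by
  obtain ⟨C, δ, hC, hδ, h⟩ := exists_norm_mlIntegrand_le a hα hβ
  refine continuousOn_const.mul fun ζ₀ _ => ?_
  refine continuousWithinAt_of_dominated
    (bound := fun v => C * Real.exp (-(ζ₀.re - 1) / 4) * Real.exp (-(δ * |v|)))
    (Eventually.of_forall fun ζ => ?_) ?_ ((integrable_exp_neg_mul_abs hδ).const_mul _)
    (ae_of_all _ fun v => ?_)
  · exact ((continuous_mlIntegrand α a).comp (by fun_prop : Continuous fun v : ℝ =>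
      ((ζ, v) : ℂ × ℝ))).aestronglyMeasurable
  · have hnear : ∀ᶠ ζ in 𝓝[{ζ : ℂ | |ζ.im| ≤ β}] ζ₀, ζ₀.re - 1 < ζ.re :=
      nhdsWithin_le_nhds (Complex.continuous_re.continuousAt.eventually (lt_mem_nhds (by linarith)))
    filter_upwards [hnear, self_mem_nhdsWithin] with ζ h1 h2
    refine ae_of_all _ fun v => (h ζ h2 v).trans ?_
    gcongr
  · exact ((continuous_mlIntegrand α a).comp (by fun_prop : Continuous fun ζ : ℂ =>
      ((ζ, v) : ℂ × ℝ))).continuousWithinAt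

/-- The recurrence `E_{α,1}(-z) = 1 - z E_{α,1+α}(-z)`. -/
theorem mlBarnes_one_eq {α β : ℝ} (hα : 0 < α) (hβ : β < Real.pi * (1 - α / 2)) {ζ : ℂ}
    (hζ : |ζ.im| ≤ β) :
    mlBarnes α 1 ζ = 1 - Complex.exp ζ * mlBarnes α (1 + α) ζ := by
  obtain ⟨C, δ, hC, hδ, h⟩ := exists_norm_mlKernel_mul_cexp_le (α := α) (β := β) 1 hα hβ
    (p := -1 / 4) (q := 3 / 4) (by norm_num) (by norm_num)
  -- The line is moved by exactly one unit, from -1/4 to 3/4, across the simple pole at 0, whose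
  -- residue is the term 1 of the recurrence.
  have key := integral_vertical_sub_eq (g := fun s => mlKernel α 1 s * Complex.exp (s * ζ))
    (a := -1 / 4) (b := 3 / 4) (C := C * Real.exp |ζ.re|) (by norm_num) (by norm_num) hδ
    (fun s h1 h2 => (differentiableAt_mlKernel α 1 (by linarith) (by linarith)).mul
      (by fun_prop))
    (fun s h1 h2 => (h ζ hζ s h1 h2).trans (by
      gcongr
      have h3 : |s.re| ≤ 1 := abs_le.2 ⟨by linarith, by linarith⟩
      calc s.re * ζ.re ≤ |s.re * ζ.re| := le_abs_self _
        _ = |s.re| * |ζ.re| := abs_mul _ _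
        _ ≤ 1 * |ζ.re| := by gcongr
        _ = _ := one_mul _))
  have h0 : mlKernel α 1 0 * Complex.exp (0 * ζ) = 1 := by
    simp [mlKernel, Complex.Gamma_one]
  rw [h0] at key
  have h1 : ∫ y : ℝ, mlKernel α 1 (((-1 / 4 : ℝ) : ℂ) + y * Complex.I) *
      Complex.exp ((((-1 / 4 : ℝ) : ℂ) + y * Complex.I) * ζ) /
        (((-1 / 4 : ℝ) : ℂ) + y * Complex.I) =
      -∫ v : ℝ, mlIntegrand α 1 ζ (((-1 / 4 : ℝ) : ℂ) + v * Complex.I) := by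
    rw [← integral_neg]
    refine integral_congr_ae (ae_of_all _ fun y => ?_)
    simp only [mlIntegrand]
    ring
  have h2 : ∫ y : ℝ, mlKernel α 1 (((3 / 4 : ℝ) : ℂ) + y * Complex.I) *
      Complex.exp ((((3 / 4 : ℝ) : ℂ) + y * Complex.I) * ζ) /
        (((3 / 4 : ℝ) : ℂ) + y * Complex.I) =
      Complex.exp ζ * ∫ v : ℝ, mlIntegrand α (1 + α) ζ (((-1 / 4 : ℝ) : ℂ) + v * Complex.I) := by
    rw [← integral_const_mul]
    refine integral_congr_ae (ae_of_all _ fun y => ?_)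
    simp only [mlIntegrand]
    -- On the shifted line s = w + 1: one step of the functional equation in Γ(1+s) and in Γ(1-s)
    -- flips the sign, and α(w+1) turns the parameter 1 into 1 + α.
    set w : ℂ := ((-1 / 4 : ℝ) : ℂ) + y * Complex.I with hw
    have hw0 : w ≠ 0 := ofReal_add_mul_I_ne_zero (by norm_num) y
    have hs : ((3 / 4 : ℝ) : ℂ) + y * Complex.I = w + 1 := by rw [hw]; push_cast; ring
    have hw1 : w + 1 ≠ 0 := by rw [← hs]; exact ofReal_add_mul_I_ne_zero (by norm_num) y
    have g1 : Complex.Gamma (1 + (w + 1)) = (w + 1) * Complex.Gamma (1 + w) := by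
      rw [add_comm 1 (w + 1), Complex.Gamma_add_one _ hw1, add_comm w 1]
    have g2 : Complex.Gamma (1 - w) = -w * Complex.Gamma (-w) := by
      rw [← Complex.Gamma_add_one _ (neg_ne_zero.2 hw0)]
      congr 1; ring
    have g3 : (1 : ℂ) - (w + 1) = -w := by ring
    have g4 : ((1 : ℝ) : ℂ) + α * (w + 1) = ((1 + α : ℝ) : ℂ) + α * w := by push_cast; ring
    have g5 : Complex.exp ((w + 1) * ζ) = Complex.exp ζ * Complex.exp (w * ζ) := by
      rw [← Complex.exp_add]; congr 1; ring
    rw [hs, mlKernel, mlKernel, g1, g2, g3, g4, g5]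
    field_simp
  rw [h1, h2] at key
  have hpi : (Real.pi : ℂ) ≠ 0 := Complex.ofReal_ne_zero.2 Real.pi_ne_zero
  rw [mlBarnes, mlBarnes]
  set X := ∫ v : ℝ, mlIntegrand α 1 ζ (((-1 / 4 : ℝ) : ℂ) + v * Complex.I)
  set Y := ∫ v : ℝ, mlIntegrand α (1 + α) ζ (((-1 / 4 : ℝ) : ℂ) + v * Complex.I)
  field_simp
  linear_combination key

/-- Riemann-Liouville integrals of `τ ^ (α - 1) E_{α,α}(-z τ ^ α)`. -/
theorem integral_rl_mlBarnes {α β b : ℝ} (hα : 0 < α) (hβ : β < Real.pi * (1 - α / 2)) {ζ : ℂ}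
    (hζ : |ζ.im| ≤ β) (hb : 0 < b) {t : ℝ} (ht : 0 < t) :
    ∫ τ in (0 : ℝ)..t, (((t - τ) ^ (b - 1) : ℝ) : ℂ) *
        (((τ ^ (α - 1) : ℝ) : ℂ) * mlBarnes α α (ζ + α * Real.log τ)) =
      Real.Gamma b * (((t ^ (α + b - 1) : ℝ) : ℂ) * mlBarnes α (α + b) (ζ + α * Real.log t)) := by
  set S : ℝ → ℂ := fun v => ((-1 / 4 : ℝ) : ℂ) + v * Complex.I with hS
  have hSre : ∀ v, (S v).re = -1 / 4 := fun v => by simp [hS]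
  set F : ℝ → ℝ → ℂ := fun τ v =>
    (((t - τ) ^ (b - 1) : ℝ) : ℂ) * (τ : ℂ) ^ (α + α * S v - 1) * mlIntegrand α α ζ (S v) with hF
  have hpow : ∀ τ : ℝ, 0 < τ → ∀ v c : ℝ, ((τ ^ (c - 1) : ℝ) : ℂ) *
      Complex.exp (S v * (α * Real.log τ)) = (τ : ℂ) ^ (c + α * S v - 1) := by
    intro τ hτ v c
    have hτc : (τ : ℂ) ≠ 0 := Complex.ofReal_ne_zero.2 hτ.ne'
    rw [Complex.ofReal_cpow hτ.le, Complex.cpow_def_of_ne_zero hτc,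
      Complex.cpow_def_of_ne_zero hτc, ← Complex.exp_add, ← Complex.ofReal_log hτ.le]
    congr 1
    push_cast
    ring
  have hadd : ∀ (a' : ℝ) (w : ℂ) (v : ℝ), mlIntegrand α a' (ζ + w) (S v) =
      mlIntegrand α a' ζ (S v) * Complex.exp (S v * w) := by
    intro a' w v
    rw [mlIntegrand, mlIntegrand, mul_add, Complex.exp_add]
    ring
  have hint : Integrable (Function.uncurry F) ((volume.restrict (Ioc 0 t)).prod volume) := by
    -- On Re s = -1/4 the power of τ has real exponent α - α/4 - 1 = 3α/4 - 1, so a product of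
    -- integrable functions dominates and Fubini applies.
    have i1 := integrableOn_rl_rpow hb (q := 3 * α / 4) (by linarith) ht
    have i2 := integrable_mlIntegrand α hα hβ hζ
    have i3 := i1.mul_prod i2.norm
    refine i3.mono' ?_ ?_
    · refine Measurable.aestronglyMeasurable ?_
      refine Measurable.mul (Measurable.mul ?_ ?_) ?_
      · fun_prop
      · refine Measurable.pow ?_ ?_
        · fun_prop
        · fun_prop
      · exact ((continuous_mlIntegrand α α).comp (by fun_prop : Continuous fun p : ℝ × ℝ =>
          ((ζ, p.2) : ℂ × ℝ))).measurable
    · have : ∀ᵐ p : ℝ × ℝ ∂((volume.restrict (Ioc 0 t)).prod volume), p.1 ∈ Ioc 0 t := by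
        have h0 : ∀ᵐ τ ∂(volume.restrict (Ioc 0 t)), τ ∈ Ioc 0 t :=
          ae_restrict_mem measurableSet_Ioc
        exact Measure.quasiMeasurePreserving_fst.ae h0
      filter_upwards [this] with p hp
      simp only [Function.uncurry, hF]
      rw [norm_mul, norm_mul, Complex.norm_real, Complex.norm_cpow_eq_rpow_re_of_pos hp.1,
        Real.norm_of_nonneg (Real.rpow_nonneg (sub_nonneg.2 hp.2) _)]
      have : (α + α * S p.2 - 1 : ℂ).re = 3 * α / 4 - 1 := by
        simp [hSre]; ring
      rw [this]
  have hL : EqOn (fun τ : ℝ => (((t - τ) ^ (b - 1) : ℝ) : ℂ) *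
        (((τ ^ (α - 1) : ℝ) : ℂ) * mlBarnes α α (ζ + α * Real.log τ)))
      (fun τ => 1 / (2 * (Real.pi : ℂ)) * ∫ v, F τ v) (Ioc 0 t) := by
    intro τ hτ
    simp only
    rw [mlBarnes, mul_left_comm _ (1 / (2 * (Real.pi : ℂ))), mul_left_comm _
      (1 / (2 * (Real.pi : ℂ))), ← integral_const_mul, ← integral_const_mul]
    congr 1
    refine integral_congr_ae (ae_of_all _ fun v => ?_)
    simp only [hF]
    change _ * (_ * mlIntegrand α α (ζ + α * Real.log τ) (S v)) = _
    rw [hadd, ← hpow τ hτ.1]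
    ring
  rw [intervalIntegral.integral_of_le ht.le, setIntegral_congr_fun measurableSet_Ioc hL,
    integral_const_mul, integral_integral_swap hint, mlBarnes,
    show ∀ c G T I : ℂ, G * (T * (c * I)) = c * (G * T * I) from fun _ _ _ _ => by ring]
  congr 1
  rw [← integral_const_mul]
  refine integral_congr_ae (ae_of_all _ fun v => ?_)
  simp only
  change ∫ τ in Ioc 0 t, (((t - τ) ^ (b - 1) : ℝ) : ℂ) * (τ : ℂ) ^ (α + α * S v - 1) *
    mlIntegrand α α ζ (S v) = _
  have hp : 0 < (α + α * S v : ℂ).re := by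
    simp [hSre]; linarith
  -- For each s the Beta integral exchanges 1/Γ(α + αs) for 1/Γ(α + b + αs), which is all that
  -- separates the two kernels.
  have hrl := integral_rl_cpow hb hp ht
  rw [intervalIntegral.integral_of_le ht.le] at hrl
  rw [integral_mul_const, hrl]
  rw [show mlIntegrand α (α + b) (ζ + α * Real.log t) (((-1 / 4 : ℝ) : ℂ) + v * Complex.I) = _
    from hadd (α + b) (α * Real.log t) v]
  have e1 := hpow t ht v (α + b)
  have e2 : (α : ℂ) + α * S v + b - 1 = ((α + b : ℝ) : ℂ) + α * S v - 1 := by push_cast; ring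
  have e3 : (α : ℂ) + α * S v + b = ((α + b : ℝ) : ℂ) + α * S v := by push_cast; ring
  rw [e2, e3, ← e1, mlIntegrand, mlIntegrand, mlKernel, mlKernel, ← Complex.Gamma_ofReal]
  have hG : Complex.Gamma (α + α * S v) ≠ 0 := Complex.Gamma_ne_zero_of_re_pos hp
  linear_combination (-(((t ^ (α + b - 1) : ℝ) : ℂ)) * Complex.exp (S v * (α * Real.log t)) *
    Complex.Gamma b * (Complex.Gamma (((α + b : ℝ) : ℂ) + α * S v))⁻¹ * Complex.Gamma (1 + S v) *
    Complex.Gamma (1 - S v) * Complex.exp (S v * ζ) / S v) * mul_inv_cancel₀ hG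

/-! ### The Fourier transform of the profile on a half-line -/

theorem KernelParams.integrableOn_barnes_div {α γ ρ : ℝ} (H : KernelParams α γ ρ) (hγ2 : γ ≤ 2) :
    IntegrableOn (fun x : ℝ => ((1 / x : ℝ) : ℂ) * barnes α γ ρ x) (Ioi 0) := by
  have hγ := H.γ_pos
  obtain ⟨C, hC, hb⟩ := H.exists_norm_barnes_le hγ2
  have hcont : ContinuousOn (fun x : ℝ => ((1 / x : ℝ) : ℂ) * barnes α γ ρ x) (Ioi 0) := by
    refine ContinuousOn.mul ?_ (H.continuousOn_barnes hγ2)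
    refine Complex.continuous_ofReal.comp_continuousOn ?_
    exact continuousOn_const.div continuousOn_id fun x hx => ne_of_gt hx
  have hmeas := hcont.aestronglyMeasurable (μ := volume) measurableSet_Ioi
  rw [← Ioc_union_Ioi_eq_Ioi (zero_le_one' ℝ)]
  refine IntegrableOn.union ?_ ?_
  · have h1 : IntegrableOn (fun x : ℝ => C * x ^ (γ / 4 - 1)) (Ioc 0 1) :=
      ((intervalIntegrable_iff_integrableOn_Ioc_of_le zero_le_one).1
        (intervalIntegral.intervalIntegrable_rpow' (by linarith))).const_mul C
    refine Integrable.mono' h1 (hmeas.mono_set Ioc_subset_Ioi_self) ?_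
    filter_upwards [ae_restrict_mem measurableSet_Ioc] with x hx
    have hx0 : (0 : ℝ) < x := hx.1
    rw [norm_mul, Complex.norm_real, Real.norm_of_nonneg (by positivity), Real.rpow_sub_one hx0.ne']
    calc _ ≤ 1 / x * (C * x ^ (γ / 4)) := by gcongr; exact (hb x hx0).1
      _ = _ := by ring
  · have h1 : IntegrableOn (fun x : ℝ => C * x ^ (-(γ / 4) - 1)) (Ioi 1) :=
      (integrableOn_Ioi_rpow_of_lt (by linarith) one_pos).const_mul C
    refine Integrable.mono' h1 (hmeas.mono_set (Ioi_subset_Ioi zero_le_one)) ?_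
    filter_upwards [ae_restrict_mem measurableSet_Ioi] with x hx
    have hx0 : (0 : ℝ) < x := zero_lt_one.trans hx
    rw [norm_mul, Complex.norm_real, Real.norm_of_nonneg (by positivity), Real.rpow_sub_one hx0.ne']
    calc _ ≤ 1 / x * (C * x ^ (-(γ / 4))) := by gcongr; exact (hb x hx0).2
      _ = _ := by ring

theorem barnes_div_comp (α γ ρ : ℝ) {l : ℝ} (hl : 0 < l) (x : ℝ) :
    ((1 / x : ℝ) : ℂ) * barnes α γ ρ (x / l) =
      ((l⁻¹ : ℝ) : ℂ) * (((1 / (l⁻¹ * x) : ℝ) : ℂ) * barnes α γ ρ (l⁻¹ * x)) := by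
  rw [← mul_assoc, ← Complex.ofReal_mul, div_eq_inv_mul x l]
  congr 2
  field_simp

theorem KernelParams.integrableOn_barnes_scaled {α γ ρ : ℝ} (H : KernelParams α γ ρ)
    (hγ2 : γ ≤ 2) {l : ℝ} (hl : 0 < l) :
    IntegrableOn (fun x : ℝ => ((1 / x : ℝ) : ℂ) * barnes α γ ρ (x / l)) (Ioi 0) := by
  have h := H.integrableOn_barnes_div hγ2
  have h2 : IntegrableOn (fun x : ℝ => ((1 / (l⁻¹ * x) : ℝ) : ℂ) * barnes α γ ρ (l⁻¹ * x))
      (Ioi 0) :=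
    (integrableOn_Ioi_comp_mul_left_iff
      (fun x : ℝ => ((1 / x : ℝ) : ℂ) * barnes α γ ρ x) 0 (inv_pos.2 hl)).2 (by simpa using h)
  refine (h2.const_mul ((l⁻¹ : ℝ) : ℂ)).congr (ae_of_all _ fun x => ?_)
  exact (barnes_div_comp α γ ρ hl x).symm

/-- The measure dx/x is invariant under scaling. This makes the L¹ norm of the closed form at time t
an exact multiple of t^{α-1}. -/
theorem integral_norm_barnes_scaled (α γ ρ : ℝ) {l : ℝ} (hl : 0 < l) :
    ∫ x in Ioi (0 : ℝ), ‖((1 / x : ℝ) : ℂ) * barnes α γ ρ (x / l)‖ =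
      ∫ x in Ioi (0 : ℝ), ‖((1 / x : ℝ) : ℂ) * barnes α γ ρ x‖ := by
  have h := integral_comp_mul_left_Ioi
    (fun x : ℝ => ‖((1 / x : ℝ) : ℂ) * barnes α γ ρ x‖) 0 (inv_pos.2 hl)
  simp only [mul_zero, inv_inv, smul_eq_mul] at h
  have h2 : ∀ x : ℝ, ‖((1 / x : ℝ) : ℂ) * barnes α γ ρ (x / l)‖ =
      l⁻¹ * ‖((1 / (l⁻¹ * x) : ℝ) : ℂ) * barnes α γ ρ (l⁻¹ * x)‖ := by
    intro x
    rw [barnes_div_comp α γ ρ hl x, norm_mul, Complex.norm_real,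
      Real.norm_of_nonneg (inv_pos.2 hl).le]
  simp only [h2]
  rw [integral_const_mul, h]
  field_simp

/-- The damped half-line Fourier transform of the profile. -/
theorem KernelParams.integral_damped_barnes {α γ ρ : ℝ} (H : KernelParams α γ ρ) (hγ2 : γ ≤ 2)
    {l : ℝ} (hl : 0 < l) {r : ℂ} (hr : 0 < r.re) :
    ∫ x in Ioi (0 : ℝ), Complex.exp (-(r * x)) * (((1 / x : ℝ) : ℂ) * barnes α γ ρ (x / l)) =
      1 / (2 * (Real.pi : ℂ)) * ∫ y : ℝ,
        regKernel α γ ρ (((-γ / 4 : ℝ) : ℂ) + y * Complex.I) *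
        (Complex.Gamma (-(((-γ / 4 : ℝ) : ℂ) + y * Complex.I)) *
        Complex.exp ((((-γ / 4 : ℝ) : ℂ) + y * Complex.I) * (Real.log l + Complex.log r))) := by
  have hγ := H.γ_pos
  obtain ⟨q1, q2, q3, q4, -⟩ := H.quarter hγ2
  set S : ℝ → ℂ := fun y => ((-γ / 4 : ℝ) : ℂ) + y * Complex.I with hS
  have hSre : ∀ y, (S y).re = -γ / 4 := fun y => by simp [hS]
  have hr0 : r ≠ 0 := by rintro rfl; simp at hr
  have hlc : (l : ℂ) ≠ 0 := Complex.ofReal_ne_zero.2 hl.ne'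
  set F : ℝ → ℝ → ℂ := fun x y => regKernel α γ ρ (S y) * Complex.exp (S y * Real.log l) *
    ((x : ℂ) ^ (-S y - 1) * Complex.exp (-(r * x))) with hF
  have hreg : Integrable fun y : ℝ => regKernel α γ ρ (S y) * Complex.exp (S y * Real.log l) := by
    have := H.integrable_barnes q1 q2 q4 (inv_pos.2 hl)
    refine this.congr (ae_of_all _ fun y => ?_)
    simp only
    change regKernel α γ ρ (S y) * ((l⁻¹ : ℝ) : ℂ) ^ (-S y) = _
    rw [Complex.cpow_def_of_ne_zero (Complex.ofReal_ne_zero.2 (inv_pos.2 hl).ne'),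
      ← Complex.ofReal_log (inv_pos.2 hl).le, Real.log_inv]
    congr 2
    push_cast
    ring
  -- The damping Re r > 0 makes the double integral absolutely convergent, and Re(-ξ) = γ/4 > 0
  -- makes the power of x integrable at 0.
  have hint : Integrable (Function.uncurry F) ((volume.restrict (Ioi 0)).prod volume) := by
    have i1 : IntegrableOn (fun x : ℝ => x ^ (γ / 4 - 1) * Real.exp (-r.re * x ^ (1 : ℝ))) (Ioi 0) :=
      integrableOn_rpow_mul_exp_neg_mul_rpow (by linarith) one_pos hr
    have i3 := i1.mul_prod hreg.norm
    refine i3.mono' ?_ ?_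
    · have m1 : AEStronglyMeasurable (fun p : ℝ × ℝ => regKernel α γ ρ (S p.2) *
          Complex.exp (S p.2 * Real.log l)) ((volume.restrict (Ioi 0)).prod volume) :=
        hreg.aestronglyMeasurable.comp_snd
      refine m1.mul (Measurable.aestronglyMeasurable ?_)
      refine Measurable.mul (Measurable.pow ?_ ?_) ?_ <;> fun_prop
    · have : ∀ᵐ p : ℝ × ℝ ∂((volume.restrict (Ioi 0)).prod volume), p.1 ∈ Ioi (0 : ℝ) := by
        have h0 : ∀ᵐ τ ∂(volume.restrict (Ioi (0 : ℝ))), τ ∈ Ioi (0 : ℝ) :=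
          ae_restrict_mem measurableSet_Ioi
        exact Measure.quasiMeasurePreserving_fst.ae h0
      filter_upwards [this] with p hp
      simp only [Function.uncurry, hF]
      rw [norm_mul, norm_ofReal_cpow_mul_cexp_neg_mul hp]
      have : (-S p.2 - 1 : ℂ).re = γ / 4 - 1 := by
        simp [hSre]; ring
      rw [this, Real.rpow_one, neg_mul, mul_comm]
  have hL : EqOn (fun x : ℝ => Complex.exp (-(r * x)) *
      (((1 / x : ℝ) : ℂ) * barnes α γ ρ (x / l)))
      (fun x => 1 / (2 * (Real.pi : ℂ)) * ∫ y, F x y) (Ioi 0) := by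
    intro x hx
    have hx0 : (0 : ℝ) < x := hx
    have hxc : (x : ℂ) ≠ 0 := Complex.ofReal_ne_zero.2 hx0.ne'
    simp only
    rw [barnes, verticalBarnes, show ∀ c G T I : ℂ, G * (T * (c * I)) = c * (G * T * I) from
      fun _ _ _ _ => by ring]
    congr 1
    rw [← integral_const_mul]
    refine integral_congr_ae (ae_of_all _ fun y => ?_)
    simp only [hF]
    change _ * (regKernel α γ ρ (S y) * ((x / l : ℝ) : ℂ) ^ (-S y)) = _
    rw [Complex.cpow_def_of_ne_zero (Complex.ofReal_ne_zero.2 (div_pos hx0 hl).ne'),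
      ← Complex.ofReal_log (div_pos hx0 hl).le, Real.log_div hx0.ne' hl.ne',
      Complex.cpow_sub _ _ hxc, Complex.cpow_one, Complex.cpow_def_of_ne_zero hxc,
      ← Complex.ofReal_log hx0.le, show ((Real.log x - Real.log l : ℝ) : ℂ) * -S y =
        Real.log x * -S y + S y * Real.log l by push_cast; ring, Complex.exp_add]
    push_cast
    ring
  rw [setIntegral_congr_fun measurableSet_Ioi hL, integral_const_mul,
    integral_integral_swap hint]
  congr 1
  refine integral_congr_ae (ae_of_all _ fun y => ?_)
  simp only [hF]
  rw [integral_const_mul, integral_cpow_mul_cexp_neg_mul (by simp [hSre]; linarith) hr]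
  change _ = regKernel α γ ρ (S y) * (Complex.Gamma (-S y) *
    Complex.exp (S y * (Real.log l + Complex.log r)))
  have harg : r.arg ≠ Real.pi := by
    intro h
    have := (Complex.arg_eq_pi_iff.1 h).1
    linarith
  rw [one_div, Complex.cpow_def_of_ne_zero (inv_ne_zero hr0), Complex.log_inv _ harg, mul_add,
    Complex.exp_add, neg_mul_neg, mul_comm (Complex.log r)]
  ring

/-- The half-line Fourier transform of the profile. -/
theorem KernelParams.integral_fourier_barnes {α γ ρ : ℝ} (H : KernelParams α γ ρ) (hγ2 : γ ≤ 2)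
    {l : ℝ} (hl : 0 < l) {k : ℝ} (hk : k ≠ 0) :
    (Integrable fun y : ℝ => regKernel α γ ρ (((-γ / 4 : ℝ) : ℂ) + y * Complex.I) *
        (Complex.Gamma (-(((-γ / 4 : ℝ) : ℂ) + y * Complex.I)) *
        Complex.exp ((((-γ / 4 : ℝ) : ℂ) + y * Complex.I) *
          (Real.log l + Complex.log (-(Complex.I * k)))))) ∧
    ∫ x in Ioi (0 : ℝ), Complex.exp (Complex.I * k * x) *
        (((1 / x : ℝ) : ℂ) * barnes α γ ρ (x / l)) =
      1 / (2 * (Real.pi : ℂ)) * ∫ y : ℝ,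
        regKernel α γ ρ (((-γ / 4 : ℝ) : ℂ) + y * Complex.I) *
        (Complex.Gamma (-(((-γ / 4 : ℝ) : ℂ) + y * Complex.I)) *
        Complex.exp ((((-γ / 4 : ℝ) : ℂ) + y * Complex.I) *
          (Real.log l + Complex.log (-(Complex.I * k))))) := by
  have hγ := H.γ_pos
  obtain ⟨q1, q2, q3, q4, -⟩ := H.quarter hγ2
  obtain ⟨δ, hδ, hbd⟩ := H.exists_norm_regKernel_le
  obtain ⟨C, hC, hreg⟩ := hbd (-γ / 4) (-γ / 4) q1 q2 q4
  -- As r approaches the imaginary axis, r^ξ grows at a rate up to π/2, which Γ(-ξ) compensates up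
  -- to δ/2. The kernel's own decay δ pays for this and leaves δ/2.
  obtain ⟨D, hD, hGam⟩ := exists_norm_Gamma_le' (a := γ / 4) (γ / 4) (by linarith)
    (η := Real.pi / 2 - δ / 2) (by linarith)
  set S : ℝ → ℂ := fun y => ((-γ / 4 : ℝ) : ℂ) + y * Complex.I with hS
  have hSre : ∀ y, (S y).re = -γ / 4 := fun y => by simp [hS]
  have hSim : ∀ y, (S y).im = y := fun y => by simp [hS]
  set R : ℝ → ℂ := fun ε => ε - Complex.I * k with hR
  have hRre : ∀ ε, (R ε).re = ε := fun ε => by simp [hR]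
  have hRim : ∀ ε, (R ε).im = -k := fun ε => by simp [hR]
  -- Since k ≠ 0, the points ε - ik stay off the branch cut down to ε = 0, so the logarithm is
  -- continuous in the limit.
  have hRslit : ∀ ε, R ε ∈ Complex.slitPlane := fun ε => Or.inr (by rw [hRim]; simpa using hk)
  have hR0 : R 0 = -(Complex.I * k) := by simp [hR]
  have hRcont : Continuous R := by fun_prop
  have hlogcont : Continuous fun ε => Complex.log (R ε) :=
    hRcont.clog hRslit
  set Φ : ℝ → ℝ → ℂ := fun ε y => regKernel α γ ρ (S y) * (Complex.Gamma (-S y) *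
    Complex.exp (S y * (Real.log l + Complex.log (R ε)))) with hΦ
  set bound : ℝ → ℝ := fun y => C * D * Real.exp (-γ / 4 * (Real.log l + Real.log |k|)) *
    Real.exp (-(δ / 2 * |y|)) with hbound
  have hbi : Integrable bound := (integrable_exp_neg_mul_abs (by positivity)).const_mul _
  have hΦb : ∀ ε, 0 ≤ ε → ∀ y, ‖Φ ε y‖ ≤ bound y := by
    intro ε hε y
    have g1 := hreg (S y) (hSre y).ge (hSre y).le
    have g2 := hGam (-S y) (by rw [Complex.neg_re, hSre]; linarith)
      (by rw [Complex.neg_re, hSre]; linarith)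
    rw [hSim] at g1
    rw [Complex.neg_im, hSim, abs_neg] at g2
    have g3 : ‖Complex.exp (S y * (Real.log l + Complex.log (R ε)))‖ ≤
        Real.exp (-γ / 4 * (Real.log l + Real.log |k|)) * Real.exp (Real.pi / 2 * |y|) := by
      have harg : |(Real.log l + Complex.log (R ε)).im| ≤ Real.pi / 2 := by
        simp only [Complex.add_im, Complex.ofReal_im, zero_add, Complex.log_im]
        exact Complex.abs_arg_le_pi_div_two_iff.2 (by rw [hRre]; exact hε)
      have := norm_cexp_mul_le (s := S y) harg
      rw [hSre, hSim] at this
      refine this.trans ?_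
      gcongr ?_ * _
      rw [Real.exp_le_exp]
      -- Re ξ = -γ/4 is negative, so the lower bound |k| on |R ε| gives an upper bound uniform in ε.
      have hkR : |k| ≤ ‖R ε‖ := by
        have := Complex.abs_im_le_norm (R ε)
        rwa [hRim, abs_neg] at this
      have hlog := Real.log_le_log (abs_pos.2 hk) hkR
      simp only [Complex.add_re, Complex.ofReal_re, Complex.log_re]
      nlinarith
    simp only [hΦ, hbound]
    rw [norm_mul, norm_mul]
    calc _ ≤ (C * Real.exp (-(δ * |y|))) * ((D * Real.exp (-((Real.pi / 2 - δ / 2) * |y|))) *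
          (Real.exp (-γ / 4 * (Real.log l + Real.log |k|)) * Real.exp (Real.pi / 2 * |y|))) := by
          gcongr
      _ = C * D * Real.exp (-γ / 4 * (Real.log l + Real.log |k|)) * (Real.exp (-(δ * |y|)) *
          Real.exp (-((Real.pi / 2 - δ / 2) * |y|)) * Real.exp (Real.pi / 2 * |y|)) := by ring
      _ = _ := by
          rw [← Real.exp_add, ← Real.exp_add]
          congr 2
          ring
  have hΦm : ∀ ε, AEStronglyMeasurable (Φ ε) := by
    intro ε
    have c1 : Continuous fun y => regKernel α γ ρ (S y) := continuous_vertical fun s hs =>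
      (differentiableAt_regKernel α ρ hγ (by rwa [hs]) (by rwa [hs]) (by rwa [hs])).continuousAt
    have c2 : Continuous fun y => Complex.Gamma (-S y) :=
      continuous_vertical (f := fun s => Complex.Gamma (-s)) fun s hs =>
        ContinuousAt.comp (f := fun s : ℂ => -s)
        (differentiableAt_Gamma_of_re_pos (s := -s) (by
          rw [Complex.neg_re, hs]; linarith)).continuousAt (by fun_prop)
    exact (c1.mul (c2.mul (by fun_prop))).aestronglyMeasurable
  have hΦ0 : ∀ y, Φ 0 y = regKernel α γ ρ (((-γ / 4 : ℝ) : ℂ) + y * Complex.I) *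
        (Complex.Gamma (-(((-γ / 4 : ℝ) : ℂ) + y * Complex.I)) *
        Complex.exp ((((-γ / 4 : ℝ) : ℂ) + y * Complex.I) *
          (Real.log l + Complex.log (-(Complex.I * k))))) := by
    intro y
    simp only [hΦ, hR0, hS]
  simp only [← hΦ0]
  refine ⟨hbi.mono' (hΦm 0) (ae_of_all _ (hΦb 0 le_rfl)), ?_⟩
  have hlim1 : Tendsto (fun ε => 1 / (2 * (Real.pi : ℂ)) * ∫ y, Φ ε y) (𝓝[>] 0)
      (𝓝 (1 / (2 * (Real.pi : ℂ)) * ∫ y, Φ 0 y)) := by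
    refine Tendsto.const_mul _ ?_
    refine tendsto_integral_filter_of_dominated_convergence bound
      (Eventually.of_forall hΦm) ?_ hbi (ae_of_all _ fun y => ?_)
    · filter_upwards [self_mem_nhdsWithin] with ε hε
      exact ae_of_all _ (hΦb ε (le_of_lt hε))
    · have : Continuous fun ε => Φ ε y := by
        simp only [hΦ]
        fun_prop
      exact (this.tendsto 0).mono_left nhdsWithin_le_nhds
  have hprof := H.integrableOn_barnes_scaled hγ2 hl
  have hlim2 : Tendsto (fun ε => ∫ x in Ioi (0 : ℝ), Complex.exp (-(R ε * x)) *
        (((1 / x : ℝ) : ℂ) * barnes α γ ρ (x / l))) (𝓝[>] 0)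
      (𝓝 (∫ x in Ioi (0 : ℝ), Complex.exp (-(R 0 * x)) *
        (((1 / x : ℝ) : ℂ) * barnes α γ ρ (x / l)))) := by
    refine tendsto_integral_filter_of_dominated_convergence
      (fun x => ‖((1 / x : ℝ) : ℂ) * barnes α γ ρ (x / l)‖)
      (Eventually.of_forall fun ε => ?_) ?_ hprof.norm (ae_of_all _ fun x => ?_)
    · exact (by fun_prop : Continuous fun x : ℝ =>
        Complex.exp (-(R ε * x))).aestronglyMeasurable.mul hprof.aestronglyMeasurable
    · filter_upwards [self_mem_nhdsWithin] with ε hε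
      have hε' : (0 : ℝ) < ε := hε
      filter_upwards [ae_restrict_mem measurableSet_Ioi] with x hx
      have hx' : (0 : ℝ) < x := hx
      rw [norm_mul, Complex.norm_exp]
      have : (-(R ε * x)).re = -(ε * x) := by simp [hRre]
      rw [this]
      have h1 : Real.exp (-(ε * x)) ≤ 1 := Real.exp_le_one_iff.2 (by nlinarith)
      exact mul_le_of_le_one_left (norm_nonneg _) h1
    · have : Continuous fun ε => Complex.exp (-(R ε * x)) *
          (((1 / x : ℝ) : ℂ) * barnes α γ ρ (x / l)) := by fun_prop
      exact (this.tendsto 0).mono_left nhdsWithin_le_nhds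
  have hlim3 := hlim1.congr' (f₂ := fun ε => ∫ x in Ioi (0 : ℝ), Complex.exp (-(R ε * x)) *
        (((1 / x : ℝ) : ℂ) * barnes α γ ρ (x / l))) (by
    filter_upwards [self_mem_nhdsWithin] with ε hε
    exact (H.integral_damped_barnes hγ2 hl (r := R ε) (by rw [hRre]; exact hε)).symm)
  rw [← tendsto_nhds_unique hlim2 hlim3]
  refine integral_congr_ae (ae_of_all _ fun x => ?_)
  simp only [hR0]
  congr 2
  ring

/-! ### The Fourier transform of the closed form -/

/-- A logarithm of `μ ψ_γ^θ(k)`. -/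
def freqLog (γ θ μ k : ℝ) : ℂ :=
  Real.log μ + γ * Real.log |k| + Real.sign k * θ * Real.pi / 2 * Complex.I

theorem exp_freqLog (γ θ : ℝ) {μ k : ℝ} (hμ : 0 < μ) (hk : k ≠ 0) :
    Complex.exp (freqLog γ θ μ k) = μ * rieszFellerSymbol γ θ k := by
  rw [freqLog, rieszFellerSymbol, Complex.exp_add, Complex.exp_add, ← Complex.ofReal_exp,
    Real.exp_log hμ, ← Complex.ofReal_mul, ← Complex.ofReal_exp,
    Real.rpow_def_of_pos (abs_pos.2 hk), mul_comm γ, mul_assoc]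
  congr 3
  push_cast
  ring

theorem freqLog_im (γ θ μ k : ℝ) : (freqLog γ θ μ k).im = Real.sign k * θ * Real.pi / 2 := by
  have : (Real.sign k * θ * Real.pi / 2 : ℂ) = ((Real.sign k * θ * Real.pi / 2 : ℝ) : ℂ) := by
    push_cast; rfl
  rw [freqLog, this]
  simp

theorem abs_sign_le_one (k : ℝ) : |Real.sign k| ≤ 1 := by
  rcases lt_trichotomy k 0 with h | h | h
  · simp [Real.sign_of_neg h]
  · simp [h]
  · simp [Real.sign_of_pos h]

theorem abs_freqLog_im_le (γ θ μ k : ℝ) : |(freqLog γ θ μ k).im| ≤ |θ| * Real.pi / 2 := by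
  rw [freqLog_im, abs_div, abs_mul, abs_mul, abs_of_pos Real.pi_pos, abs_two]
  have := abs_sign_le_one k
  have h : |Real.sign k| * |θ| ≤ 1 * |θ| := by gcongr
  rw [one_mul] at h
  have := Real.pi_pos
  gcongr

/-- The hypotheses on the parameters of the equation. -/
structure EqParams (α γ θ μ : ℝ) : Prop where
  α_pos : 0 < α
  α_le : α ≤ 1
  γ_pos : 0 < γ
  γ_le : γ ≤ 2
  θ_le : |θ| ≤ γ
  μ_pos : 0 < μ
  sector : |θ| < 2 - α

/-- One has |θ| ≤ min(γ, 2-γ) ≤ 1 ≤ 2 - α, and equality throughout forces α = γ = |θ| = 1. The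
strict inequality `sector` serves both the decay of the kernel and the convergence of `mlBarnes` at
μ ψ(k) t^α. -/
theorem EqParams.of_hyps {α γ θ μ : ℝ} (hα : 0 < α) (hα1 : α ≤ 1) (hγ : 0 < γ) (hγ2 : γ ≤ 2)
    (hθ : |θ| ≤ min γ (2 - γ)) (hμ : 0 < μ) (hdeg : ¬ (α = 1 ∧ γ = 1 ∧ |θ| = 1)) :
    EqParams α γ θ μ := by
  have h1 := hθ.trans (min_le_left _ _)
  have h2 := hθ.trans (min_le_right _ _)
  refine ⟨hα, hα1, hγ, hγ2, h1, hμ, ?_⟩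
  by_contra h
  push Not at h
  exact hdeg ⟨by linarith, by linarith, by linarith⟩

namespace EqParams

variable {α γ θ μ : ℝ}

theorem sector' (H : EqParams α γ θ μ) : |θ| * Real.pi / 2 < Real.pi * (1 - α / 2) := by
  have := H.sector
  have := Real.pi_pos
  nlinarith

/-- With ρ = 1/2 - θσ/(2γ), where σ stands for the sign of x, the decay condition becomes -θσ < 2 -
α, and ρ ≥ 0 follows from |θ| ≤ γ. -/
theorem kernelParams (H : EqParams α γ θ μ) {σ : ℝ} (hσ : |σ| = 1) :
    KernelParams α γ ((γ - θ * σ) / (2 * γ)) := by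
  have hγ := H.γ_pos
  have h0 : |θ * σ| = |θ| := by rw [abs_mul, hσ, mul_one]
  have h1 := abs_le.1 (h0.trans_le H.θ_le)
  have h2 := abs_lt.1 (h0.trans_lt H.sector)
  refine ⟨H.α_pos, hγ, div_nonneg (by linarith) (by linarith), ?_⟩
  rw [div_add' _ _ _ hγ.ne', div_lt_div_iff₀ (by linarith) hγ]
  nlinarith

theorem kernelParams_pos (H : EqParams α γ θ μ) : KernelParams α γ ((γ - θ) / (2 * γ)) := by
  simpa using H.kernelParams (σ := 1) (by simp)

theorem kernelParams_neg (H : EqParams α γ θ μ) : KernelParams α γ ((γ + θ) / (2 * γ)) := by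
  simpa using H.kernelParams (σ := -1) (by simp)

theorem kernelParams_rho (H : EqParams α γ θ μ) {x : ℝ} (hx : x ≠ 0) :
    KernelParams α γ (rho γ θ x) := by
  refine H.kernelParams ?_
  rcases lt_or_gt_of_ne hx with h | h
  · simp [Real.sign_of_neg h]
  · simp [Real.sign_of_pos h]

theorem scale_pos (H : EqParams α γ θ μ) {t : ℝ} (ht : 0 < t) : 0 < (μ * t ^ α) ^ (1 / γ) := by
  have := H.μ_pos
  positivity

theorem similarity_pos (H : EqParams α γ θ μ) {x t : ℝ} (hx : x ≠ 0) (ht : 0 < t) :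
    0 < similarity α γ μ x t :=
  div_pos (abs_pos.2 hx) (H.scale_pos ht)

theorem closedForm_eq (H : EqParams α γ θ μ) {x t : ℝ} (hx : x ≠ 0) (ht : 0 < t) :
    closedForm α γ θ μ x t = ((t ^ (α - 1) / (γ * |x|) : ℝ) : ℂ) *
      barnes α γ (rho γ θ x) (similarity α γ μ x t) := by
  rw [closedForm, (H.kernelParams_rho hx).foxH_eq H.γ_le (H.similarity_pos hx ht)]

theorem closedForm_of_pos (H : EqParams α γ θ μ) {x t : ℝ} (hx : 0 < x) (ht : 0 < t) :
    closedForm α γ θ μ x t = ((t ^ (α - 1) / γ : ℝ) : ℂ) *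
      (((1 / x : ℝ) : ℂ) * barnes α γ ((γ - θ) / (2 * γ)) (x / (μ * t ^ α) ^ (1 / γ))) := by
  rw [H.closedForm_eq hx.ne' ht, rho, similarity, Real.sign_of_pos hx, abs_of_pos hx, mul_one,
    ← mul_assoc, ← Complex.ofReal_mul]
  congr 2
  field_simp

theorem closedForm_neg_of_pos (H : EqParams α γ θ μ) {x t : ℝ} (hx : 0 < x) (ht : 0 < t) :
    closedForm α γ θ μ (-x) t = ((t ^ (α - 1) / γ : ℝ) : ℂ) *
      (((1 / x : ℝ) : ℂ) * barnes α γ ((γ + θ) / (2 * γ)) (x / (μ * t ^ α) ^ (1 / γ))) := by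
  rw [H.closedForm_eq (neg_ne_zero.2 hx.ne') ht, rho, similarity,
    Real.sign_of_neg (neg_lt_zero.2 hx), abs_neg, abs_of_pos hx, mul_neg_one, sub_neg_eq_add,
    ← mul_assoc, ← Complex.ofReal_mul]
  congr 2
  field_simp

end EqParams

/-! ### Trigonometric merging of the two half-lines -/

/-- The factor Γ(-ξ) comes from the half-line transform of x^{-ξ-1}. Two uses of the reflection
formula isolate the dependence on ρ in sin(πρξ). -/
theorem regKernel_mul_Gamma (α ρ : ℝ) {γ : ℝ} (hγ : 0 < γ) {ξ : ℂ} (hξ : ξ ≠ 0) :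
    regKernel α γ ρ ξ * Complex.Gamma (-ξ) =
      -(γ / ξ * mlKernel α α (ξ / γ)) *
        (Complex.sin (Real.pi * (ρ * ξ)) / Complex.sin (Real.pi * ξ)) := by
  have hpi : (Real.pi : ℂ) ≠ 0 := Complex.ofReal_ne_zero.2 Real.pi_ne_zero
  have hγc : (γ : ℂ) ≠ 0 := Complex.ofReal_ne_zero.2 hγ.ne'
  have h1 : (ρ * ξ) * ((Complex.Gamma (1 - ρ * ξ))⁻¹ * (Complex.Gamma (1 + ρ * ξ))⁻¹) =
      Complex.sin (Real.pi * (ρ * ξ)) / Real.pi := by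
    have e1 := Complex.Gamma_mul_Gamma_one_sub (ρ * ξ)
    have e2 := Complex.one_div_Gamma_eq_self_mul_one_div_Gamma_add_one (ρ * ξ)
    rw [← inv_inj, mul_inv, e2, inv_div] at e1
    rw [← e1, add_comm 1 ((ρ : ℂ) * ξ)]
    ring
  have h2 : Complex.Gamma (1 + ξ) * Complex.Gamma (-ξ) =
      -(Real.pi / Complex.sin (Real.pi * ξ)) := by
    have e1 := Complex.Gamma_mul_Gamma_one_sub (-ξ)
    rw [sub_neg_eq_add, mul_neg, Complex.sin_neg, div_neg] at e1
    rw [← e1, mul_comm]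
  have h3 : regKernel α γ ρ ξ * Complex.Gamma (-ξ) = γ / ξ * mlKernel α α (ξ / γ) *
      ((ρ * ξ) * ((Complex.Gamma (1 - ρ * ξ))⁻¹ * (Complex.Gamma (1 + ρ * ξ))⁻¹)) *
      (Complex.Gamma (1 + ξ) * Complex.Gamma (-ξ)) := by
    have e : ((ρ * γ : ℝ) : ℂ) = γ / ξ * (ρ * ξ) := by
      push_cast
      field_simp
    rw [regKernel, e]
    ring
  rw [h3, h1, h2]
  field_simp

/-- Used with a = πξ/2 and b = πθξ/(2γ): the two terms on the left come from the two half-lines, and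
sin(2a) = sin(πξ) cancels the common denominator. -/
theorem sin_combination (a b : ℂ) :
    Complex.sin (a - b) * Complex.exp (-(a * Complex.I)) +
      Complex.sin (a + b) * Complex.exp (a * Complex.I) =
      Complex.exp (b * Complex.I) * Complex.sin (2 * a) := by
  rw [← neg_mul, Complex.exp_mul_I, Complex.exp_mul_I, Complex.exp_mul_I, Complex.sin_sub,
    Complex.sin_add, Complex.cos_neg, Complex.sin_neg, Complex.sin_two_mul]
  ring

theorem log_neg_I_mul {k : ℝ} (hk : k ≠ 0) :
    Complex.log (-(Complex.I * k)) =
      Real.log |k| - Real.sign k * (Real.pi / 2) * Complex.I := by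
  have h : -(Complex.I * k) = ((|k| : ℝ) : ℂ) * (-(Real.sign k) * Complex.I) := by
    rcases lt_or_gt_of_ne hk with h | h
    · rw [Real.sign_of_neg h, abs_of_neg h]; push_cast; ring
    · rw [Real.sign_of_pos h, abs_of_pos h]; push_cast; ring
  have hne : (-(Real.sign k) * Complex.I : ℂ) ≠ 0 := by
    rcases lt_or_gt_of_ne hk with h | h
    · simp [Real.sign_of_neg h]
    · simp [Real.sign_of_pos h]
  rw [h, Complex.log_ofReal_mul (abs_pos.2 hk) hne, sub_eq_add_neg]
  congr 1
  rcases lt_or_gt_of_ne hk with h | h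
  · rw [Real.sign_of_neg h]; simp [Complex.log_I]
  · rw [Real.sign_of_pos h]; simp [Complex.log_neg_I]

theorem sin_pi_mul_ne_zero {ξ : ℂ} (h1 : -1 < ξ.re) (h2 : ξ.re < 0) :
    Complex.sin (Real.pi * ξ) ≠ 0 := by
  rw [Complex.sin_ne_zero_iff]
  intro n hn
  have h : ξ = n := by
    have hpi : (Real.pi : ℂ) ≠ 0 := Complex.ofReal_ne_zero.2 Real.pi_ne_zero
    rw [mul_comm] at hn
    exact mul_right_cancel₀ hpi hn
  rw [h] at h1 h2
  simp only [Complex.intCast_re] at h1 h2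
  have a1 : (-1 : ℤ) < n := by exact_mod_cast h1
  have a2 : n < (0 : ℤ) := by exact_mod_cast h2
  omega

/-- Combination of the kernels of the two half-lines. -/
theorem regKernel_combination (α θ : ℝ) {γ : ℝ} (hγ : 0 < γ) {ξ : ℂ} (h1 : -1 < ξ.re)
    (h2 : ξ.re < 0) (L M : ℂ) {k : ℝ} (hk : k ≠ 0) :
    regKernel α γ ((γ - θ) / (2 * γ)) ξ * (Complex.Gamma (-ξ) * Complex.exp (ξ *
        (L + (M - Real.sign k * (Real.pi / 2) * Complex.I)))) +
      regKernel α γ ((γ + θ) / (2 * γ)) ξ * (Complex.Gamma (-ξ) * Complex.exp (ξ *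
        (L + (M + Real.sign k * (Real.pi / 2) * Complex.I)))) =
      -(γ / ξ * mlKernel α α (ξ / γ)) * Complex.exp (ξ / γ *
        (γ * (L + M) + Real.sign k * θ * Real.pi / 2 * Complex.I)) := by
  have hγc : (γ : ℂ) ≠ 0 := Complex.ofReal_ne_zero.2 hγ.ne'
  have hξ : ξ ≠ 0 := by rintro rfl; simp at h2
  have hsin := sin_pi_mul_ne_zero h1 h2
  rw [← mul_assoc, ← mul_assoc, regKernel_mul_Gamma α _ hγ hξ, regKernel_mul_Gamma α _ hγ hξ]
  set σ : ℂ := (Real.sign k : ℂ) with hσ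
  set a : ℂ := Real.pi * ξ / 2 with ha
  set b : ℂ := Real.pi * θ * ξ / (2 * γ) with hb
  have e1 : (Real.pi : ℂ) * ((((γ - θ) / (2 * γ) : ℝ) : ℂ) * ξ) = a - b := by
    rw [ha, hb]; push_cast; field_simp
  have e2 : (Real.pi : ℂ) * ((((γ + θ) / (2 * γ) : ℝ) : ℂ) * ξ) = a + b := by
    rw [ha, hb]; push_cast; field_simp
  have e3 : (Real.pi : ℂ) * ξ = 2 * a := by rw [ha]; ring
  have e4 : ξ * (L + (M - σ * (Real.pi / 2) * Complex.I)) =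
      ξ * (L + M) + -(σ * a * Complex.I) := by rw [ha]; ring
  have e5 : ξ * (L + (M + σ * (Real.pi / 2) * Complex.I)) =
      ξ * (L + M) + σ * a * Complex.I := by rw [ha]; ring
  have e6 : ξ / γ * (γ * (L + M) + σ * θ * Real.pi / 2 * Complex.I) =
      ξ * (L + M) + σ * b * Complex.I := by rw [hb]; field_simp
  -- For k < 0 this is the same identity at (-a, -b).
  have key : Complex.sin (a - b) * Complex.exp (-(σ * a * Complex.I)) +
      Complex.sin (a + b) * Complex.exp (σ * a * Complex.I) =
      Complex.exp (σ * b * Complex.I) * Complex.sin (2 * a) := by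
    rcases lt_or_gt_of_ne hk with h | h
    · have hs : σ = -1 := by rw [hσ, Real.sign_of_neg h]; simp
      have := sin_combination (-a) (-b)
      rw [show -a - -b = -(a - b) by ring, show -a + -b = -(a + b) by ring,
        show 2 * -a = -(2 * a) by ring, Complex.sin_neg, Complex.sin_neg, Complex.sin_neg] at this
      rw [hs]
      simp only [neg_mul, one_mul, neg_neg] at this ⊢
      linear_combination -this
    · have hs : σ = 1 := by rw [hσ, Real.sign_of_pos h]; simp
      simpa [hs] using sin_combination a b
  rw [e3] at hsin ⊢
  rw [e1, e2, e4, e5, e6, Complex.exp_add, Complex.exp_add, Complex.exp_add]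
  linear_combination
    (-(γ / ξ * mlKernel α α (ξ / γ)) * Complex.exp (ξ * (L + M)) / Complex.sin (2 * a)) * key -
    (γ / ξ * mlKernel α α (ξ / γ)) * Complex.exp (ξ * (L + M)) * Complex.exp (σ * b * Complex.I) *
      mul_inv_cancel₀ hsin

theorem integral_split {E : Type*} [NormedAddCommGroup E] [NormedSpace ℝ E] {f : ℝ → E}
    (hf : Integrable f) :
    ∫ x, f x = (∫ x in Ioi (0 : ℝ), f x) + ∫ x in Ioi (0 : ℝ), f (-x) := by
  have := integral_comp_neg_Ioi (0 : ℝ) f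
  rw [this, neg_zero, add_comm]
  exact (intervalIntegral.integral_Iic_add_Ioi hf.integrableOn hf.integrableOn).symm

namespace EqParams

variable {α γ θ μ : ℝ}

theorem integrable_slice (H : EqParams α γ θ μ) {t : ℝ} (ht : 0 < t) {f : ℝ → ℂ}
    (hf : ∀ x, x ≠ 0 → f x = closedForm α γ θ μ x t) :
    IntegrableOn f (Ioi 0) ∧ IntegrableOn (fun x => f (-x)) (Ioi 0) ∧ Integrable f := by
  have h1 : IntegrableOn f (Ioi 0) := by
    refine IntegrableOn.congr_fun ((H.kernelParams_pos.integrableOn_barnes_scaled H.γ_le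
      (H.scale_pos ht)).const_mul ((t ^ (α - 1) / γ : ℝ) : ℂ)) (fun x hx => ?_) measurableSet_Ioi
    have hx' : (0 : ℝ) < x := hx
    rw [hf x hx'.ne', H.closedForm_of_pos hx' ht]
  have h2 : IntegrableOn (fun x => f (-x)) (Ioi 0) := by
    refine IntegrableOn.congr_fun ((H.kernelParams_neg.integrableOn_barnes_scaled H.γ_le
      (H.scale_pos ht)).const_mul ((t ^ (α - 1) / γ : ℝ) : ℂ)) (fun x hx => ?_) measurableSet_Ioi
    have hx' : (0 : ℝ) < x := hx
    rw [hf (-x) (neg_ne_zero.2 hx'.ne'), H.closedForm_neg_of_pos hx' ht]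
  have h3 : IntegrableOn f (Iic 0) := by
    rw [← integrable_indicator_iff measurableSet_Iic]
    have h4 := ((integrableOn_Ici_iff_integrableOn_Ioi (b := (0 : ℝ))).2 h2).integrable_indicator
      measurableSet_Ici
    refine h4.comp_neg.congr (ae_of_all _ fun y => ?_)
    simp [indicator]
  refine ⟨h1, h2, ?_⟩
  rw [← integrableOn_univ, ← Iic_union_Ioi (a := (0 : ℝ))]
  exact h3.union h1

/-- The value is t^{α-1} E_{α,α}(-μ ψ(k) t^α). The half-line transforms at k and -k are added under
the integral sign, where the phases combine into `freqLog`. -/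
theorem fourierStar_closedForm (H : EqParams α γ θ μ) {t : ℝ} (ht : 0 < t) {f : ℝ → ℂ}
    (hf : ∀ x, x ≠ 0 → f x = closedForm α γ θ μ x t) {k : ℝ} (hk : k ≠ 0) :
    fourierStar f k =
      ((t ^ (α - 1) : ℝ) : ℂ) * mlBarnes α α (freqLog γ θ μ k + α * Real.log t) := by
  have hγ := H.γ_pos
  have hγc : (γ : ℂ) ≠ 0 := Complex.ofReal_ne_zero.2 hγ.ne'
  have hμ := H.μ_pos
  set l := (μ * t ^ α) ^ (1 / γ) with hl
  have hl0 : 0 < l := H.scale_pos ht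
  have hlogl : γ * Real.log l = Real.log μ + α * Real.log t := by
    rw [hl, Real.log_rpow (by positivity), Real.log_mul hμ.ne' (by positivity),
      Real.log_rpow ht]
    field_simp
  set A : ℂ := ((t ^ (α - 1) / γ : ℝ) : ℂ) with hA
  obtain ⟨i1, i2, i3⟩ := H.integrable_slice ht hf
  obtain ⟨j1, e1⟩ := H.kernelParams_pos.integral_fourier_barnes H.γ_le hl0 hk
  obtain ⟨j2, e2⟩ := H.kernelParams_neg.integral_fourier_barnes H.γ_le hl0 (neg_ne_zero.2 hk)
  have hint : Integrable fun x : ℝ => Complex.exp (Complex.I * k * x) * f x := by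
    refine i3.bdd_mul (c := 1) (by fun_prop : Continuous fun x : ℝ =>
      Complex.exp (Complex.I * k * x)).aestronglyMeasurable (ae_of_all _ fun x => ?_)
    rw [Complex.norm_exp]
    simp
  rw [fourierStar, integral_split hint]
  have e3 : ∫ x in Ioi (0 : ℝ), Complex.exp (Complex.I * k * x) * f x =
      A * ∫ x in Ioi (0 : ℝ), Complex.exp (Complex.I * k * x) *
        (((1 / x : ℝ) : ℂ) * barnes α γ ((γ - θ) / (2 * γ)) (x / l)) := by
    rw [← integral_const_mul]
    refine setIntegral_congr_fun measurableSet_Ioi fun x hx => ?_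
    have hx' : (0 : ℝ) < x := hx
    rw [hf x hx'.ne', H.closedForm_of_pos hx' ht]
    ring
  have e4 : ∫ x in Ioi (0 : ℝ), Complex.exp (Complex.I * k * (-x : ℝ)) * f (-x) =
      A * ∫ x in Ioi (0 : ℝ), Complex.exp (Complex.I * (-k : ℝ) * x) *
        (((1 / x : ℝ) : ℂ) * barnes α γ ((γ + θ) / (2 * γ)) (x / l)) := by
    rw [← integral_const_mul]
    refine setIntegral_congr_fun measurableSet_Ioi fun x hx => ?_
    have hx' : (0 : ℝ) < x := hx
    have hexp : Complex.exp (Complex.I * k * (-x : ℝ)) = Complex.exp (Complex.I * (-k : ℝ) * x) := by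
      congr 1
      push_cast
      ring
    rw [hf (-x) (neg_ne_zero.2 hx'.ne'), H.closedForm_neg_of_pos hx' ht, hexp]
    ring
  rw [e3, e4, e1, e2, ← mul_add, ← mul_add, ← integral_add j1 j2, mlBarnes]
  -- The substitution s = ξ/γ carries the line Re ξ = -γ/4 to Re s = -1/4; its Jacobian 1/γ is the
  -- one in the prefactor `A`.
  have e5 : ∫ v : ℝ, mlIntegrand α α (freqLog γ θ μ k + α * Real.log t)
      (((-1 / 4 : ℝ) : ℂ) + v * Complex.I) =
      ((γ⁻¹ : ℝ) : ℂ) * ∫ y : ℝ, mlIntegrand α α (freqLog γ θ μ k + α * Real.log t)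
      (((-1 / 4 : ℝ) : ℂ) + (γ⁻¹ * y : ℝ) * Complex.I) := by
    rw [Measure.integral_comp_mul_left (fun v : ℝ => mlIntegrand α α (freqLog γ θ μ k +
      α * Real.log t) (((-1 / 4 : ℝ) : ℂ) + v * Complex.I)) γ⁻¹, inv_inv, abs_of_pos hγ,
      Complex.real_smul, ← mul_assoc, Complex.ofReal_inv, inv_mul_cancel₀ hγc, one_mul]
  rw [e5, show A = ((t ^ (α - 1) : ℝ) : ℂ) * ((γ⁻¹ : ℝ) : ℂ) by
    rw [hA, ← Complex.ofReal_mul, div_eq_mul_inv]]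
  have e6 : ∀ y : ℝ, regKernel α γ ((γ - θ) / (2 * γ)) (((-γ / 4 : ℝ) : ℂ) + y * Complex.I) *
        (Complex.Gamma (-(((-γ / 4 : ℝ) : ℂ) + y * Complex.I)) *
        Complex.exp ((((-γ / 4 : ℝ) : ℂ) + y * Complex.I) *
          (Real.log l + Complex.log (-(Complex.I * k))))) +
      regKernel α γ ((γ + θ) / (2 * γ)) (((-γ / 4 : ℝ) : ℂ) + y * Complex.I) *
        (Complex.Gamma (-(((-γ / 4 : ℝ) : ℂ) + y * Complex.I)) *
        Complex.exp ((((-γ / 4 : ℝ) : ℂ) + y * Complex.I) *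
          (Real.log l + Complex.log (-(Complex.I * (-k : ℝ)))))) =
      mlIntegrand α α (freqLog γ θ μ k + α * Real.log t)
        (((-1 / 4 : ℝ) : ℂ) + (γ⁻¹ * y : ℝ) * Complex.I) := by
    intro y
    set ξ : ℂ := ((-γ / 4 : ℝ) : ℂ) + y * Complex.I with hξ
    have hre : ξ.re = -γ / 4 := by simp [hξ]
    have hξ0 : ξ ≠ 0 := ofReal_add_mul_I_ne_zero (by linarith) y
    obtain ⟨q1, q2, q3, -⟩ := H.kernelParams_pos.quarter H.γ_le
    have hs : ((-1 / 4 : ℝ) : ℂ) + (γ⁻¹ * y : ℝ) * Complex.I = ξ / γ := by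
      rw [hξ]; push_cast; field_simp
    have hc := regKernel_combination α θ hγ (ξ := ξ) (by rw [hre]; exact q1)
      (by rw [hre]; exact q3) (Real.log l) (Real.log |k|) hk
    have hsign : Real.sign (-k) = -Real.sign k := Real.sign_neg
    rw [log_neg_I_mul hk, log_neg_I_mul (neg_ne_zero.2 hk), abs_neg, hsign, hs, mlIntegrand]
    have h7 : (((-Real.sign k : ℝ) : ℂ)) * (Real.pi / 2) * Complex.I =
        -(Real.sign k * (Real.pi / 2) * Complex.I) := by push_cast; ring
    rw [h7, sub_neg_eq_add, hc]
    have h8 : (γ : ℂ) * (Real.log l + Real.log |k|) + Real.sign k * θ * Real.pi / 2 * Complex.I =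
        freqLog γ θ μ k + α * Real.log t := by
      have h9 : (γ : ℂ) * Real.log l = Real.log μ + α * Real.log t := by exact_mod_cast hlogl
      rw [freqLog]
      linear_combination h9
    rw [h8]
    congr 2
    field_simp
  simp only [e6]
  ring

end EqParams

/-! ### Fourier transforms -/

theorem norm_cexp_I_mul (k x : ℝ) : ‖Complex.exp (Complex.I * k * x)‖ = 1 := by
  rw [Complex.norm_exp]
  simp

theorem integrable_cexp_I_mul {f : ℝ → ℂ} (hf : Integrable f) (k : ℝ) :
    Integrable fun x : ℝ => Complex.exp (Complex.I * k * x) * f x :=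
  hf.bdd_mul (c := 1) (by fun_prop : Continuous fun x : ℝ =>
    Complex.exp (Complex.I * k * x)).aestronglyMeasurable
    (ae_of_all _ fun x => (norm_cexp_I_mul k x).le)

theorem norm_fourierStar_le (f : ℝ → ℂ) (k : ℝ) : ‖fourierStar f k‖ ≤ ∫ x, ‖f x‖ := by
  refine (norm_integral_le_integral_norm _).trans_eq ?_
  refine integral_congr_ae (ae_of_all _ fun x => ?_)
  simp only
  rw [norm_mul, norm_cexp_I_mul, one_mul]

theorem continuous_fourierStar {f : ℝ → ℂ} (hf : Integrable f) : Continuous (fourierStar f) := by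
  refine continuous_of_dominated (fun k => (integrable_cexp_I_mul hf k).aestronglyMeasurable)
    (fun k => ae_of_all _ fun x => ?_) hf.norm (ae_of_all _ fun x => by fun_prop)
  rw [norm_mul, norm_cexp_I_mul, one_mul]

theorem fourierStar_eq_fourier (φ : 𝓢(ℝ, ℂ)) (v : ℝ) :
    fourierStar φ (-(2 * Real.pi * v)) = FourierTransform.fourier φ v := by
  rw [SchwartzMap.fourier_coe, Real.fourier_real_eq_integral_exp_smul, fourierStar]
  refine integral_congr_ae (ae_of_all _ fun x => ?_)
  simp only [smul_eq_mul]
  congr 2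
  push_cast
  ring

/-- The function `k ↦ φ^*(-k)`. -/
def dualTransform (φ : 𝓢(ℝ, ℂ)) (k : ℝ) : ℂ := fourierStar φ (-k)

theorem dualTransform_eq (φ : 𝓢(ℝ, ℂ)) (k : ℝ) :
    dualTransform φ k = FourierTransform.fourier φ ((2 * Real.pi)⁻¹ * k) := by
  rw [← fourierStar_eq_fourier, dualTransform, mul_inv_cancel_left₀ (by positivity)]

theorem continuous_dualTransform (φ : 𝓢(ℝ, ℂ)) : Continuous (dualTransform φ) :=
  (continuous_fourierStar φ.integrable).comp continuous_neg

theorem integrable_pow_mul_dualTransform (φ : 𝓢(ℝ, ℂ)) (n : ℕ) :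
    Integrable fun k : ℝ => |k| ^ n * ‖dualTransform φ k‖ := by
  have h := SchwartzMap.integrable_pow_mul (μ := volume) (FourierTransform.fourier φ) n
  have h2 := (h.comp_mul_left' (R := (2 * Real.pi)⁻¹) (by positivity)).const_mul
    ((2 * Real.pi) ^ n)
  refine h2.congr (ae_of_all _ fun k => ?_)
  simp only [dualTransform_eq, Real.norm_eq_abs]
  rw [abs_mul, abs_of_pos (by positivity : (0 : ℝ) < (2 * Real.pi)⁻¹), ← mul_assoc,
    ← mul_pow, mul_inv_cancel_left₀ (by positivity)]

theorem integrable_dualTransform (φ : 𝓢(ℝ, ℂ)) : Integrable (dualTransform φ) := by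
  have := integrable_pow_mul_dualTransform φ 0
  simp only [pow_zero, one_mul] at this
  exact (integrable_norm_iff (continuous_dualTransform φ).aestronglyMeasurable).1 this

theorem schwartz_inversion (φ : 𝓢(ℝ, ℂ)) (x : ℝ) :
    φ x = 1 / (2 * (Real.pi : ℂ)) *
      ∫ k : ℝ, Complex.exp (Complex.I * k * x) * dualTransform φ k := by
  have h1 : φ x = FourierTransformInv.fourierInv (FourierTransform.fourier φ) x := by
    rw [FourierTransform.fourierInv_fourier_eq]
  have h2 : ∀ v : ℝ, Complex.exp (Complex.I * (2 * Real.pi * v : ℝ) * x) *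
      dualTransform φ (2 * Real.pi * v) =
      Complex.exp (((2 * Real.pi * (v * x) : ℝ) : ℂ) * Complex.I) •
        FourierTransform.fourier φ v := by
    intro v
    rw [dualTransform, fourierStar_eq_fourier, smul_eq_mul]
    congr 2
    push_cast
    ring
  rw [h1, SchwartzMap.fourierInv_coe, Real.fourierInv_eq']
  simp only [RCLike.inner_apply, conj_trivial]
  have h3 : ∀ v : ℝ, x * v = v * x := fun v => mul_comm _ _
  simp only [h3, ← h2]
  rw [Measure.integral_comp_mul_left (fun k : ℝ => Complex.exp (Complex.I * k * x) *
    dualTransform φ k) (2 * Real.pi), abs_of_pos (by positivity), Complex.real_smul]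
  push_cast
  ring

theorem parseval {f : ℝ → ℂ} (hf : Integrable f) (φ : 𝓢(ℝ, ℂ)) :
    ∫ x, f x * φ x = 1 / (2 * (Real.pi : ℂ)) * ∫ k, dualTransform φ k * fourierStar f k := by
  have hint : Integrable (Function.uncurry fun x k : ℝ =>
      f x * (Complex.exp (Complex.I * k * x) * dualTransform φ k)) (volume.prod volume) := by
    have h := (hf.mul_prod (integrable_dualTransform φ)).bdd_mul (c := 1)
      (f := fun p : ℝ × ℝ => Complex.exp (Complex.I * p.2 * p.1))
      (by fun_prop : Continuous fun p : ℝ × ℝ =>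
        Complex.exp (Complex.I * p.2 * p.1)).aestronglyMeasurable
      (ae_of_all _ fun p => (norm_cexp_I_mul p.2 p.1).le)
    refine h.congr (ae_of_all _ fun p => ?_)
    simp only [Function.uncurry]
    ring
  have h1 : ∀ x, f x * φ x = 1 / (2 * (Real.pi : ℂ)) *
      ∫ k : ℝ, f x * (Complex.exp (Complex.I * k * x) * dualTransform φ k) := by
    intro x
    rw [schwartz_inversion φ x, integral_const_mul]
    ring
  simp only [h1]
  rw [integral_const_mul, integral_integral_swap hint]
  congr 1
  refine integral_congr_ae (ae_of_all _ fun k => ?_)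
  simp only
  rw [fourierStar, ← integral_const_mul]
  refine integral_congr_ae (ae_of_all _ fun x => ?_)
  simp only
  ring

/-- Every smooth compactly supported function of the frequency arises as a `dualTransform`, so an
identity tested against all Schwartz functions of x can be localized in k. -/
theorem exists_dualTransform_eq {g : ℝ → ℂ} (h1 : HasCompactSupport g)
    (h2 : ContDiff ℝ (↑(⊤ : ℕ∞)) g) : ∃ φ : 𝓢(ℝ, ℂ), dualTransform φ = g := by
  have hpi : (2 * Real.pi) ≠ 0 := by positivity
  have c1 : HasCompactSupport fun v : ℝ => g (2 * Real.pi * v) :=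
    h1.comp_homeomorph (Homeomorph.mulLeft₀ (2 * Real.pi) hpi)
  have c2 : ContDiff ℝ (↑(⊤ : ℕ∞)) fun v : ℝ => g (2 * Real.pi * v) :=
    h2.comp (contDiff_const.mul contDiff_id)
  refine ⟨FourierTransformInv.fourierInv (c1.toSchwartzMap c2), funext fun k => ?_⟩
  rw [dualTransform_eq, FourierTransform.fourier_fourierInv_eq]
  change g _ = _
  rw [mul_inv_cancel_left₀ hpi]

theorem ae_eq_zero_of_dualTransform {F : ℝ → ℂ} (hF : LocallyIntegrable F)
    (h : ∀ φ : 𝓢(ℝ, ℂ), ∫ k, dualTransform φ k * F k = 0) : ∀ᵐ k, F k = 0 := by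
  refine ae_eq_zero_of_integral_contDiff_smul_eq_zero hF fun g g1 g2 => ?_
  have c1 : HasCompactSupport (Complex.ofRealCLM ∘ g) := g2.comp_left rfl
  have c2 : ContDiff ℝ (↑(⊤ : ℕ∞)) (Complex.ofRealCLM ∘ g) := by fun_prop
  obtain ⟨φ, hφ⟩ := exists_dualTransform_eq c1 c2
  have := h φ
  rw [hφ] at this
  simpa using this

theorem ae_eq_zero_of_integral_schwartz {f : ℝ → ℂ} (hf : LocallyIntegrable f)
    (h : ∀ φ : 𝓢(ℝ, ℂ), ∫ x, f x * φ x = 0) : ∀ᵐ x, f x = 0 := by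
  refine ae_eq_zero_of_integral_contDiff_smul_eq_zero hf fun g g1 g2 => ?_
  have c1 : HasCompactSupport (Complex.ofRealCLM ∘ g) := g2.comp_left rfl
  have c2 : ContDiff ℝ (↑(⊤ : ℕ∞)) (Complex.ofRealCLM ∘ g) := by fun_prop
  have := h (c1.toSchwartzMap c2)
  simpa [mul_comm] using this

theorem ae_eq_of_fourierStar_ae_eq {f g : ℝ → ℂ} (hf : Integrable f) (hg : Integrable g)
    (h : ∀ᵐ k, fourierStar f k = fourierStar g k) : f =ᵐ[volume] g := by
  have h1 : ∀ᵐ x, (f - g) x = 0 := by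
    refine ae_eq_zero_of_integral_schwartz (hf.sub hg).locallyIntegrable fun φ => ?_
    rw [parseval (hf.sub hg) φ]
    refine mul_eq_zero_of_right _ (integral_eq_zero_of_ae ?_)
    filter_upwards [h] with k hk
    have : fourierStar (f - g) k = fourierStar f k - fourierStar g k := by
      rw [fourierStar, fourierStar, fourierStar, ← integral_sub (integrable_cexp_I_mul hf k)
        (integrable_cexp_I_mul hg k)]
      simp only [Pi.sub_apply, mul_sub]
    rw [this, hk, sub_self, mul_zero]
    rfl
  filter_upwards [h1] with x hx
  exact sub_eq_zero.1 hx

/-! ### The symbol -/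

theorem rieszFellerSymbol_eq {γ : ℝ} (hγ : 0 < γ) (θ k : ℝ) :
    rieszFellerSymbol γ θ k = if 0 ≤ k then
      ((|k| ^ γ : ℝ) : ℂ) * Complex.exp (Complex.I * (θ * Real.pi / 2 : ℝ)) else
      ((|k| ^ γ : ℝ) : ℂ) * Complex.exp (Complex.I * (-(θ * Real.pi / 2) : ℝ)) := by
  rcases lt_trichotomy k 0 with h | h | h
  · rw [if_neg (not_le.2 h), rieszFellerSymbol, Real.sign_of_neg h]
    congr 4
    ring
  · rw [if_pos h.ge, rieszFellerSymbol, h, abs_zero, Real.zero_rpow hγ.ne']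
    simp
  · rw [if_pos h.le, rieszFellerSymbol, Real.sign_of_pos h, one_mul]

theorem continuous_rieszFellerSymbol {γ : ℝ} (hγ : 0 < γ) (θ : ℝ) :
    Continuous (rieszFellerSymbol γ θ) := by
  rw [show rieszFellerSymbol γ θ = _ from funext (rieszFellerSymbol_eq hγ θ)]
  have h : Continuous fun k : ℝ => ((|k| ^ γ : ℝ) : ℂ) :=
    Complex.continuous_ofReal.comp (continuous_abs.rpow_const fun _ => Or.inr hγ.le)
  refine Continuous.if_le (h.mul continuous_const) (h.mul continuous_const) continuous_const
    continuous_id fun k hk => ?_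
  have hk' : 0 = k := hk
  rw [← hk', abs_zero, Real.zero_rpow hγ.ne']
  simp

theorem norm_rieszFellerSymbol (γ θ k : ℝ) : ‖rieszFellerSymbol γ θ k‖ = |k| ^ γ := by
  rw [rieszFellerSymbol, norm_mul, Complex.norm_real, mul_comm Complex.I,
    Complex.norm_exp_ofReal_mul_I, mul_one, Real.norm_of_nonneg (by positivity)]

theorem rieszFellerSymbol_ne_zero (γ θ : ℝ) {k : ℝ} (hk : k ≠ 0) :
    rieszFellerSymbol γ θ k ≠ 0 := by
  rw [← norm_ne_zero_iff, norm_rieszFellerSymbol]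
  have := abs_pos.2 hk
  positivity

/-- The multiplier `μ ψ_γ^θ(k) φ^*(-k)`. -/
def multiplier (γ θ μ : ℝ) (φ : 𝓢(ℝ, ℂ)) (k : ℝ) : ℂ :=
  μ * rieszFellerSymbol γ θ k * dualTransform φ k

theorem integrable_multiplier {γ : ℝ} (hγ : 0 < γ) (hγ2 : γ ≤ 2) (θ μ : ℝ) (φ : 𝓢(ℝ, ℂ)) :
    Integrable (multiplier γ θ μ φ) := by
  have h := ((integrable_pow_mul_dualTransform φ 0).add
    (integrable_pow_mul_dualTransform φ 2)).const_mul |μ|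
  refine h.mono' ((continuous_const.mul (continuous_rieszFellerSymbol hγ θ)).mul
    (continuous_dualTransform φ)).aestronglyMeasurable (ae_of_all _ fun k => ?_)
  have hle : |k| ^ γ ≤ |k| ^ 0 + |k| ^ 2 := by
    have h0 := abs_nonneg k
    rcases le_total |k| 1 with h1 | h1
    · have := Real.rpow_le_one h0 h1 hγ.le
      nlinarith [pow_two_nonneg |k|]
    · have := Real.rpow_le_rpow_of_exponent_le h1 hγ2
      rw [Real.rpow_two] at this
      simp only [pow_zero]
      linarith
  rw [multiplier, norm_mul, norm_mul, Complex.norm_real, norm_rieszFellerSymbol, Real.norm_eq_abs]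
  calc _ ≤ |μ| * (|k| ^ 0 + |k| ^ 2) * ‖dualTransform φ k‖ := by gcongr
    _ = _ := by simp only [Pi.add_apply]; ring

theorem mul_rieszFeller_eq (γ θ μ : ℝ) (f : ℝ → ℂ) (φ : 𝓢(ℝ, ℂ)) :
    μ * rieszFeller γ θ f φ =
      -(1 / (2 * (Real.pi : ℂ)) * ∫ k, multiplier γ θ μ φ k * fourierStar f k) := by
  rw [rieszFeller, mul_left_comm, ← mul_neg, ← integral_const_mul, ← integral_neg]
  congr 1
  refine integral_congr_ae (ae_of_all _ fun k => ?_)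
  simp only [multiplier, dualTransform]
  ring

/-! ### Functions that are integrable on slabs -/

/-- Integrability on `ℝ × (0, T]` for all `T` and at each time. -/
structure SlabIntegrable (N : ℝ → ℝ → ℂ) : Prop where
  slab : ∀ T : ℝ, 0 < T → IntegrableOn (fun p : ℝ × ℝ => N p.1 p.2) (univ ×ˢ Ioc 0 T)
  slice : ∀ t : ℝ, 0 < t → Integrable fun x => N x t

/-- The `L¹` norm of a time slice. -/
def sliceNorm (N : ℝ → ℝ → ℂ) (t : ℝ) : ℝ := ∫ x, ‖N x t‖

/-- The Fourier transform of a time slice. -/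
def sliceStar (N : ℝ → ℝ → ℂ) (k t : ℝ) : ℂ := fourierStar (fun x => N x t) k

theorem norm_sliceStar_le (N : ℝ → ℝ → ℂ) (k t : ℝ) : ‖sliceStar N k t‖ ≤ sliceNorm N t :=
  norm_fourierStar_le _ _

theorem sliceNorm_nonneg (N : ℝ → ℝ → ℂ) (t : ℝ) : 0 ≤ sliceNorm N t :=
  integral_nonneg fun _ => norm_nonneg _

namespace SlabIntegrable

variable {N : ℝ → ℝ → ℂ}

theorem integrable_prod (H : SlabIntegrable N) {T : ℝ} (hT : 0 < T) :
    Integrable (fun p : ℝ × ℝ => N p.1 p.2) (volume.prod (volume.restrict (Ioc 0 T))) := by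
  have h := H.slab T hT
  rwa [IntegrableOn, Measure.volume_eq_prod, ← Measure.prod_restrict, Measure.restrict_univ] at h

theorem integrableOn_sliceNorm (H : SlabIntegrable N) {T : ℝ} (hT : 0 < T) :
    IntegrableOn (sliceNorm N) (Ioc 0 T) :=
  (H.integrable_prod hT).norm.integral_prod_right

theorem aestronglyMeasurable_sliceStar_prod (H : SlabIntegrable N) {T : ℝ} (hT : 0 < T) :
    AEStronglyMeasurable (fun p : ℝ × ℝ => sliceStar N p.1 p.2)
      (volume.prod (volume.restrict (Ioc 0 T))) := by
  have h1 := (H.integrable_prod hT).aestronglyMeasurable.prod_swap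
  have h2 : AEStronglyMeasurable (fun p : ℝ × (ℝ × ℝ) => N p.2.2 p.2.1)
      (volume.prod ((volume.restrict (Ioc 0 T)).prod volume)) := h1.comp_snd
  have h3 : AEStronglyMeasurable (fun p : (ℝ × ℝ) × ℝ => N p.2 p.1.2)
      ((volume.prod (volume.restrict (Ioc 0 T))).prod volume) :=
    h2.comp_measurePreserving (measurePreserving_prodAssoc _ _ _)
  have h4 : AEStronglyMeasurable (fun p : (ℝ × ℝ) × ℝ =>
      Complex.exp (Complex.I * p.1.1 * p.2) * N p.2 p.1.2)
      ((volume.prod (volume.restrict (Ioc 0 T))).prod volume) :=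
    (by fun_prop : Continuous fun p : (ℝ × ℝ) × ℝ =>
      Complex.exp (Complex.I * p.1.1 * p.2)).aestronglyMeasurable.mul h3
  exact h4.integral_prod_right'

theorem integrableOn_sliceStar (H : SlabIntegrable N) {T : ℝ} (hT : 0 < T) (k : ℝ) :
    IntegrableOn (sliceStar N k) (Ioc 0 T) := by
  have h := (H.integrable_prod hT).bdd_mul (c := 1)
      (f := fun p : ℝ × ℝ => Complex.exp (Complex.I * k * p.1))
      (by fun_prop : Continuous fun p : ℝ × ℝ =>
        Complex.exp (Complex.I * k * p.1)).aestronglyMeasurable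
      (ae_of_all _ fun p => (norm_cexp_I_mul k p.1).le)
  exact h.integral_prod_right

/-- `sliceNorm` bounds the transforms uniformly in k, so the weight `G` in frequency and the kernel
`κ` in time separate. This licenses every later interchange of the time and frequency integrals of
`sliceStar`. -/
theorem integrable_kernel_prod (H : SlabIntegrable N) {T : ℝ} (hT : 0 < T) {G κ : ℝ → ℂ}
    (hG : Integrable G) (hκm : AEStronglyMeasurable κ (volume.restrict (Ioc 0 T)))
    (hκ : IntegrableOn (fun τ => ‖κ τ‖ * sliceNorm N τ) (Ioc 0 T)) :
    Integrable (fun p : ℝ × ℝ => G p.1 * (κ p.2 * sliceStar N p.1 p.2))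
      (volume.prod (volume.restrict (Ioc 0 T))) := by
  refine (hG.norm.mul_prod hκ).mono' ?_ (ae_of_all _ fun p => ?_)
  · exact hG.aestronglyMeasurable.comp_fst.mul
      (hκm.comp_snd.mul (H.aestronglyMeasurable_sliceStar_prod hT))
  · rw [norm_mul, norm_mul]
    gcongr
    exact norm_sliceStar_le _ _ _

theorem integrableOn_kernel_mul (H : SlabIntegrable N) {T : ℝ} (hT : 0 < T) {G κ : ℝ → ℂ}
    (hG : Integrable G) (hκm : AEStronglyMeasurable κ (volume.restrict (Ioc 0 T)))
    (hκ : IntegrableOn (fun τ => ‖κ τ‖ * sliceNorm N τ) (Ioc 0 T)) :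
    IntegrableOn (fun τ => κ τ * ∫ k, G k * sliceStar N k τ) (Ioc 0 T) := by
  refine (H.integrable_kernel_prod hT hG hκm hκ).integral_prod_right.congr
    (ae_of_all _ fun τ => ?_)
  simp only
  rw [← integral_const_mul]
  refine integral_congr_ae (ae_of_all _ fun k => ?_)
  simp only
  ring

theorem integral_kernel_mul (H : SlabIntegrable N) {T : ℝ} (hT : 0 < T) {G κ : ℝ → ℂ}
    (hG : Integrable G) (hκm : AEStronglyMeasurable κ (volume.restrict (Ioc 0 T)))
    (hκ : IntegrableOn (fun τ => ‖κ τ‖ * sliceNorm N τ) (Ioc 0 T)) :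
    ∫ τ in Ioc 0 T, κ τ * ∫ k, G k * sliceStar N k τ =
      ∫ k, G k * ∫ τ in Ioc 0 T, κ τ * sliceStar N k τ := by
  have h := integral_integral_swap (f := fun k τ => G k * (κ τ * sliceStar N k τ))
    (H.integrable_kernel_prod hT hG hκm hκ)
  simp only [← integral_const_mul]
  rw [h]
  refine integral_congr_ae (ae_of_all _ fun τ => ?_)
  refine integral_congr_ae (ae_of_all _ fun k => ?_)
  simp only
  ring

theorem integrableOn_integral_mul (H : SlabIntegrable N) {T : ℝ} (hT : 0 < T) {G : ℝ → ℂ}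
    (hG : Integrable G) :
    IntegrableOn (fun τ => ∫ k, G k * sliceStar N k τ) (Ioc 0 T) := by
  simpa using H.integrableOn_kernel_mul hT hG (κ := fun _ => 1) aestronglyMeasurable_const
    (by simpa using H.integrableOn_sliceNorm hT)

theorem integral_integral_mul (H : SlabIntegrable N) {T : ℝ} (hT : 0 < T) {G : ℝ → ℂ}
    (hG : Integrable G) :
    ∫ τ in Ioc 0 T, ∫ k, G k * sliceStar N k τ = ∫ k, G k * ∫ τ in Ioc 0 T, sliceStar N k τ := by
  simpa using H.integral_kernel_mul hT hG (κ := fun _ => 1) aestronglyMeasurable_const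
    (by simpa using H.integrableOn_sliceNorm hT)

theorem pairing_eq (H : SlabIntegrable N) (φ : 𝓢(ℝ, ℂ)) {t : ℝ} (ht : 0 < t) :
    pairing N φ t = 1 / (2 * (Real.pi : ℂ)) * ∫ k, dualTransform φ k * sliceStar N k t :=
  parseval (H.slice t ht) φ

theorem integrableOn_pairing (H : SlabIntegrable N) (φ : 𝓢(ℝ, ℂ)) {T : ℝ} (hT : 0 < T) :
    IntegrableOn (pairing N φ) (Ioc 0 T) := by
  refine IntegrableOn.congr_fun ((H.integrableOn_integral_mul hT
    (integrable_dualTransform φ)).const_mul (1 / (2 * (Real.pi : ℂ))))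
    (fun τ hτ => (H.pairing_eq φ hτ.1).symm) measurableSet_Ioc

end SlabIntegrable

/-! ### Time primitives of the Fourier transforms -/

/-- The time integral of the Fourier transform of the slices. -/
def starPrimitive (N : ℝ → ℝ → ℂ) (k t : ℝ) : ℂ := ∫ τ in Ioc 0 t, sliceStar N k τ

namespace SlabIntegrable

variable {N : ℝ → ℝ → ℂ}

/-- Written with an indicator, the integrand is dominated by `sliceNorm` and continuous in the
parameters except for the single time τ equal to the endpoint. No continuity in time of the slices
is needed. -/
theorem continuous_starPrimitive (H : SlabIntegrable N) :
    Continuous fun p : ℝ × ℝ => starPrimitive N p.1 p.2 := by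
  have heq : ∀ p : ℝ × ℝ, starPrimitive N p.1 p.2 =
      ∫ τ, (Ioc 0 p.2).indicator (sliceStar N p.1) τ := fun p =>
    (integral_indicator measurableSet_Ioc).symm
  simp only [heq]
  refine continuous_iff_continuousAt.2 fun p₀ => ?_
  set T := max p₀.2 0 + 1 with hT
  have hT0 : 0 < T := by positivity
  have hmeas : ∀ p : ℝ × ℝ, AEStronglyMeasurable ((Ioc 0 p.2).indicator (sliceStar N p.1)) := by
    intro p
    rcases le_or_gt p.2 0 with h | h
    · simp only [Ioc_eq_empty (not_lt.2 h), indicator_empty]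
      exact aestronglyMeasurable_const
    · exact (aestronglyMeasurable_indicator_iff measurableSet_Ioc).2
        (H.integrableOn_sliceStar h p.1).aestronglyMeasurable
  refine continuousAt_of_dominated (bound := (Ioc 0 T).indicator (sliceNorm N))
    (Eventually.of_forall hmeas) ?_
    ((integrable_indicator_iff measurableSet_Ioc).2 (H.integrableOn_sliceNorm hT0)) ?_
  · have : ∀ᶠ p : ℝ × ℝ in 𝓝 p₀, p.2 < T := by
      refine continuous_snd.continuousAt.eventually (gt_mem_nhds ?_)
      have := le_max_left p₀.2 0
      linarith
    filter_upwards [this] with p hp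
    refine ae_of_all _ fun τ => ?_
    by_cases h : τ ∈ Ioc 0 p.2
    · rw [indicator_of_mem h, indicator_of_mem (Ioc_subset_Ioc_right hp.le h)]
      exact norm_sliceStar_le _ _ _
    · rw [indicator_of_notMem h, norm_zero]
      exact indicator_nonneg (fun _ _ => sliceNorm_nonneg _ _) _
  · have hne : ∀ᵐ τ : ℝ, τ ≠ p₀.2 := by simp [ae_iff, measure_singleton]
    filter_upwards [hne] with τ hτ
    rcases le_or_gt τ 0 with h0 | h0
    · have : ∀ p : ℝ × ℝ, (Ioc 0 p.2).indicator (sliceStar N p.1) τ = 0 := fun p =>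
        indicator_of_notMem (fun h => absurd h.1 (not_lt.2 h0)) _
      simp only [this]
      exact continuousAt_const
    · rcases lt_or_gt_of_ne hτ with h | h
      · have hev : ∀ᶠ p : ℝ × ℝ in 𝓝 p₀, (Ioc 0 p.2).indicator (sliceStar N p.1) τ =
            sliceStar N p.1 τ := by
          filter_upwards [continuous_snd.continuousAt.eventually (lt_mem_nhds h)] with p hp
          exact indicator_of_mem (show τ ∈ Ioc 0 p.2 from ⟨h0, le_of_lt hp⟩) _
        refine ContinuousAt.congr ?_ (EventuallyEq.symm hev)
        exact ((continuous_fourierStar (H.slice τ h0)).comp continuous_fst).continuousAt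
      · have hev : ∀ᶠ p : ℝ × ℝ in 𝓝 p₀, (Ioc 0 p.2).indicator (sliceStar N p.1) τ = 0 := by
          filter_upwards [continuous_snd.continuousAt.eventually (gt_mem_nhds h)] with p hp
          exact indicator_of_notMem (fun h' => absurd h'.2 (not_le.2 hp)) _
        exact ContinuousAt.congr continuousAt_const (EventuallyEq.symm hev)

theorem norm_starPrimitive_le (H : SlabIntegrable N) {s T : ℝ} (hT : 0 < T) (hs : s ≤ T)
    (k : ℝ) : ‖starPrimitive N k s‖ ≤ ∫ τ in Ioc 0 T, sliceNorm N τ := by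
  have hi := H.integrableOn_sliceNorm hT
  calc ‖starPrimitive N k s‖ ≤ ∫ τ in Ioc 0 s, sliceNorm N τ :=
        norm_integral_le_of_norm_le (hi.mono_set (Ioc_subset_Ioc_right hs))
          (ae_of_all _ fun τ => norm_sliceStar_le _ _ _)
    _ ≤ _ := setIntegral_mono_set hi (ae_of_all _ fun τ => sliceNorm_nonneg _ _)
        (Ioc_subset_Ioc_right hs).eventuallyLE

theorem starPrimitive_zero (N : ℝ → ℝ → ℂ) (k : ℝ) : starPrimitive N k 0 = 0 := by
  simp [starPrimitive]

end SlabIntegrable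

/-! ### The closed form is a fundamental solution -/

namespace EqParams

variable {α γ θ μ : ℝ}

theorem continuousAt_profile (H : EqParams α γ θ μ) {ρ : ℝ} (hρ : KernelParams α γ ρ)
    {p : ℝ × ℝ} (h1 : 0 < p.1) (h2 : 0 < p.2) :
    ContinuousAt (fun p : ℝ × ℝ => ((p.2 ^ (α - 1) / γ : ℝ) : ℂ) *
      (((1 / p.1 : ℝ) : ℂ) * barnes α γ ρ (p.1 / (μ * p.2 ^ α) ^ (1 / γ)))) p := by
  have hμ := H.μ_pos
  have hpow : ∀ e : ℝ, ContinuousAt (fun p : ℝ × ℝ => p.2 ^ e) p := fun e =>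
    continuous_snd.continuousAt.rpow_const (Or.inl h2.ne')
  have hscale : ContinuousAt (fun p : ℝ × ℝ => (μ * p.2 ^ α) ^ (1 / γ)) p :=
    (continuousAt_const.mul (hpow α)).rpow_const (Or.inl ((mul_pos hμ (Real.rpow_pos_of_pos h2 α)).ne'))
  have harg : ContinuousAt (fun p : ℝ × ℝ => p.1 / (μ * p.2 ^ α) ^ (1 / γ)) p :=
    continuous_fst.continuousAt.div hscale (H.scale_pos h2).ne'
  have hb : ContinuousAt (barnes α γ ρ) (p.1 / (μ * p.2 ^ α) ^ (1 / γ)) :=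
    (hρ.continuousOn_barnes H.γ_le).continuousAt (Ioi_mem_nhds (div_pos h1 (H.scale_pos h2)))
  refine ContinuousAt.mul ?_ (ContinuousAt.mul ?_ ?_)
  · exact Complex.continuous_ofReal.continuousAt.comp ((hpow _).div_const γ)
  · exact Complex.continuous_ofReal.continuousAt.comp
      (continuousAt_const.div continuous_fst.continuousAt h1.ne')
  · exact ContinuousAt.comp (f := fun p : ℝ × ℝ => p.1 / (μ * p.2 ^ α) ^ (1 / γ)) hb harg

theorem continuousAt_closedForm (H : EqParams α γ θ μ) {p : ℝ × ℝ} (h1 : p.1 ≠ 0)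
    (h2 : 0 < p.2) :
    ContinuousAt (fun p : ℝ × ℝ => closedForm α γ θ μ p.1 p.2) p := by
  have ht : ∀ᶠ q : ℝ × ℝ in 𝓝 p, 0 < q.2 := continuous_snd.continuousAt.eventually (lt_mem_nhds h2)
  rcases lt_or_gt_of_ne h1 with h | h
  · have hx : ∀ᶠ q : ℝ × ℝ in 𝓝 p, q.1 < 0 :=
      continuous_fst.continuousAt.eventually (gt_mem_nhds h)
    have hc : ContinuousAt (fun q : ℝ × ℝ => ((-q.1, q.2) : ℝ × ℝ)) p := by fun_prop
    have := ContinuousAt.comp (f := fun q : ℝ × ℝ => ((-q.1, q.2) : ℝ × ℝ))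
      (H.continuousAt_profile H.kernelParams_neg (p := (-p.1, p.2)) (by simpa using h) h2) hc
    refine this.congr ?_
    filter_upwards [ht, hx] with q hq1 hq2
    have := H.closedForm_neg_of_pos (neg_pos.2 hq2) hq1
    rw [neg_neg] at this
    exact this.symm
  · have hx : ∀ᶠ q : ℝ × ℝ in 𝓝 p, 0 < q.1 :=
      continuous_fst.continuousAt.eventually (lt_mem_nhds h)
    refine (H.continuousAt_profile H.kernelParams_pos h h2).congr ?_
    filter_upwards [ht, hx] with q hq1 hq2
    exact (H.closedForm_of_pos hq2 hq1).symm

theorem continuousAt_closedForm_slice (H : EqParams α γ θ μ) {x t : ℝ} (hx : x ≠ 0)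
    (ht : 0 < t) : ContinuousAt (fun x => closedForm α γ θ μ x t) x :=
  ContinuousAt.comp (f := fun x : ℝ => ((x, t) : ℝ × ℝ))
    (H.continuousAt_closedForm (p := (x, t)) hx ht) (by fun_prop)

theorem tendsto_profile (H : EqParams α γ θ μ) {ρ : ℝ} (hρ : KernelParams α γ ρ) {l : ℝ}
    (hl : 0 < l) (A : ℂ) :
    Tendsto (fun x : ℝ => A * (((1 / x : ℝ) : ℂ) * barnes α γ ρ (x / l))) atTop (𝓝 0) := by
  obtain ⟨C, hC, hb⟩ := hρ.exists_norm_barnes_le H.γ_le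
  have hlim : Tendsto (fun x : ℝ => ‖A‖ * C / x) atTop (𝓝 0) :=
    tendsto_const_nhds.div_atTop tendsto_id
  refine squeeze_zero_norm' ?_ hlim
  filter_upwards [eventually_ge_atTop l] with x hx
  have hx0 : 0 < x := hl.trans_le hx
  have h1 : 1 ≤ x / l := (one_le_div hl).2 hx
  have h2 := (hb (x / l) (by positivity)).2
  have h3 : (x / l) ^ (-(γ / 4)) ≤ 1 :=
    Real.rpow_le_one_of_one_le_of_nonpos h1 (by have := H.γ_pos; linarith)
  rw [norm_mul, norm_mul, Complex.norm_real, Real.norm_of_nonneg (by positivity)]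
  calc _ ≤ ‖A‖ * (1 / x * (C * 1)) := by
        gcongr
        exact h2.trans (by gcongr)
    _ = _ := by ring

theorem tendsto_closedForm_atTop (H : EqParams α γ θ μ) {t : ℝ} (ht : 0 < t) :
    Tendsto (fun x => closedForm α γ θ μ x t) atTop (𝓝 0) := by
  refine (H.tendsto_profile H.kernelParams_pos (H.scale_pos ht)
    ((t ^ (α - 1) / γ : ℝ) : ℂ)).congr' ?_
  filter_upwards [eventually_gt_atTop 0] with x hx
  exact (H.closedForm_of_pos hx ht).symm

theorem tendsto_closedForm_atBot (H : EqParams α γ θ μ) {t : ℝ} (ht : 0 < t) :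
    Tendsto (fun x => closedForm α γ θ μ x t) atBot (𝓝 0) := by
  have h : Tendsto (fun x => closedForm α γ θ μ (-x) t) atTop (𝓝 0) := by
    refine (H.tendsto_profile H.kernelParams_neg (H.scale_pos ht)
      ((t ^ (α - 1) / γ : ℝ) : ℂ)).congr' ?_
    filter_upwards [eventually_gt_atTop 0] with x hx
    exact (H.closedForm_neg_of_pos hx ht).symm
  simpa [Function.comp_def] using h.comp tendsto_neg_atBot_atTop

end EqParams

/-- `N` agrees with the closed form away from `x = 0`. -/
def IsClosedForm (α γ θ μ : ℝ) (N : ℝ → ℝ → ℂ) : Prop :=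
  ∀ x t : ℝ, x ≠ 0 → 0 < t → N x t = closedForm α γ θ μ x t

namespace EqParams

variable {α γ θ μ : ℝ} {N : ℝ → ℝ → ℂ}

theorem exists_sliceNorm_eq (H : EqParams α γ θ μ) (hN : IsClosedForm α γ θ μ N) :
    ∃ K : ℝ, 0 ≤ K ∧ ∀ t : ℝ, 0 < t → sliceNorm N t = K * t ^ (α - 1) := by
  have hγ := H.γ_pos
  refine ⟨((∫ x in Ioi (0 : ℝ), ‖((1 / x : ℝ) : ℂ) * barnes α γ ((γ - θ) / (2 * γ)) x‖) +
    ∫ x in Ioi (0 : ℝ), ‖((1 / x : ℝ) : ℂ) * barnes α γ ((γ + θ) / (2 * γ)) x‖) / γ,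
    div_nonneg (add_nonneg (integral_nonneg fun _ => norm_nonneg _)
      (integral_nonneg fun _ => norm_nonneg _)) hγ.le, fun t ht => ?_⟩
  have hA : ‖((t ^ (α - 1) / γ : ℝ) : ℂ)‖ = t ^ (α - 1) / γ := by
    rw [Complex.norm_real, Real.norm_of_nonneg (by positivity)]
  rw [sliceNorm, integral_split (H.integrable_slice ht fun x hx => hN x t hx ht).2.2.norm]
  have e1 : ∫ x in Ioi (0 : ℝ), ‖N x t‖ = t ^ (α - 1) / γ *
      ∫ x in Ioi (0 : ℝ), ‖((1 / x : ℝ) : ℂ) * barnes α γ ((γ - θ) / (2 * γ)) x‖ := by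
    rw [← integral_norm_barnes_scaled α γ _ (H.scale_pos ht), ← integral_const_mul]
    refine setIntegral_congr_fun measurableSet_Ioi fun x hx => ?_
    have hx' : (0 : ℝ) < x := hx
    rw [hN x t hx'.ne' ht, H.closedForm_of_pos hx' ht, norm_mul, hA]
  have e2 : ∫ x in Ioi (0 : ℝ), ‖N (-x) t‖ = t ^ (α - 1) / γ *
      ∫ x in Ioi (0 : ℝ), ‖((1 / x : ℝ) : ℂ) * barnes α γ ((γ + θ) / (2 * γ)) x‖ := by
    rw [← integral_norm_barnes_scaled α γ _ (H.scale_pos ht), ← integral_const_mul]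
    refine setIntegral_congr_fun measurableSet_Ioi fun x hx => ?_
    have hx' : (0 : ℝ) < x := hx
    rw [hN (-x) t (neg_ne_zero.2 hx'.ne') ht, H.closedForm_neg_of_pos hx' ht, norm_mul, hA]
  rw [e1, e2]
  ring

theorem integrableOn_Ioc_rpow (H : EqParams α γ θ μ) (T : ℝ) :
    IntegrableOn (fun t : ℝ => t ^ (α - 1)) (Ioc 0 T) := by
  rcases le_or_gt T 0 with h | h
  · rw [Ioc_eq_empty (not_lt.2 h)]
    exact integrableOn_empty
  · exact (intervalIntegrable_iff_integrableOn_Ioc_of_le h.le).1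
      (intervalIntegral.intervalIntegrable_rpow' (by have := H.α_pos; linarith))

theorem slabIntegrable (H : EqParams α γ θ μ) (hN : IsClosedForm α γ θ μ N) :
    SlabIntegrable N := by
  have hslice : ∀ t : ℝ, 0 < t → Integrable fun x => N x t := fun t ht =>
    (H.integrable_slice ht fun x hx => hN x t hx ht).2.2
  refine ⟨fun T hT => ?_, hslice⟩
  obtain ⟨K, hK, hnorm⟩ := H.exists_sliceNorm_eq hN
  have hopen : IsOpen ({0}ᶜ ×ˢ Ioi 0 : Set (ℝ × ℝ)) := isOpen_compl_singleton.prod isOpen_Ioi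
  have hcont : ContinuousOn (fun p : ℝ × ℝ => N p.1 p.2) ({0}ᶜ ×ˢ Ioi 0) := by
    refine ContinuousOn.congr (f := fun p : ℝ × ℝ => closedForm α γ θ μ p.1 p.2)
      (fun p hp => (H.continuousAt_closedForm hp.1 hp.2).continuousWithinAt)
      (fun p hp => hN p.1 p.2 hp.1 hp.2)
  -- The closed form is continuous off x = 0, and the arbitrary values on that line sit on a null
  -- set.
  have hm1 : AEStronglyMeasurable (fun p : ℝ × ℝ => N p.1 p.2)
      ((volume.prod volume).restrict ({0}ᶜ ×ˢ Ioc 0 T)) :=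
    (hcont.aestronglyMeasurable (μ := volume.prod volume) hopen.measurableSet).mono_set
      (prod_mono subset_rfl Ioc_subset_Ioi_self)
  have hm : AEStronglyMeasurable (fun p : ℝ × ℝ => N p.1 p.2)
      (volume.prod (volume.restrict (Ioc 0 T))) := by
    rwa [← Measure.prod_restrict, Measure.restrict_congr_set (s := {0}ᶜ) (t := univ),
      Measure.restrict_univ] at hm1
    exact ae_eq_univ.2 (by simp)
  have hint : Integrable (fun p : ℝ × ℝ => N p.1 p.2)
      (volume.prod (volume.restrict (Ioc 0 T))) := by
    rw [integrable_prod_iff' hm]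
    constructor
    · filter_upwards [ae_restrict_mem measurableSet_Ioc] with t ht
      exact hslice t ht.1
    · refine IntegrableOn.congr_fun (f := fun t => K * t ^ (α - 1))
        ((H.integrableOn_Ioc_rpow T).const_mul K) (fun t ht => ?_) measurableSet_Ioc
      exact (hnorm t ht.1).symm
  rwa [IntegrableOn, Measure.volume_eq_prod, ← Measure.prod_restrict, Measure.restrict_univ]

theorem sliceStar_eq (H : EqParams α γ θ μ) (hN : IsClosedForm α γ θ μ N) {t : ℝ} (ht : 0 < t)
    {k : ℝ} (hk : k ≠ 0) :
    sliceStar N k t =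
      ((t ^ (α - 1) : ℝ) : ℂ) * mlBarnes α α (freqLog γ θ μ k + α * Real.log t) :=
  H.fourierStar_closedForm ht (fun x hx => hN x t hx ht) hk

theorem integral_rl_sliceStar (H : EqParams α γ θ μ) (hN : IsClosedForm α γ θ μ N) {t : ℝ}
    (ht : 0 < t) {k : ℝ} (hk : k ≠ 0) {b : ℝ} (hb : 0 < b) :
    ∫ τ in Ioc 0 t, (((t - τ) ^ (b - 1) : ℝ) : ℂ) * sliceStar N k τ =
      Real.Gamma b * (((t ^ (α + b - 1) : ℝ) : ℂ) *
        mlBarnes α (α + b) (freqLog γ θ μ k + α * Real.log t)) := by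
  rw [← integral_rl_mlBarnes H.α_pos H.sector' (abs_freqLog_im_le γ θ μ k) hb ht,
    intervalIntegral.integral_of_le ht.le]
  refine setIntegral_congr_fun measurableSet_Ioc fun τ hτ => ?_
  rw [H.sliceStar_eq hN hτ.1 hk]

/-- Orders 1-α and 1 of the Riemann–Liouville integral produce E_{α,1} and t^α E_{α,1+α}, which the
recurrence connects. This is the Cauchy problem at a fixed frequency, integrated in time, the 1
being the transform of δ. -/
theorem rlIntegral_sliceStar (H : EqParams α γ θ μ) (hN : IsClosedForm α γ θ μ N) {t : ℝ}
    (ht : 0 < t) {k : ℝ} (hk : k ≠ 0) :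
    rlIntegral (1 - α) (sliceStar N k) t =
      1 - μ * rieszFellerSymbol γ θ k * starPrimitive N k t := by
  have hμ := H.μ_pos
  have h1 : rlIntegral (1 - α) (sliceStar N k) t =
      mlBarnes α 1 (freqLog γ θ μ k + α * Real.log t) := by
    rcases H.α_le.eq_or_lt with h | h
    · rw [rlIntegral, if_pos (by linarith), H.sliceStar_eq hN ht hk, h]
      simp
    · rw [rlIntegral, if_neg (by linarith), intervalIntegral.integral_of_le ht.le,
        H.integral_rl_sliceStar hN ht hk (sub_pos.2 h)]
      have hG : ((Real.Gamma (1 - α) : ℝ) : ℂ) ≠ 0 :=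
        Complex.ofReal_ne_zero.2 (Real.Gamma_pos_of_pos (sub_pos.2 h)).ne'
      rw [show α + (1 - α) - 1 = 0 by ring, show α + (1 - α) = 1 by ring, Real.rpow_zero,
        Complex.ofReal_one, one_mul, ← mul_assoc, one_div, inv_mul_cancel₀ hG, one_mul]
  have h2 : starPrimitive N k t =
      ((t ^ α : ℝ) : ℂ) * mlBarnes α (1 + α) (freqLog γ θ μ k + α * Real.log t) := by
    have := H.integral_rl_sliceStar hN ht hk one_pos
    simp only [sub_self, Real.rpow_zero, Complex.ofReal_one, one_mul, Real.Gamma_one,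
      add_sub_cancel_right] at this
    rw [starPrimitive, this, add_comm 1 α]
  have him : |(freqLog γ θ μ k + α * Real.log t).im| ≤ |θ| * Real.pi / 2 := by
    have : (freqLog γ θ μ k + α * Real.log t).im = (freqLog γ θ μ k).im := by simp
    rw [this]
    exact abs_freqLog_im_le γ θ μ k
  rw [h1, h2, mlBarnes_one_eq H.α_pos H.sector' him, Complex.exp_add, exp_freqLog γ θ hμ hk,
    Real.rpow_def_of_pos ht, Complex.ofReal_exp]
  push_cast
  rw [mul_comm (α : ℂ)]
  ring

end EqParams

/-- The pairing of `-μ D_θ^γ N(·,t)` with `φ`. -/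
def symbolPairing (γ θ μ : ℝ) (N : ℝ → ℝ → ℂ) (φ : 𝓢(ℝ, ℂ)) (t : ℝ) : ℂ :=
  1 / (2 * (Real.pi : ℂ)) * ∫ k, multiplier γ θ μ φ k * sliceStar N k t

theorem mul_rieszFeller_eq_symbolPairing (γ θ μ : ℝ) (N : ℝ → ℝ → ℂ) (φ : 𝓢(ℝ, ℂ)) (t : ℝ) :
    μ * rieszFeller γ θ (fun x => N x t) φ = -symbolPairing γ θ μ N φ t :=
  mul_rieszFeller_eq γ θ μ _ φ

theorem SlabIntegrable.integrable_mul_starPrimitive {N : ℝ → ℝ → ℂ} (H : SlabIntegrable N)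
    {G : ℝ → ℂ} (hG : Integrable G) {t : ℝ} (ht : 0 < t) :
    Integrable fun k => G k * starPrimitive N k t :=
  hG.mul_bdd (c := ∫ τ in Ioc 0 t, sliceNorm N τ)
    (H.continuous_starPrimitive.comp (by fun_prop : Continuous fun k : ℝ =>
      ((k, t) : ℝ × ℝ))).aestronglyMeasurable
    (ae_of_all _ fun k => H.norm_starPrimitive_le ht le_rfl k)

theorem SlabIntegrable.integral_symbolPairing {N : ℝ → ℝ → ℂ} (H : SlabIntegrable N) {γ : ℝ}
    (hγ : 0 < γ) (hγ2 : γ ≤ 2) (θ μ : ℝ) (φ : 𝓢(ℝ, ℂ)) {t : ℝ} (ht : 0 < t) :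
    IntervalIntegrable (symbolPairing γ θ μ N φ) volume 0 t ∧
    ∫ s in (0 : ℝ)..t, symbolPairing γ θ μ N φ s =
      1 / (2 * (Real.pi : ℂ)) * ∫ k, multiplier γ θ μ φ k * starPrimitive N k t := by
  have hG := integrable_multiplier hγ hγ2 θ μ φ
  refine ⟨(intervalIntegrable_iff_integrableOn_Ioc_of_le ht.le).2
    ((H.integrableOn_integral_mul ht hG).const_mul _), ?_⟩
  rw [intervalIntegral.integral_of_le ht.le]
  simp only [symbolPairing, starPrimitive]
  rw [integral_const_mul, H.integral_integral_mul ht hG]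

theorem tendsto_intervalIntegral_zero {u : ℝ → ℂ} (hu : IntervalIntegrable u volume 0 1) :
    Tendsto (fun t => ∫ s in (0 : ℝ)..t, u s) (𝓝[>] 0) (𝓝 0) := by
  have h := intervalIntegral.continuousOn_primitive_interval' hu left_mem_uIcc 0 left_mem_uIcc
  rw [ContinuousWithinAt, intervalIntegral.integral_same, uIcc_of_le zero_le_one] at h
  refine h.mono_left ?_
  rw [← nhdsWithin_Ioo_eq_nhdsGT (zero_lt_one' ℝ)]
  exact nhdsWithin_mono _ Ioo_subset_Icc_self

theorem apply_zero_eq (φ : 𝓢(ℝ, ℂ)) :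
    φ 0 = 1 / (2 * (Real.pi : ℂ)) * ∫ k, dualTransform φ k := by
  simpa using schwartz_inversion φ 0

namespace EqParams

variable {α γ θ μ : ℝ} {N : ℝ → ℝ → ℂ}

theorem integrableOn_rl_sliceNorm (H : EqParams α γ θ μ) (hN : IsClosedForm α γ θ μ N)
    (h : α < 1) {t : ℝ} (ht : 0 < t) :
    IntegrableOn (fun τ => ‖(((t - τ) ^ (1 - α - 1) : ℝ) : ℂ)‖ * sliceNorm N τ) (Ioc 0 t) := by
  obtain ⟨K, hK, hnorm⟩ := H.exists_sliceNorm_eq hN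
  refine IntegrableOn.congr_fun ((integrableOn_rl_rpow (sub_pos.2 h) H.α_pos ht).const_mul K)
    (fun τ hτ => ?_) measurableSet_Ioc
  rw [hnorm τ hτ.1, Complex.norm_real, Real.norm_of_nonneg (Real.rpow_nonneg (sub_nonneg.2 hτ.2) _)]
  ring

/-- The identity for fixed k is integrated against `dualTransform φ`; Fourier inversion turns the
constant 1 into `φ 0`. The equation and the initial condition are both read off from here. -/
theorem rlIntegral_pairing (H : EqParams α γ θ μ) (hN : IsClosedForm α γ θ μ N) (φ : 𝓢(ℝ, ℂ))
    {t : ℝ} (ht : 0 < t) :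
    rlIntegral (1 - α) (pairing N φ) t =
      φ 0 - ∫ s in (0 : ℝ)..t, symbolPairing γ θ μ N φ s := by
  have hS := H.slabIntegrable hN
  have h1 : rlIntegral (1 - α) (pairing N φ) t = 1 / (2 * (Real.pi : ℂ)) *
      ∫ k, dualTransform φ k * rlIntegral (1 - α) (sliceStar N k) t := by
    rcases H.α_le.eq_or_lt with h | h
    · simp only [rlIntegral, if_pos (show 1 - α = 0 by linarith)]
      exact hS.pairing_eq φ ht
    · simp only [rlIntegral, if_neg (show ¬ 1 - α = 0 by linarith),
        intervalIntegral.integral_of_le ht.le]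
      have hκ := hS.integral_kernel_mul ht (integrable_dualTransform φ)
        (κ := fun τ => (((t - τ) ^ (1 - α - 1) : ℝ) : ℂ))
        (Measurable.aestronglyMeasurable (by fun_prop)) (H.integrableOn_rl_sliceNorm hN h ht)
      have e : ∫ τ in Ioc 0 t, (((t - τ) ^ (1 - α - 1) : ℝ) : ℂ) * pairing N φ τ =
          1 / (2 * (Real.pi : ℂ)) * ∫ τ in Ioc 0 t, (((t - τ) ^ (1 - α - 1) : ℝ) : ℂ) *
            ∫ k, dualTransform φ k * sliceStar N k τ := by
        rw [← integral_const_mul]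
        refine setIntegral_congr_fun measurableSet_Ioc fun τ hτ => ?_
        rw [hS.pairing_eq φ hτ.1]
        ring
      rw [e, hκ, mul_left_comm, ← integral_const_mul]
      congr 1
      refine integral_congr_ae (ae_of_all _ fun k => ?_)
      simp only
      ring
  have hne : ∀ᵐ k : ℝ, k ≠ 0 := by simp [ae_iff, measure_singleton]
  have h2 : ∫ k, dualTransform φ k * rlIntegral (1 - α) (sliceStar N k) t =
      (∫ k, dualTransform φ k) - ∫ k, multiplier γ θ μ φ k * starPrimitive N k t := by
    rw [← integral_sub (integrable_dualTransform φ)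
      (hS.integrable_mul_starPrimitive (integrable_multiplier H.γ_pos H.γ_le θ μ φ) ht)]
    refine integral_congr_ae ?_
    filter_upwards [hne] with k hk
    rw [H.rlIntegral_sliceStar hN ht hk, multiplier]
    ring
  rw [h1, h2, (hS.integral_symbolPairing H.γ_pos H.γ_le θ μ φ ht).2, apply_zero_eq]
  ring

/-- Continuity in t is what lets the integrated equation be differentiated at every t. Near t₀ the
transforms are bounded by K (t₀/2)^{α-1}, because α ≤ 1 makes the power nonincreasing. -/
theorem continuousOn_symbolPairing (H : EqParams α γ θ μ) (hN : IsClosedForm α γ θ μ N)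
    (φ : 𝓢(ℝ, ℂ)) : ContinuousOn (symbolPairing γ θ μ N φ) (Ioi 0) := by
  have hS := H.slabIntegrable hN
  have hG := integrable_multiplier H.γ_pos H.γ_le θ μ φ
  obtain ⟨K, hK, hnorm⟩ := H.exists_sliceNorm_eq hN
  refine continuousOn_const.mul fun t₀ ht₀ => ContinuousAt.continuousWithinAt ?_
  have ht₀' : (0 : ℝ) < t₀ := ht₀
  have hnear : ∀ᶠ t in 𝓝 t₀, t₀ / 2 < t := lt_mem_nhds (by linarith)
  have hne : ∀ᵐ k : ℝ, k ≠ 0 := by simp [ae_iff, measure_singleton]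
  refine continuousAt_of_dominated
    (bound := fun k => ‖multiplier γ θ μ φ k‖ * (K * (t₀ / 2) ^ (α - 1))) ?_ ?_
    (hG.norm.mul_const _) ?_
  · filter_upwards [hnear] with t ht
    exact hG.aestronglyMeasurable.mul
      (continuous_fourierStar (hS.slice t (by linarith))).aestronglyMeasurable
  · filter_upwards [hnear] with t ht
    refine ae_of_all _ fun k => ?_
    rw [norm_mul]
    gcongr
    refine (norm_sliceStar_le N k t).trans ?_
    rw [hnorm t (by linarith)]
    gcongr ?_ * ?_
    exact Real.rpow_le_rpow_of_nonpos (by linarith) ht.le (by linarith [H.α_le])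
  · filter_upwards [hne] with k hk
    refine continuousAt_const.mul ?_
    have hev : ∀ᶠ t in 𝓝 t₀, ((t ^ (α - 1) : ℝ) : ℂ) *
        mlBarnes α α (freqLog γ θ μ k + α * Real.log t) = sliceStar N k t := by
      filter_upwards [hnear] with t ht
      exact (H.sliceStar_eq hN (by linarith) hk).symm
    refine ContinuousAt.congr ?_ hev
    refine ContinuousAt.mul ?_ ?_
    · exact Complex.continuous_ofReal.continuousAt.comp
        (Real.continuousAt_rpow_const _ _ (Or.inl ht₀'.ne'))
    · have hc := continuousOn_mlBarnes α H.α_pos H.sector'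
      have harg : ∀ t : ℝ, freqLog γ θ μ k + α * Real.log t ∈
          {ζ : ℂ | |ζ.im| ≤ |θ| * Real.pi / 2} := by
        intro t
        have : (freqLog γ θ μ k + α * Real.log t).im = (freqLog γ θ μ k).im := by simp
        rw [mem_ofPred_eq, this]
        exact abs_freqLog_im_le γ θ μ k
      have hlog : ContinuousAt (fun t : ℝ => freqLog γ θ μ k + α * Real.log t) t₀ :=
        continuousAt_const.add (continuousAt_const.mul
          (Complex.continuous_ofReal.continuousAt.comp (Real.continuousAt_log ht₀'.ne')))
      exact (hc _ (harg t₀)).tendsto.comp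
        (tendsto_nhdsWithin_iff.2 ⟨hlog, Eventually.of_forall harg⟩)

theorem hasDerivAt_rlIntegral_pairing (H : EqParams α γ θ μ) (hN : IsClosedForm α γ θ μ N)
    (φ : 𝓢(ℝ, ℂ)) {t : ℝ} (ht : 0 < t) :
    HasDerivAt (rlIntegral (1 - α) (pairing N φ)) (-symbolPairing γ θ μ N φ t) t := by
  have hS := H.slabIntegrable hN
  have hc := H.continuousOn_symbolPairing hN φ
  have h1 := intervalIntegral.integral_hasDerivAt_right
    (hS.integral_symbolPairing H.γ_pos H.γ_le θ μ φ ht).1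
    (hc.stronglyMeasurableAtFilter isOpen_Ioi t ht) (hc.continuousAt (Ioi_mem_nhds ht))
  refine (h1.const_sub (φ 0)).congr_of_eventuallyEq ?_
  filter_upwards [lt_mem_nhds ht] with s hs
  exact H.rlIntegral_pairing hN φ hs

theorem tendsto_rlIntegral_pairing (H : EqParams α γ θ μ) (hN : IsClosedForm α γ θ μ N)
    (φ : 𝓢(ℝ, ℂ)) :
    Tendsto (rlIntegral (1 - α) (pairing N φ)) (𝓝[>] 0) (𝓝 (φ 0)) := by
  have hS := H.slabIntegrable hN
  have h4 := (tendsto_intervalIntegral_zero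
    (hS.integral_symbolPairing H.γ_pos H.γ_le θ μ φ one_pos).1).const_sub (φ 0)
  rw [sub_zero] at h4
  refine h4.congr' ?_
  filter_upwards [self_mem_nhdsWithin] with t ht
  exact (H.rlIntegral_pairing hN φ ht).symm

theorem hasRLDerivAt_pairing (H : EqParams α γ θ μ) (hN : IsClosedForm α γ θ μ N)
    (φ : 𝓢(ℝ, ℂ)) {t : ℝ} (ht : 0 < t) :
    HasRLDerivAt α (pairing N φ) (μ * rieszFeller γ θ (fun x => N x t) φ) t := by
  have hS := H.slabIntegrable hN
  rw [mul_rieszFeller_eq_symbolPairing]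
  rcases H.α_le.eq_or_lt with h | h
  -- For α = 1 the definition has n = 2: the derivative is the second derivative of the ordinary
  -- primitive, so the first derivative must first be recognized as the pairing itself.
  · have hfl : ⌊α⌋₊ = 1 := by rw [h]; exact Nat.floor_one
    have e1 : ((1 + 1 : ℕ) : ℝ) - α = 1 := by rw [h]; norm_num
    have hrl : rlIntegral 1 (pairing N φ) = fun s => ∫ τ in (0 : ℝ)..s, pairing N φ τ := by
      funext s
      simp [rlIntegral]
    have hU : ∀ s, HasDerivAt (pairing N φ) (-symbolPairing γ θ μ N φ s) s ∨ s ≤ 0 := by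
      intro s
      rcases le_or_gt s 0 with hs | hs
      · exact Or.inr hs
      · left
        have := H.hasDerivAt_rlIntegral_pairing hN φ hs
        have h0 : rlIntegral (1 - α) (pairing N φ) = pairing N φ := by
          funext r
          rw [rlIntegral, if_pos (by linarith)]
        rwa [h0] at this
    have hU' : ∀ s, 0 < s → HasDerivAt (pairing N φ) (-symbolPairing γ θ μ N φ s) s := fun s hs =>
      (hU s).resolve_right (not_le.2 hs)
    have hcont : ContinuousOn (pairing N φ) (Ioi 0) := fun s hs =>
      (hU' s hs).continuousAt.continuousWithinAt
    have hint : ∀ s : ℝ, 0 < s → IntervalIntegrable (pairing N φ) volume 0 s := fun s hs =>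
      (intervalIntegrable_iff_integrableOn_Ioc_of_le hs.le).2 (hS.integrableOn_pairing φ hs)
    have hV : ∀ s : ℝ, 0 < s → HasDerivAt (rlIntegral 1 (pairing N φ)) (pairing N φ s) s := by
      intro s hs
      rw [hrl]
      exact intervalIntegral.integral_hasDerivAt_right (hint s hs)
        (hcont.stronglyMeasurableAtFilter isOpen_Ioi s hs) (hU' s hs).continuousAt
    rw [HasRLDerivAt, hfl, e1]
    refine ⟨?_, fun j hj => ?_, ?_⟩
    · filter_upwards [lt_mem_nhds ht] with s hs
      simpa using hint s hs
    · have hj0 : j = 0 := by omega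
      filter_upwards [lt_mem_nhds ht] with s hs
      rw [hj0, iteratedDeriv_zero]
      exact (hV s hs).differentiableAt
    · rw [iteratedDeriv_one]
      refine (hU' t ht).congr_of_eventuallyEq ?_
      filter_upwards [lt_mem_nhds ht] with s hs
      exact (hV s hs).deriv
  · have hfl : ⌊α⌋₊ = 0 := Nat.floor_eq_zero.2 h
    have e1 : ((0 + 1 : ℕ) : ℝ) - α = 1 - α := by norm_num
    rw [HasRLDerivAt, hfl, e1]
    refine ⟨?_, fun j hj => absurd hj (Nat.not_lt_zero j), ?_⟩
    · filter_upwards [lt_mem_nhds ht] with s hs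
      refine (intervalIntegrable_iff_integrableOn_Ioc_of_le hs.le).2 ?_
      have hκ := hS.integrableOn_kernel_mul hs (integrable_dualTransform φ)
        (κ := fun τ => (((s - τ) ^ (1 - α - 1) : ℝ) : ℂ))
        (Measurable.aestronglyMeasurable (by fun_prop)) (H.integrableOn_rl_sliceNorm hN h hs)
      refine IntegrableOn.congr_fun (hκ.const_mul (1 / (2 * (Real.pi : ℂ)))) (fun τ hτ => ?_)
        measurableSet_Ioc
      rw [hS.pairing_eq φ hτ.1]
      ring
    · rw [iteratedDeriv_zero]
      exact H.hasDerivAt_rlIntegral_pairing hN φ ht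

theorem isFundamentalSolution (H : EqParams α γ θ μ) (hN : IsClosedForm α γ θ μ N) :
    IsFundamentalSolution α γ θ μ N where
  integrableOn_slab := (H.slabIntegrable hN).slab
  integrable_slice := (H.slabIntegrable hN).slice
  equation φ _ ht := H.hasRLDerivAt_pairing hN φ ht
  initial φ := H.tendsto_rlIntegral_pairing hN φ
  tendsto_atTop t ht := by
    refine (H.tendsto_closedForm_atTop ht).congr' ?_
    filter_upwards [eventually_gt_atTop 0] with x hx
    exact (hN x t hx.ne' ht).symm
  tendsto_atBot t ht := by
    refine (H.tendsto_closedForm_atBot ht).congr' ?_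
    filter_upwards [eventually_lt_atBot 0] with x hx
    exact (hN x t hx.ne ht).symm

end EqParams

/-! ### The composition of Riemann-Liouville integrals of orders `1 - α` and `α` -/

/-- This is the Beta integral B(α, 1-α). The exponents add up to -1, so the value does not depend on
the length of the interval. -/
theorem integral_rl_rpow_shift {α : ℝ} (h0 : 0 < α) (h1 : α < 1) {τ t : ℝ} (h : τ < t) :
    IntegrableOn (fun s => (t - s) ^ (α - 1) * (s - τ) ^ (1 - α - 1)) (Ioc τ t) ∧
    ∫ s in Ioc τ t, (t - s) ^ (α - 1) * (s - τ) ^ (1 - α - 1) =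
      Real.Gamma α * Real.Gamma (1 - α) := by
  have hq : 0 < 1 - α := sub_pos.2 h1
  have ht : 0 < t - τ := sub_pos.2 h
  set f : ℝ → ℝ := fun r => (t - τ - r) ^ (α - 1) * r ^ (1 - α - 1) with hf
  have hfs : (fun s => (t - s) ^ (α - 1) * (s - τ) ^ (1 - α - 1)) = fun s => f (s - τ) := by
    funext s
    simp only [hf]
    rw [show t - τ - (s - τ) = t - s by ring]
  have hint : IntervalIntegrable f volume 0 (t - τ) :=
    (intervalIntegrable_iff_integrableOn_Ioc_of_le ht.le).2 (integrableOn_rl_rpow h0 hq ht)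
  have hval : ∫ r in (0 : ℝ)..(t - τ), f r = Real.Gamma α * Real.Gamma (1 - α) := by
    have hC := integral_rl_cpow h0 (p := ((1 - α : ℝ) : ℂ)) (by simpa using h1) ht
    have e : ∫ r in (0 : ℝ)..(t - τ), (((t - τ - r) ^ (α - 1) : ℝ) : ℂ) *
        (r : ℂ) ^ (((1 - α : ℝ) : ℂ) - 1) = ∫ r in (0 : ℝ)..(t - τ), ((f r : ℝ) : ℂ) := by
      refine intervalIntegral.integral_congr fun r hr => ?_
      rw [uIcc_of_le ht.le] at hr
      simp only [hf]
      rw [Complex.ofReal_mul, Complex.ofReal_cpow hr.1]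
      push_cast
      ring
    rw [e, intervalIntegral.integral_ofReal] at hC
    have e2 : ((1 - α : ℝ) : ℂ) + (α : ℂ) = 1 := by push_cast; ring
    rw [e2, sub_self, Complex.cpow_zero, Complex.Gamma_one, inv_one, mul_one, one_mul,
      Complex.Gamma_ofReal, Complex.Gamma_ofReal, ← Complex.ofReal_mul] at hC
    exact_mod_cast hC
  rw [hfs]
  refine ⟨(intervalIntegrable_iff_integrableOn_Ioc_of_le h.le).1 ?_, ?_⟩
  · have := hint.comp_sub_right τ
    simpa using this
  · rw [← intervalIntegral.integral_of_le h.le, intervalIntegral.integral_comp_sub_right, sub_self,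
      hval]

/-- The kernel of the iterated Riemann-Liouville integral. -/
def iteratedKernel (α t : ℝ) (p : ℝ × ℝ) : ℝ :=
  {q : ℝ × ℝ | q.2 < q.1}.indicator
    (fun q => (t - q.1) ^ (α - 1) * (q.1 - q.2) ^ (1 - α - 1)) p

theorem measurable_iteratedKernel (α t : ℝ) : Measurable (iteratedKernel α t) :=
  Measurable.indicator (by fun_prop) (measurableSet_lt measurable_snd measurable_fst)

theorem iteratedKernel_nonneg {α t : ℝ} {p : ℝ × ℝ} (hp : p.1 ≤ t) : 0 ≤ iteratedKernel α t p := by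
  by_cases h : p ∈ {q : ℝ × ℝ | q.2 < q.1}
  · have h' : p.2 < p.1 := h
    rw [iteratedKernel, indicator_of_mem h]
    exact mul_nonneg (Real.rpow_nonneg (sub_nonneg.2 hp) _)
      (Real.rpow_nonneg (sub_nonneg.2 h'.le) _)
  · rw [iteratedKernel, indicator_of_notMem h]

theorem iteratedKernel_eq_indicator (α t τ : ℝ) :
    (fun s => iteratedKernel α t (s, τ)) = (Ioi τ).indicator
      (fun s => (t - s) ^ (α - 1) * (s - τ) ^ (1 - α - 1)) := by
  funext s
  simp only [iteratedKernel, indicator_apply, mem_Ioi]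
  rfl

theorem integral_iteratedKernel {α : ℝ} (h0 : 0 < α) (h1 : α < 1) {τ t : ℝ} (hτ : 0 < τ)
    (h : τ < t) :
    IntegrableOn (fun s => iteratedKernel α t (s, τ)) (Ioc 0 t) ∧
    ∫ s in Ioc 0 t, iteratedKernel α t (s, τ) = Real.Gamma α * Real.Gamma (1 - α) := by
  have hs := integral_rl_rpow_shift h0 h1 h
  have hset : Ioi τ ∩ Ioc 0 t = Ioc τ t := by
    ext s
    simp only [mem_inter_iff, mem_Ioi, mem_Ioc]
    exact ⟨fun h => ⟨h.1, h.2.2⟩, fun h => ⟨h.1, hτ.trans h.1, h.2⟩⟩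
  rw [iteratedKernel_eq_indicator]
  constructor
  · rw [IntegrableOn, integrable_indicator_iff measurableSet_Ioi, IntegrableOn,
      Measure.restrict_restrict measurableSet_Ioi, hset]
    exact hs.1
  · rw [integral_indicator measurableSet_Ioi, Measure.restrict_restrict measurableSet_Ioi, hset,
      hs.2]

/-- Fubini on the triangle τ < s ≤ t: the inner integral in s is the constant Γ(α)Γ(1-α), so orders
α and 1-α compose to the plain primitive. -/
theorem integral_rl_comp {α : ℝ} (h0 : 0 < α) (h1 : α < 1) {u : ℝ → ℂ} {t : ℝ}
    (hu : IntegrableOn u (Ioc 0 t)) :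
    ∫ s in Ioc 0 t, (((t - s) ^ (α - 1) : ℝ) : ℂ) *
      ∫ τ in Ioc 0 s, (((s - τ) ^ (1 - α - 1) : ℝ) : ℂ) * u τ =
      Real.Gamma α * Real.Gamma (1 - α) * ∫ τ in Ioc 0 t, u τ := by
  set ν := volume.restrict (Ioc 0 t) with hν
  have hmem : ∀ᵐ τ ∂ν, τ ∈ Ioo 0 t := by
    rw [hν, ← restrict_Ioo_eq_restrict_Ioc]
    exact ae_restrict_mem measurableSet_Ioo
  have hint : Integrable (fun p : ℝ × ℝ => ((iteratedKernel α t p : ℝ) : ℂ) * u p.2)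
      (ν.prod ν) := by
    have hm : AEStronglyMeasurable (fun p : ℝ × ℝ => ((iteratedKernel α t p : ℝ) : ℂ) * u p.2)
        (ν.prod ν) :=
      (Complex.measurable_ofReal.comp (measurable_iteratedKernel α t)).aestronglyMeasurable.mul
        hu.aestronglyMeasurable.comp_snd
    rw [integrable_prod_iff' hm]
    constructor
    · filter_upwards [hmem] with τ hτ
      exact (integral_iteratedKernel h0 h1 hτ.1 hτ.2).1.ofReal.mul_const _
    · refine Integrable.congr (hu.norm.const_mul (Real.Gamma α * Real.Gamma (1 - α))) ?_
      filter_upwards [hmem] with τ hτ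
      rw [← (integral_iteratedKernel h0 h1 hτ.1 hτ.2).2, ← integral_mul_const]
      refine setIntegral_congr_fun measurableSet_Ioc fun s hs => ?_
      rw [norm_mul, Complex.norm_real, Real.norm_of_nonneg (iteratedKernel_nonneg hs.2)]
  have hswap := integral_integral_swap
    (f := fun s τ => ((iteratedKernel α t (s, τ) : ℝ) : ℂ) * u τ) hint
  have e1 : ∫ s in Ioc 0 t, (((t - s) ^ (α - 1) : ℝ) : ℂ) *
      ∫ τ in Ioc 0 s, (((s - τ) ^ (1 - α - 1) : ℝ) : ℂ) * u τ =
      ∫ s, ∫ τ, ((iteratedKernel α t (s, τ) : ℝ) : ℂ) * u τ ∂ν ∂ν := by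
    refine setIntegral_congr_fun measurableSet_Ioc fun s hs => ?_
    have hset : Iio s ∩ Ioc 0 t = Ioo 0 s := by
      ext τ
      simp only [mem_inter_iff, mem_Iio, mem_Ioc, mem_Ioo]
      exact ⟨fun h => ⟨h.2.1, h.1⟩, fun h => ⟨h.2, h.1, h.2.le.trans hs.2⟩⟩
    have hfun : (fun τ => ((iteratedKernel α t (s, τ) : ℝ) : ℂ) * u τ) = (Iio s).indicator
        (fun τ => (((t - s) ^ (α - 1) : ℝ) : ℂ) *
          ((((s - τ) ^ (1 - α - 1) : ℝ) : ℂ) * u τ)) := by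
      funext τ
      simp only [iteratedKernel, indicator_apply, mem_Iio, mem_ofPred_eq]
      split_ifs
      · push_cast
        ring
      · simp
    rw [hfun, integral_indicator measurableSet_Iio, hν,
      Measure.restrict_restrict measurableSet_Iio, hset, integral_const_mul, integral_Ioc_eq_integral_Ioo]
  rw [e1, hswap, ← integral_const_mul]
  refine integral_congr_ae ?_
  filter_upwards [hmem] with τ hτ
  rw [integral_mul_const, integral_complex_ofReal, (integral_iteratedKernel h0 h1 hτ.1 hτ.2).2]
  push_cast
  rfl

/-! ### A weakly singular Volterra equation -/

theorem integral_rl_exp_le {α σ t : ℝ} (hα : 0 < α) (hσ : 0 < σ) (ht : 0 ≤ t) :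
    IntegrableOn (fun s => (t - s) ^ (α - 1) * Real.exp (-(σ * (t - s)))) (Ioc 0 t) ∧
    ∫ s in Ioc 0 t, (t - s) ^ (α - 1) * Real.exp (-(σ * (t - s))) ≤
      (1 / σ) ^ α * Real.Gamma α := by
  set f : ℝ → ℝ := fun r => r ^ (α - 1) * Real.exp (-(σ * r)) with hf
  have hI : IntegrableOn f (Ioi 0) := by
    refine Integrable.of_integral_ne_zero ?_
    rw [hf, Real.integral_rpow_mul_exp_neg_mul_Ioi hα hσ]
    exact (mul_pos (by positivity) (Real.Gamma_pos_of_pos hα)).ne'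
  have hI' : IntervalIntegrable f volume 0 t :=
    (intervalIntegrable_iff_integrableOn_Ioc_of_le ht).2 (hI.mono_set Ioc_subset_Ioi_self)
  constructor
  · have := (hI'.comp_sub_left t).symm
    simp only [sub_self, sub_zero] at this
    exact (intervalIntegrable_iff_integrableOn_Ioc_of_le ht).1 this
  · rw [← intervalIntegral.integral_of_le ht]
    have e := intervalIntegral.integral_comp_sub_left (a := 0) (b := t) f t
    simp only [sub_self, sub_zero] at e
    simp only [hf] at e
    rw [e, intervalIntegral.integral_of_le ht, ← Real.integral_rpow_mul_exp_neg_mul_Ioi hα hσ]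
    refine setIntegral_mono_set hI ?_ Ioc_subset_Ioi_self.eventuallyLE
    filter_upwards [ae_restrict_mem measurableSet_Ioi] with r hr
    exact mul_nonneg (Real.rpow_nonneg (le_of_lt hr) _) (Real.exp_pos _).le

/-- An exponential weight turns the Volterra operator into a contraction. If M is the maximum of
|D(s)| exp(-σs) on [0,T], the equation at the maximum point gives M ≤ |c| σ^{-α} M ≤ M/2 for σ
large, hence M = 0. -/
theorem eq_zero_of_volterra {α : ℝ} (hα : 0 < α) {D : ℝ → ℂ} (hD : Continuous D) (c : ℂ)
    (h0 : D 0 = 0)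
    (h : ∀ t : ℝ, 0 < t → Real.Gamma α * D t =
      c * ∫ s in Ioc 0 t, (((t - s) ^ (α - 1) : ℝ) : ℂ) * D s) {T : ℝ} (hT : 0 < T) :
    D T = 0 := by
  have hΓ := Real.Gamma_pos_of_pos hα
  obtain ⟨σ, hσ, hσc⟩ : ∃ σ : ℝ, 0 < σ ∧ ‖c‖ * (1 / σ) ^ α ≤ 1 / 2 := by
    have h1 : Tendsto (fun σ : ℝ => ‖c‖ * σ ^ (-α)) atTop (𝓝 (‖c‖ * 0)) :=
      (tendsto_rpow_neg_atTop hα).const_mul _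
    rw [mul_zero] at h1
    obtain ⟨σ, h2, h3⟩ := ((h1.eventually (ge_mem_nhds (show (0 : ℝ) < 1 / 2 by norm_num))).and
      (eventually_gt_atTop 0)).exists
    refine ⟨σ, h3, ?_⟩
    rwa [one_div, Real.inv_rpow (le_of_lt h3), ← Real.rpow_neg (le_of_lt h3)]
  obtain ⟨t, ht, hmax⟩ := isCompact_Icc.exists_isMaxOn (nonempty_Icc.2 hT.le)
    (show ContinuousOn (fun s => ‖D s‖ * Real.exp (-(σ * s))) (Icc 0 T) by fun_prop)
  set M := ‖D t‖ * Real.exp (-(σ * t)) with hM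
  have hle : ∀ s ∈ Icc 0 T, ‖D s‖ ≤ M * Real.exp (σ * s) := by
    intro s hs
    have h1 : ‖D s‖ * Real.exp (-(σ * s)) ≤ M := hmax hs
    rw [Real.exp_neg, ← div_eq_mul_inv, div_le_iff₀ (Real.exp_pos _)] at h1
    exact h1
  have hM0 : M ≤ 0 := by
    rcases ht.1.eq_or_lt with h' | ht0
    · rw [hM, ← h', h0]
      simp
    have hMnn : 0 ≤ M := by positivity
    obtain ⟨hi, hb⟩ := integral_rl_exp_le hα hσ ht.1
    have h1 : ‖∫ s in Ioc 0 t, (((t - s) ^ (α - 1) : ℝ) : ℂ) * D s‖ ≤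
        ∫ s in Ioc 0 t, M * Real.exp (σ * t) *
          ((t - s) ^ (α - 1) * Real.exp (-(σ * (t - s)))) := by
      refine norm_integral_le_of_norm_le (hi.const_mul _) ?_
      filter_upwards [ae_restrict_mem measurableSet_Ioc] with s hs
      have hts : 0 ≤ (t - s) ^ (α - 1) := Real.rpow_nonneg (sub_nonneg.2 hs.2) _
      rw [norm_mul, Complex.norm_real, Real.norm_of_nonneg hts]
      calc _ ≤ (t - s) ^ (α - 1) * (M * Real.exp (σ * s)) := by
            gcongr
            exact hle s ⟨hs.1.le, hs.2.trans ht.2⟩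
        _ = _ := by
          rw [show σ * s = σ * t + -(σ * (t - s)) by ring, Real.exp_add]
          ring
    rw [integral_const_mul] at h1
    have h2 : Real.Gamma α * ‖D t‖ ≤
        ‖c‖ * (M * Real.exp (σ * t) * ((1 / σ) ^ α * Real.Gamma α)) := by
      have := congrArg norm (h t ht0)
      rw [norm_mul, norm_mul, Complex.norm_real, Real.norm_of_nonneg hΓ.le] at this
      rw [this]
      gcongr
      exact h1.trans (by gcongr)
    have h3 : Real.Gamma α * ‖D t‖ ≤ Real.Gamma α * (M * Real.exp (σ * t) * (1 / 2)) := by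
      refine h2.trans ?_
      calc _ = Real.Gamma α * (M * Real.exp (σ * t) * (‖c‖ * (1 / σ) ^ α)) := by ring
        _ ≤ _ := by gcongr
    have h4 := le_of_mul_le_mul_left h3 hΓ
    have h5 : ‖D t‖ = M * Real.exp (σ * t) := by
      rw [hM, mul_assoc, ← Real.exp_add, neg_add_cancel, Real.exp_zero, mul_one]
    rw [h5] at h4
    have h6 := Real.exp_pos (σ * t)
    by_contra hcon
    push Not at hcon
    have := mul_pos hcon h6
    linarith
  have h1 := hle T ⟨hT.le, le_rfl⟩
  have h2 : M * Real.exp (σ * T) ≤ 0 := mul_nonpos_of_nonpos_of_nonneg hM0 (Real.exp_pos _).le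
  exact norm_le_zero_iff.1 (h1.trans h2)

/-! ### The equation of a fundamental solution in integrated form -/

theorem eq_sub_integral_of_hasDerivAt {J σ : ℝ → ℂ} {a : ℂ}
    (hσ : ∀ t, 0 < t → IntervalIntegrable σ volume 0 t)
    (hJ : ∀ t, 0 < t → HasDerivAt J (-σ t) t) (h0 : Tendsto J (𝓝[>] 0) (𝓝 a)) {t : ℝ}
    (ht : 0 < t) : J t = a - ∫ s in (0 : ℝ)..t, σ s := by
  have h := intervalIntegral.integral_eq_sub_of_hasDerivAt_of_tendsto ht
    (fun s hs => hJ s hs.1) (hσ t ht).neg h0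
    ((hJ t ht).continuousAt.tendsto.mono_left nhdsWithin_le_nhds)
  rw [intervalIntegral.integral_neg] at h
  linear_combination -h

/-- Needed for α = 1, where the initial condition concerns the pairing and not the function whose
derivative appears in the equation. -/
theorem exists_tendsto_of_hasDerivAt {J σ : ℝ → ℂ}
    (hσ : ∀ t, 0 < t → IntervalIntegrable σ volume 0 t)
    (hJ : ∀ t, 0 < t → HasDerivAt J (-σ t) t) : ∃ a, Tendsto J (𝓝[>] 0) (𝓝 a) := by
  refine ⟨J 1 + ∫ s in (0 : ℝ)..1, σ s, ?_⟩
  have h := (tendsto_intervalIntegral_zero (hσ 1 one_pos)).const_sub (J 1 + ∫ s in (0 : ℝ)..1, σ s)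
  rw [sub_zero] at h
  refine h.congr' ?_
  filter_upwards [self_mem_nhdsWithin] with t ht
  have ht' : (0 : ℝ) < t := ht
  have h1 : ∀ s ∈ uIcc t 1, HasDerivAt J (-σ s) s := fun s hs =>
    hJ s ((lt_min ht' one_pos).trans_le hs.1)
  have hti : IntervalIntegrable σ volume t 1 := (hσ t ht').symm.trans (hσ 1 one_pos)
  have h2 := intervalIntegral.integral_eq_sub_of_hasDerivAt h1 hti.neg
  rw [intervalIntegral.integral_neg] at h2
  rw [← intervalIntegral.integral_add_adjacent_intervals (hσ t ht') hti]
  linear_combination -h2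

/-- The right derivative of `V` at 0 is computed twice: from the limit of `u`, because `V` is its
primitive, and from the limit of V' = J. No equality of `u` and `J` at individual times is assumed.
-/
theorem eq_of_tendsto_deriv_of_tendsto {V J u : ℝ → ℂ} {a b : ℂ}
    (hV : ∀ t, 0 < t → HasDerivAt V (J t) t)
    (hVu : ∀ t, 0 ≤ t → V t = ∫ s in (0 : ℝ)..t, u s)
    (hu : IntervalIntegrable u volume 0 1)
    (hua : Tendsto u (𝓝[>] 0) (𝓝 a)) (hJ : Tendsto J (𝓝[>] 0) (𝓝 b)) : b = a := by
  have hm : StronglyMeasurableAtFilter u (𝓝[>] 0) volume :=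
    ⟨Ioc 0 1, Ioc_mem_nhdsGT one_pos,
      ((intervalIntegrable_iff_integrableOn_Ioc_of_le zero_le_one).1 hu).aestronglyMeasurable⟩
  have h1 : HasDerivWithinAt V a (Ici 0) 0 := by
    refine (intervalIntegral.integral_hasDerivWithinAt_of_tendsto_ae_right (a := 0)
      IntervalIntegrable.refl hm (hua.mono_left inf_le_left)).congr (fun t ht => hVu t ht)
      (hVu 0 le_rfl)
  have hV0 : V 0 = 0 := by rw [hVu 0 le_rfl, intervalIntegral.integral_same]
  have h2 : HasDerivWithinAt V b (Ici 0) 0 := by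
    refine hasDerivWithinAt_Ici_of_tendsto_deriv (s := Ioi 0)
      (fun t ht => (hV t ht).differentiableAt.differentiableWithinAt) ?_ self_mem_nhdsWithin ?_
    · exact h1.continuousWithinAt.mono Ioi_subset_Ici_self
    · refine hJ.congr' ?_
      filter_upwards [self_mem_nhdsWithin] with t ht
      exact (hV t ht).deriv.symm
  exact (uniqueDiffOn_Ici (0 : ℝ) 0 self_mem_Ici).eq_deriv _ h2 h1

theorem rlIntegral_one (u : ℝ → ℂ) : rlIntegral 1 u = fun t => ∫ s in (0 : ℝ)..t, u s := by
  funext t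
  simp [rlIntegral]

namespace IsFundamentalSolution

variable {α γ θ μ : ℝ} {N : ℝ → ℝ → ℂ}

theorem slabIntegrable (hN : IsFundamentalSolution α γ θ μ N) : SlabIntegrable N :=
  ⟨hN.integrableOn_slab, hN.integrable_slice⟩

/-- J lies one derivative below the Riemann–Liouville derivative: it is the integral of order 1-α of
the pairing if α < 1, and the derivative of its primitive if α = 1. Introducing it lets both cases
be treated alike afterwards. -/
theorem exists_flux (H : EqParams α γ θ μ) (hN : IsFundamentalSolution α γ θ μ N)
    (φ : 𝓢(ℝ, ℂ)) :
    ∃ J : ℝ → ℂ, (∀ t, 0 < t → HasDerivAt J (-symbolPairing γ θ μ N φ t) t) ∧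
      Tendsto J (𝓝[>] 0) (𝓝 (φ 0)) ∧
      ∀ t, 0 < t → Real.Gamma α * ∫ τ in Ioc 0 t, pairing N φ τ =
        ∫ s in Ioc 0 t, (((t - s) ^ (α - 1) : ℝ) : ℂ) * J s := by
  have hS := hN.slabIntegrable
  have hσ := fun t ht => (hS.integral_symbolPairing H.γ_pos H.γ_le θ μ φ (t := t) ht).1
  have heq := hN.equation φ
  simp only [mul_rieszFeller_eq_symbolPairing] at heq
  have hini := hN.initial φ
  rcases H.α_le.eq_or_lt with h | h
  · have hfl : ⌊α⌋₊ = 1 := by rw [h]; exact Nat.floor_one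
    have e1 : ((1 + 1 : ℕ) : ℝ) - α = 1 := by rw [h]; norm_num
    simp only [HasRLDerivAt, hfl, e1] at heq
    have e0 : rlIntegral (1 - α) (pairing N φ) = pairing N φ := by
      funext s
      rw [rlIntegral, if_pos (by linarith)]
    rw [e0] at hini
    set V := rlIntegral 1 (pairing N φ) with hVdef
    have hVd : ∀ t, 0 < t → HasDerivAt V (deriv V t) t := by
      intro t ht
      have := ((heq t ht).2.1 0 zero_lt_one).self_of_nhds
      rw [iteratedDeriv_zero] at this
      exact this.hasDerivAt
    have hJ : ∀ t, 0 < t → HasDerivAt (deriv V) (-symbolPairing γ θ μ N φ t) t := by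
      intro t ht
      have := (heq t ht).2.2
      rwa [iteratedDeriv_one] at this
    have hu : ∀ t, 0 < t → IntervalIntegrable (pairing N φ) volume 0 t := fun t ht =>
      (intervalIntegrable_iff_integrableOn_Ioc_of_le ht.le).2 (hS.integrableOn_pairing φ ht)
    have hVu : ∀ t, V t = ∫ s in (0 : ℝ)..t, pairing N φ s := fun t => by
      rw [hVdef, rlIntegral_one]
    obtain ⟨b, hb⟩ := exists_tendsto_of_hasDerivAt hσ hJ
    have hba : b = φ 0 :=
      eq_of_tendsto_deriv_of_tendsto hVd (fun t _ => hVu t) (hu 1 one_pos) hini hb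
    rw [hba] at hb
    refine ⟨deriv V, hJ, hb, fun t ht => ?_⟩
    have hJi : IntervalIntegrable (deriv V) volume 0 t := by
      refine IntervalIntegrable.congr_uIoo (f := fun s => φ 0 - ∫ r in (0 : ℝ)..s,
        symbolPairing γ θ μ N φ r) (ContinuousOn.intervalIntegrable ?_) fun s hs => ?_
      · exact continuousOn_const.sub
          (intervalIntegral.continuousOn_primitive_interval' (hσ t ht) left_mem_uIcc)
      · rw [uIoo_of_le ht.le] at hs
        exact (eq_sub_integral_of_hasDerivAt hσ hJ hb hs.1).symm
    have hV0 : Tendsto V (𝓝[>] 0) (𝓝 0) := by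
      simp only [funext hVu]
      exact tendsto_intervalIntegral_zero (hu 1 one_pos)
    have hV1 := intervalIntegral.integral_eq_sub_of_hasDerivAt_of_tendsto ht
      (fun s hs => hVd s hs.1) hJi hV0
      ((hVd t ht).continuousAt.tendsto.mono_left nhdsWithin_le_nhds)
    rw [h, Real.Gamma_one, Complex.ofReal_one, one_mul, sub_self]
    simp only [Real.rpow_zero, Complex.ofReal_one, one_mul]
    rw [← intervalIntegral.integral_of_le ht.le, ← intervalIntegral.integral_of_le ht.le, hV1,
      sub_zero, hVu]
  · have hfl : ⌊α⌋₊ = 0 := Nat.floor_eq_zero.2 h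
    have e1 : ((0 + 1 : ℕ) : ℝ) - α = 1 - α := by norm_num
    simp only [HasRLDerivAt, hfl, e1, iteratedDeriv_zero] at heq
    refine ⟨_, fun t ht => (heq t ht).2.2, hini, fun t ht => ?_⟩
    have hc := integral_rl_comp H.α_pos h (hS.integrableOn_pairing φ ht)
    have hG : ((Real.Gamma (1 - α) : ℝ) : ℂ) ≠ 0 :=
      Complex.ofReal_ne_zero.2 (Real.Gamma_pos_of_pos (sub_pos.2 h)).ne'
    have e2 : ∫ s in Ioc 0 t, (((t - s) ^ (α - 1) : ℝ) : ℂ) * rlIntegral (1 - α) (pairing N φ) s =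
        (Real.Gamma (1 - α) : ℂ)⁻¹ * ∫ s in Ioc 0 t, (((t - s) ^ (α - 1) : ℝ) : ℂ) *
          ∫ τ in Ioc 0 s, (((s - τ) ^ (1 - α - 1) : ℝ) : ℂ) * pairing N φ τ := by
      rw [← integral_const_mul]
      refine setIntegral_congr_fun measurableSet_Ioc fun s hs => ?_
      rw [rlIntegral, if_neg (by linarith), intervalIntegral.integral_of_le hs.1.le]
      ring
    rw [e2, hc]
    field_simp

/-- Continuity of `symbolPairing` is not available for a general solution. Its primitive is φ(0) -
J, however, and J is differentiable at every t > 0 by the equation; this later gives uniqueness at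
every time and not just at almost every one. -/
theorem hasDerivAt_integral_symbolPairing (H : EqParams α γ θ μ)
    (hN : IsFundamentalSolution α γ θ μ N) (φ : 𝓢(ℝ, ℂ)) {t : ℝ} (ht : 0 < t) :
    HasDerivAt (fun t => ∫ s in (0 : ℝ)..t, symbolPairing γ θ μ N φ s)
      (symbolPairing γ θ μ N φ t) t := by
  obtain ⟨J, hJ, h0, -⟩ := hN.exists_flux H φ
  have hσ := fun t ht =>
    (hN.slabIntegrable.integral_symbolPairing H.γ_pos H.γ_le θ μ φ (t := t) ht).1
  refine (((hJ t ht).const_sub (φ 0)).congr_deriv (neg_neg _)).congr_of_eventuallyEq ?_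
  filter_upwards [lt_mem_nhds ht] with s hs
  rw [eq_sub_integral_of_hasDerivAt hσ hJ h0 hs]
  ring

theorem gamma_mul_integral_pairing (H : EqParams α γ θ μ)
    (hN : IsFundamentalSolution α γ θ μ N) (φ : 𝓢(ℝ, ℂ)) {t : ℝ} (ht : 0 < t) :
    Real.Gamma α * ∫ τ in Ioc 0 t, pairing N φ τ =
      ∫ s in Ioc 0 t, (((t - s) ^ (α - 1) : ℝ) : ℂ) *
        (φ 0 - ∫ r in (0 : ℝ)..s, symbolPairing γ θ μ N φ r) := by
  obtain ⟨J, hJ, h0, h1⟩ := hN.exists_flux H φ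
  have hσ := fun t ht =>
    (hN.slabIntegrable.integral_symbolPairing H.γ_pos H.γ_le θ μ φ (t := t) ht).1
  rw [h1 t ht]
  refine setIntegral_congr_fun measurableSet_Ioc fun s hs => ?_
  rw [eq_sub_integral_of_hasDerivAt hσ hJ h0 hs.1]

end IsFundamentalSolution

/-! ### The Volterra equation in frequency space and uniqueness -/

theorem integrableOn_rl_kernel {α t : ℝ} (hα : 0 < α) (ht : 0 < t) :
    IntegrableOn (fun s => (t - s) ^ (α - 1)) (Ioc 0 t) := by
  simpa using integrableOn_rl_rpow hα one_pos ht

theorem integral_rl_kernel {α t : ℝ} (hα : 0 < α) (ht : 0 < t) :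
    ∫ s in Ioc 0 t, (t - s) ^ (α - 1) = t ^ α / α := by
  have e := intervalIntegral.integral_comp_sub_left (a := 0) (b := t)
    (fun r : ℝ => r ^ (α - 1)) t
  rw [← intervalIntegral.integral_of_le ht.le, e, sub_self, sub_zero,
    integral_rpow (Or.inl (by linarith)), sub_add_cancel, Real.zero_rpow hα.ne', sub_zero]

/-- `Γ(α)` times the Riemann-Liouville integral of order `α` of `starPrimitive`. -/
def rlPrimitive (α : ℝ) (N : ℝ → ℝ → ℂ) (k t : ℝ) : ℂ :=
  ∫ s in Ioc 0 t, (((t - s) ^ (α - 1) : ℝ) : ℂ) * starPrimitive N k s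

namespace SlabIntegrable

variable {N : ℝ → ℝ → ℂ}

theorem norm_rl_starPrimitive_le (H : SlabIntegrable N) (α : ℝ) {s t : ℝ} (ht : 0 < t)
    (hs : s ≤ t) (k : ℝ) :
    ‖(((t - s) ^ (α - 1) : ℝ) : ℂ) * starPrimitive N k s‖ ≤
      (t - s) ^ (α - 1) * ∫ τ in Ioc 0 t, sliceNorm N τ := by
  have h := Real.rpow_nonneg (sub_nonneg.2 hs) (α - 1)
  rw [norm_mul, Complex.norm_real, Real.norm_of_nonneg h]
  exact mul_le_mul_of_nonneg_left (H.norm_starPrimitive_le ht hs k) h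

theorem measurable_rl_starPrimitive (H : SlabIntegrable N) (α t : ℝ) :
    Measurable fun p : ℝ × ℝ => (((t - p.2) ^ (α - 1) : ℝ) : ℂ) * starPrimitive N p.1 p.2 :=
  (Complex.measurable_ofReal.comp (by fun_prop)).mul H.continuous_starPrimitive.measurable

theorem integrableOn_rl_starPrimitive (H : SlabIntegrable N) {α t : ℝ} (hα : 0 < α) (ht : 0 < t)
    (k : ℝ) :
    IntegrableOn (fun s => (((t - s) ^ (α - 1) : ℝ) : ℂ) * starPrimitive N k s) (Ioc 0 t) := by
  refine ((integrableOn_rl_kernel hα ht).mul_const (∫ τ in Ioc 0 t, sliceNorm N τ)).mono'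
    ((H.measurable_rl_starPrimitive α t).comp measurable_prodMk_left).aestronglyMeasurable ?_
  filter_upwards [ae_restrict_mem measurableSet_Ioc] with s hs
  exact H.norm_rl_starPrimitive_le α ht hs.2 k

theorem continuous_rlPrimitive (H : SlabIntegrable N) {α t : ℝ} (hα : 0 < α) (ht : 0 < t) :
    Continuous fun k => rlPrimitive α N k t := by
  refine continuous_of_dominated
    (bound := fun s => (t - s) ^ (α - 1) * ∫ τ in Ioc 0 t, sliceNorm N τ)
    (fun k => (H.integrableOn_rl_starPrimitive hα ht k).aestronglyMeasurable) (fun k => ?_)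
    ((integrableOn_rl_kernel hα ht).mul_const _) (ae_of_all _ fun s => ?_)
  · filter_upwards [ae_restrict_mem measurableSet_Ioc] with s hs
    exact H.norm_rl_starPrimitive_le α ht hs.2 k
  · exact continuous_const.mul (H.continuous_starPrimitive.comp (by fun_prop : Continuous
      fun k : ℝ => ((k, s) : ℝ × ℝ)))

theorem norm_rlPrimitive_le (H : SlabIntegrable N) {α t : ℝ} (hα : 0 < α) (ht : 0 < t) (k : ℝ) :
    ‖rlPrimitive α N k t‖ ≤ ∫ s in Ioc 0 t, (t - s) ^ (α - 1) * ∫ τ in Ioc 0 t, sliceNorm N τ := by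
  refine norm_integral_le_of_norm_le ((integrableOn_rl_kernel hα ht).mul_const _) ?_
  filter_upwards [ae_restrict_mem measurableSet_Ioc] with s hs
  exact H.norm_rl_starPrimitive_le α ht hs.2 k

theorem integrable_mul_rlPrimitive (H : SlabIntegrable N) {α t : ℝ} (hα : 0 < α) (ht : 0 < t)
    {G : ℝ → ℂ} (hG : Integrable G) : Integrable fun k => G k * rlPrimitive α N k t :=
  hG.mul_bdd (c := ∫ s in Ioc 0 t, (t - s) ^ (α - 1) * ∫ τ in Ioc 0 t, sliceNorm N τ)
    (H.continuous_rlPrimitive hα ht).aestronglyMeasurable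
    (ae_of_all _ (H.norm_rlPrimitive_le hα ht))

theorem integral_rl_integral_starPrimitive (H : SlabIntegrable N) {α t : ℝ} (hα : 0 < α)
    (ht : 0 < t) {G : ℝ → ℂ} (hG : Integrable G) :
    IntegrableOn (fun s => (((t - s) ^ (α - 1) : ℝ) : ℂ) * ∫ k, G k * starPrimitive N k s)
      (Ioc 0 t) ∧
    ∫ s in Ioc 0 t, (((t - s) ^ (α - 1) : ℝ) : ℂ) * ∫ k, G k * starPrimitive N k s =
      ∫ k, G k * rlPrimitive α N k t := by
  have hint : Integrable (fun p : ℝ × ℝ => G p.1 *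
      ((((t - p.2) ^ (α - 1) : ℝ) : ℂ) * starPrimitive N p.1 p.2))
      (volume.prod (volume.restrict (Ioc 0 t))) := by
    refine (hG.norm.mul_prod ((integrableOn_rl_kernel hα ht).mul_const
      (∫ τ in Ioc 0 t, sliceNorm N τ))).mono'
      (hG.aestronglyMeasurable.comp_fst.mul
        (H.measurable_rl_starPrimitive α t).aestronglyMeasurable) ?_
    have hmem : ∀ᵐ p : ℝ × ℝ ∂(volume.prod (volume.restrict (Ioc 0 t))), p.2 ∈ Ioc 0 t :=
      Measure.quasiMeasurePreserving_snd.ae (ae_restrict_mem measurableSet_Ioc)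
    filter_upwards [hmem] with p hp
    rw [norm_mul]
    gcongr
    exact H.norm_rl_starPrimitive_le α ht hp.2 p.1
  have e : ∀ s, ∫ k, G k * ((((t - s) ^ (α - 1) : ℝ) : ℂ) * starPrimitive N k s) =
      (((t - s) ^ (α - 1) : ℝ) : ℂ) * ∫ k, G k * starPrimitive N k s := by
    intro s
    rw [← integral_const_mul]
    refine integral_congr_ae (ae_of_all _ fun k => ?_)
    simp only
    ring
  constructor
  · refine hint.integral_prod_right.congr (ae_of_all _ fun s => ?_)
    exact e s
  · have hswap := integral_integral_swap
      (f := fun k s => G k * ((((t - s) ^ (α - 1) : ℝ) : ℂ) * starPrimitive N k s)) hint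
    simp only [e, integral_const_mul] at hswap
    exact hswap.symm

end SlabIntegrable

namespace IsFundamentalSolution

variable {α γ θ μ : ℝ} {N M : ℝ → ℝ → ℂ}

/-- The integrated equation, moved to the frequency side by Parseval and Fubini, holds against every
`dualTransform`. Both sides are continuous in k, so it holds at every k. -/
theorem starPrimitive_volterra (H : EqParams α γ θ μ) (hN : IsFundamentalSolution α γ θ μ N)
    (k : ℝ) {t : ℝ} (ht : 0 < t) :
    Real.Gamma α * starPrimitive N k t =
      ((t ^ α / α : ℝ) : ℂ) - μ * rieszFellerSymbol γ θ k * rlPrimitive α N k t := by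
  have hS := hN.slabIntegrable
  have hα := H.α_pos
  set F : ℝ → ℂ := fun k => Real.Gamma α * starPrimitive N k t - (((t ^ α / α : ℝ) : ℂ) -
    μ * rieszFellerSymbol γ θ k * rlPrimitive α N k t) with hF
  have hW : Continuous fun k => starPrimitive N k t :=
    hS.continuous_starPrimitive.comp (by fun_prop : Continuous fun k : ℝ => ((k, t) : ℝ × ℝ))
  have hFc : Continuous F :=
    (continuous_const.mul hW).sub (continuous_const.sub ((continuous_const.mul
      (continuous_rieszFellerSymbol H.γ_pos θ)).mul (hS.continuous_rlPrimitive hα ht)))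
  have hF0 : ∀ φ : 𝓢(ℝ, ℂ), ∫ k, dualTransform φ k * F k = 0 := by
    intro φ
    have hg := integrable_dualTransform φ
    have hG := integrable_multiplier H.γ_pos H.γ_le θ μ φ
    have h1 := hN.gamma_mul_integral_pairing H φ ht
    obtain ⟨hri, hr⟩ := hS.integral_rl_integral_starPrimitive hα ht hG
    have hp : ∫ τ in Ioc 0 t, pairing N φ τ =
        1 / (2 * (Real.pi : ℂ)) * ∫ k, dualTransform φ k * starPrimitive N k t := by
      simp only [starPrimitive]
      rw [← hS.integral_integral_mul ht hg, ← integral_const_mul]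
      exact setIntegral_congr_fun measurableSet_Ioc fun τ hτ => hS.pairing_eq φ hτ.1
    have hq : ∫ s in Ioc 0 t, (((t - s) ^ (α - 1) : ℝ) : ℂ) *
        (φ 0 - ∫ r in (0 : ℝ)..s, symbolPairing γ θ μ N φ r) =
        1 / (2 * (Real.pi : ℂ)) * (((t ^ α / α : ℝ) : ℂ) * (∫ k, dualTransform φ k) -
          ∫ k, multiplier γ θ μ φ k * rlPrimitive α N k t) := by
      have hi0 : IntegrableOn (fun s => (((t - s) ^ (α - 1) : ℝ) : ℂ) *
          ∫ k, dualTransform φ k) (Ioc 0 t) :=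
        Integrable.mul_const (integrableOn_rl_kernel hα ht).ofReal _
      rw [← hr, ← integral_rl_kernel hα ht, ← integral_complex_ofReal, ← integral_mul_const,
        ← integral_sub hi0 hri,
        ← integral_const_mul]
      refine setIntegral_congr_fun measurableSet_Ioc fun s hs => ?_
      rw [(hS.integral_symbolPairing H.γ_pos H.γ_le θ μ φ hs.1).2, apply_zero_eq]
      ring
    rw [hp, hq] at h1
    have hi1 := (hS.integrable_mul_starPrimitive hg ht).const_mul (Real.Gamma α : ℂ)
    have hi2 := hg.const_mul ((t ^ α / α : ℝ) : ℂ)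
    have hi3 := hS.integrable_mul_rlPrimitive hα ht hG
    have hi4 : Integrable fun k => ((t ^ α / α : ℝ) : ℂ) * dualTransform φ k -
        multiplier γ θ μ φ k * rlPrimitive α N k t := hi2.sub hi3
    have e : ∫ k, dualTransform φ k * F k =
        Real.Gamma α * (∫ k, dualTransform φ k * starPrimitive N k t) -
          (((t ^ α / α : ℝ) : ℂ) * (∫ k, dualTransform φ k) -
            ∫ k, multiplier γ θ μ φ k * rlPrimitive α N k t) := by
      rw [← integral_const_mul, ← integral_const_mul, ← integral_sub hi2 hi3,
        ← integral_sub hi1 hi4]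
      refine integral_congr_ae (ae_of_all _ fun k => ?_)
      simp only [hF, multiplier]
      ring
    rw [e]
    have hpi : (2 * (Real.pi : ℂ)) ≠ 0 := by simp [Real.pi_ne_zero]
    field_simp at h1
    linear_combination h1
  have hae := ae_eq_zero_of_dualTransform hFc.locallyIntegrable hF0
  have hFz : F = fun _ => 0 := (hFc.ae_eq_iff_eq volume continuous_const).1 hae
  exact sub_eq_zero.1 (congrFun hFz k)

theorem starPrimitive_eq (H : EqParams α γ θ μ) (hN : IsFundamentalSolution α γ θ μ N)
    (hM : IsFundamentalSolution α γ θ μ M) (k : ℝ) {t : ℝ} (ht : 0 < t) :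
    starPrimitive N k t = starPrimitive M k t := by
  have hSN := hN.slabIntegrable
  have hSM := hM.slabIntegrable
  have hc : Continuous fun s : ℝ => ((k, s) : ℝ × ℝ) := by fun_prop
  refine sub_eq_zero.1 (eq_zero_of_volterra H.α_pos
    (D := fun s => starPrimitive N k s - starPrimitive M k s)
    ((hSN.continuous_starPrimitive.comp hc).sub (hSM.continuous_starPrimitive.comp hc))
    (-(μ * rieszFellerSymbol γ θ k))
    (by simp [SlabIntegrable.starPrimitive_zero]) (fun s hs => ?_) ht)
  simp only [mul_sub]
  rw [integral_sub (hSN.integrableOn_rl_starPrimitive H.α_pos hs k)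
    (hSM.integrableOn_rl_starPrimitive H.α_pos hs k), hN.starPrimitive_volterra H k hs,
    hM.starPrimitive_volterra H k hs, rlPrimitive, rlPrimitive]
  ring

/-- Equal time primitives give equal primitives of `symbolPairing`, and differentiating these gives
equality at the given t. Then μψ is cancelled for k ≠ 0, and injectivity of the Fourier transform on
L¹ concludes. -/
theorem ae_eq (H : EqParams α γ θ μ) (hN : IsFundamentalSolution α γ θ μ N)
    (hM : IsFundamentalSolution α γ θ μ M) {t : ℝ} (ht : 0 < t) :
    (fun x => N x t) =ᵐ[volume] fun x => M x t := by
  have hSN := hN.slabIntegrable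
  have hSM := hM.slabIntegrable
  have hsp : ∀ φ, symbolPairing γ θ μ N φ t = symbolPairing γ θ μ M φ t := by
    intro φ
    refine (hN.hasDerivAt_integral_symbolPairing H φ ht).unique
      ((hM.hasDerivAt_integral_symbolPairing H φ ht).congr_of_eventuallyEq ?_)
    filter_upwards [lt_mem_nhds ht] with s hs
    rw [(hSN.integral_symbolPairing H.γ_pos H.γ_le θ μ φ hs).2,
      (hSM.integral_symbolPairing H.γ_pos H.γ_le θ μ φ hs).2]
    simp only [hN.starPrimitive_eq H hM _ hs]
  set F : ℝ → ℂ := fun k => μ * rieszFellerSymbol γ θ k * (sliceStar N k t - sliceStar M k t)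
    with hF
  have hcN : Continuous fun k => sliceStar N k t := continuous_fourierStar (hSN.slice t ht)
  have hcM : Continuous fun k => sliceStar M k t := continuous_fourierStar (hSM.slice t ht)
  have hFc : Continuous F := (continuous_const.mul
    (continuous_rieszFellerSymbol H.γ_pos θ)).mul (hcN.sub hcM)
  have hmul : ∀ (φ : 𝓢(ℝ, ℂ)) {K : ℝ → ℝ → ℂ}, SlabIntegrable K →
      Integrable fun k => multiplier γ θ μ φ k * sliceStar K k t := fun φ K hK =>
    (integrable_multiplier H.γ_pos H.γ_le θ μ φ).mul_bdd (c := sliceNorm K t)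
      (continuous_fourierStar (hK.slice t ht)).aestronglyMeasurable
      (ae_of_all _ fun k => norm_sliceStar_le K k t)
  have hF0 : ∀ φ : 𝓢(ℝ, ℂ), ∫ k, dualTransform φ k * F k = 0 := by
    intro φ
    have e : ∫ k, dualTransform φ k * F k = (∫ k, multiplier γ θ μ φ k * sliceStar N k t) -
        ∫ k, multiplier γ θ μ φ k * sliceStar M k t := by
      rw [← integral_sub (hmul φ hSN) (hmul φ hSM)]
      refine integral_congr_ae (ae_of_all _ fun k => ?_)
      simp only [hF, multiplier]
      ring
    have hpi : (1 / (2 * (Real.pi : ℂ))) ≠ 0 := by simp [Real.pi_ne_zero]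
    rw [e, sub_eq_zero]
    exact mul_left_cancel₀ hpi (hsp φ)
  have hae := ae_eq_zero_of_dualTransform hFc.locallyIntegrable hF0
  refine ae_eq_of_fourierStar_ae_eq (hSN.slice t ht) (hSM.slice t ht) ?_
  have hne : ∀ᵐ k : ℝ, k ≠ 0 := by simp [ae_iff, measure_singleton]
  filter_upwards [hae, hne] with k hk hk0
  have h1 : (μ : ℂ) * rieszFellerSymbol γ θ k ≠ 0 :=
    mul_ne_zero (Complex.ofReal_ne_zero.2 H.μ_pos.ne') (rieszFellerSymbol_ne_zero γ θ hk0)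
  exact sub_eq_zero.1 ((mul_eq_zero.1 hk).resolve_left h1)

end IsFundamentalSolution

end FracDiff

end

theorem corollary1p3 (α γ θ μ : ℝ) (hα : 0 < α) (hα1 : α ≤ 1) (hγ : 0 < γ) (hγ2 : γ ≤ 2)
    (hθ : |θ| ≤ min γ (2 - γ)) (hμ : 0 < μ)
    (hdeg : ¬ (α = 1 ∧ γ = 1 ∧ |θ| = 1)) :
    -- the H-function in the formula exists
    (∀ x t : ℝ, x ≠ 0 → 0 < t → ∃ w : ℂ,
      FracDiff.HasFoxH 2 1 (FracDiff.upperParams α γ (FracDiff.rho γ θ x))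
        (FracDiff.lowerParams γ (FracDiff.rho γ θ x)) (FracDiff.similarity α γ μ x t : ℂ) w) ∧
    -- the formula gives a fundamental solution, whatever its values at `x = 0`
    (∀ N : ℝ → ℝ → ℂ,
      (∀ x t : ℝ, x ≠ 0 → 0 < t → N x t = FracDiff.closedForm α γ θ μ x t) →
      FracDiff.IsFundamentalSolution α γ θ μ N) ∧
    -- every fundamental solution is given by the formula
    (∀ N : ℝ → ℝ → ℂ, FracDiff.IsFundamentalSolution α γ θ μ N → ∀ t : ℝ, 0 < t →
      (∀ᵐ x : ℝ, N x t = FracDiff.closedForm α γ θ μ x t) ∧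
      (∀ x : ℝ, x ≠ 0 → ContinuousAt (fun y => N y t) x →
        N x t = FracDiff.closedForm α γ θ μ x t)) := by
  have H := FracDiff.EqParams.of_hyps hα hα1 hγ hγ2 hθ hμ hdeg
  refine ⟨fun x t hx ht => ⟨_, (H.kernelParams_rho hx).hasFoxH hγ2 (H.similarity_pos hx ht)⟩,
    fun N hN => H.isFundamentalSolution hN, fun N hN t ht => ?_⟩
  have hae : ∀ᵐ x : ℝ, N x t = FracDiff.closedForm α γ θ μ x t :=
    hN.ae_eq H (H.isFundamentalSolution fun _ _ _ _ => rfl) ht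
  refine ⟨hae, fun x hx hc => ?_⟩
  -- A set of full measure is dense, so `N` and the closed form agree at points arbitrarily close to
  -- x; both are continuous at x, hence they agree there.
  have hclos : x ∈ closure {y | N y t = FracDiff.closedForm α γ θ μ y t} :=
    (Measure.dense_of_ae hae) x
  have hfreq : ∃ᶠ y in 𝓝 x, N y t = FracDiff.closedForm α γ θ μ y t :=
    mem_closure_iff_frequently.1 hclos
  by_contra hne
  exact hfreq ((hc.ne_iff_eventually_ne (H.continuousAt_closedForm_slice hx ht)).1 hne)
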